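/- Let $D_-^0\subset\mathbb R^3$ be a bounded domain with $C^{1,1}$ boundary $\Gamma^0$ (lying locally on one side of it), $D_+^0=\mathbb R^3\setminus\overline{D_-^0}$, and let $n^0$ be the outward unit normal on $\Gamma^0$. Let $\alpha_-,\alpha_+>0$, let $\kappa\in C^1(\Gamma^0)$, and let $\tilde\kappa\in C^1(\mathbb R^3)$ with compact support and a locally Lipschitz $\tilde n^0:\mathbb R^3\to\mathbb R^3$ be any extensions of $\kappa$ and $n^0$. Put $V=\tilde\kappa\,\tilde n^0$, $T^\varepsilon(x)=x+\varepsilon V(x)$, $D_-^\varepsilon=T^\varepsilon(D_-^0)$, $D_+^\varepsilon=\mathbb R^3\setminus\overline{D_-^\varepsilon}$, $\Gamma^\varepsilon=\{x+\varepsilon\kappa(x)n^0(x):x\in\Gamma^0\}$, and let $\alpha^\varepsilon=\alpha_\pm$ on $D_\pm^\varepsilon$, $\alpha=\alpha^0$. Let $$W_\varepsilon=\{v=(v_-,v_+)\in H^1(D_-^\varepsilon)\times H^1_w(D_+^\varepsilon): [v]=0 \text{ on } \partial D_-^\varepsilon\},\qquad \|v\|_{W_\varepsilon}^2=\|v_-\|_{H^1(D_-^\varepsilon)}^2+\|v_+\|_{H^1_w(D_+^\varepsilon)}^2,$$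 where $[v]=v_--v_+$ in the sense of traces and $\|v\|_{H_w^1(U)}^2=\int_U\big(|\nabla v|^2+\frac{|v|^2}{1+|x|^2}\big)dx$. Let $W_0^*$ be the dual of $W_0$ with respect to the $L^2$ inner product, and let $f\in H^1(\mathbb R^3)\cap W_0^*$. A weak solution $u^\varepsilon\in W_\varepsilon$ of $-\nabla\cdot(\alpha^\varepsilon\nabla u^\varepsilon)=f$ in $D_\pm^\varepsilon$ with $[u^\varepsilon]=[\alpha^\varepsilon\partial_n u^\varepsilon]=0$ on the interface is defined by $$\int_{D_-^\varepsilon\cup D_+^\varepsilon}\alpha^\varepsilon\nabla u^\varepsilon\cdot\nabla\varphi\,dx=\int_{\mathbb R^3}f\varphi\,dx\qquad\forall\varphi\in C_0^\infty(\mathbb R^3).$$ Then there is $\varepsilon_0>0$ such that for every $\varepsilon\in[0,\varepsilon_0]$ the map $T^\varepsilon$ is a homeomorphism of $\mathbb R^3$ with $\partial D_-^\varepsilon=\Gamma^\varepsilon$ and $T^\varepsilon(D_+^0)=D_+^\varepsilon$, and there is exactly one weak solution $u^\varepsilon\in W_\varepsilon$. Moreover, $u^\varepsilon$ has a material derivative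 in $W_0$: there is $z\in W_0$ such that $(u^\varepsilon\circ T^\varepsilon-u^0)/\varepsilon\in W_0$ for all small $\varepsilon>0$ and $$\lim_{\varepsilon\to0^+}\Big\|\frac{u^\varepsilon\circ T^\varepsilon-u^0}{\varepsilon}-z\Big\|_{W_0}=0,$$ and $z$ is the unique element of $W_0$ satisfying, for all $w\in W_0$, $$\int_{D_-^0\cup D_+^0}\alpha\,\nabla z\cdot\nabla w\,dy=-\int_{D_-^0\cup D_+^0}\alpha\,(\nabla u^0)^\top A'(0,y)\,\nabla w\,dy+\int_{D_-^0\cup D_+^0}\operatorname{div}(Vf)\,w\,dy .$$ Here $A(\varepsilon,\cdot)=|\det J_{T^\varepsilon}|\,J_{T^\varepsilon}^{-1}J_{T^\varepsilon}^{-\top}$ with $J_{T^\varepsilon}$ the Jacobian matrix of $T^\varepsilon$, $A'(0,\cdot)$ is its derivative in $\varepsilon$ at $0$, and $\operatorname{div}$ is the distributional divergence. -/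

import Mathlib

open Set Filter Topology MeasureTheory
open scoped ContDiff

namespace Transmission

/-- Euclidean three-space. -/
abbrev E : Type := EuclideanSpace ℝ (Fin 3)

/-! ### Weak derivatives and Sobolev spaces -/

/-- `φ ∈ C_c^∞(ℝ³)`. -/
def IsTest (φ : E → ℝ) : Prop := ContDiff ℝ ∞ φ ∧ HasCompactSupport φ

/-- `g` is the weak (distributional) gradient of `v` on the open set `U`. -/
def IsWeakGrad (U : Set E) (v : E → ℝ) (g : E → E) : Prop :=
  LocallyIntegrableOn v U ∧ LocallyIntegrableOn g U ∧
    ∀ φ : E → ℝ, IsTest φ → tsupport φ ⊆ U →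
      ∫ x in U, v x • gradient φ x = - ∫ x in U, φ x • g x

open Classical in
/-- The weak gradient of `v` on `U` (unique up to a null set if it exists; `0` if there is none). -/
noncomputable def weakGrad (U : Set E) (v : E → ℝ) : E → E :=
  if h : ∃ g, IsWeakGrad U v g then h.choose else 0

/-- `d` is the distributional divergence on `ℝ³` of the vector field `F`. -/
def IsWeakDiv (F : E → E) (d : E → ℝ) : Prop :=
  LocallyIntegrable F ∧ LocallyIntegrable d ∧
    ∀ φ : E → ℝ, IsTest φ → ∫ x, inner ℝ (F x) (gradient φ x) = - ∫ x, d x * φ x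

open Classical in
/-- The distributional divergence of `F` (unique up to a null set if it is a locally integrable
function; `0` if there is none). -/
noncomputable def weakDiv (F : E → E) : E → ℝ :=
  if h : ∃ d, IsWeakDiv F d then h.choose else 0

/-- `v ∈ H¹(U)`. -/
def MemH1 (U : Set E) (v : E → ℝ) : Prop :=
  MemLp v 2 (volume.restrict U) ∧ ∃ g, IsWeakGrad U v g ∧ MemLp g 2 (volume.restrict U)

/-- `v ∈ H¹_w(U)`: the gradient and `v / √(1 + |x|²)` are square integrable on `U`. -/
def MemH1w (U : Set E) (v : E → ℝ) : Prop :=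
  MemLp (fun x => v x / √(1 + ‖x‖ ^ 2)) 2 (volume.restrict U) ∧
    ∃ g, IsWeakGrad U v g ∧ MemLp g 2 (volume.restrict U)

/-- The squared norm of `H¹(U)`. -/
noncomputable def normSqH1 (U : Set E) (v : E → ℝ) : ℝ :=
  ∫ x in U, (‖weakGrad U v x‖ ^ 2 + v x ^ 2)

/-- The squared norm of `H¹_w(U)`. -/
noncomputable def normSqH1w (U : Set E) (v : E → ℝ) : ℝ :=
  ∫ x in U, (‖weakGrad U v x‖ ^ 2 + v x ^ 2 / (1 + ‖x‖ ^ 2))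

/-! ### The weighted space of a partition `ℝ³ = closure D₋ ∪ closure D₊`

Throughout, `D` is the interior domain `D₋`. A pair `(v₋, v₊)` of functions on `D₋` and `D₊` is
represented by one function `v` on `ℝ³`; its values on the interface are irrelevant. -/

/-- The exterior domain `D₊ = ℝ³ \ closure D₋`. -/
def ext (D : Set E) : Set E := (closure D)ᶜ

open Classical in
/-- The piecewise weak gradient: that of `v₋` on `D₋` and that of `v₊` on `D₊`. -/
noncomputable def pgrad (D : Set E) (v : E → ℝ) (x : E) : E :=
  if x ∈ D then weakGrad D v x else weakGrad (ext D) v x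

/-- The classical divergence of a smooth vector field. -/
noncomputable def divergence (Φ : E → E) (x : E) : ℝ :=
  ∑ i, (fderiv ℝ Φ x (EuclideanSpace.single i 1)) i

/-- `[v] = v₋ - v₊ = 0` on the interface `Γ = ∂D` in the sense of traces, tested weakly: by Green's
formula on `D₋` and on `D₊` the integral below is `∫_Γ [v] Φ·n dσ`, with `n` the unit normal
pointing into `D₊`. -/
def JumpZero (D : Set E) (v : E → ℝ) : Prop :=
  ∀ Φ : E → E, ContDiff ℝ ∞ Φ → HasCompactSupport Φ →
    ∫ x in D ∪ ext D, (inner ℝ (pgrad D v x) (Φ x) + v x * divergence Φ x) = 0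

/-- `v ∈ W`: `v₋ ∈ H¹(D₋)`, `v₊ ∈ H¹_w(D₊)`, `[v] = 0`. -/
def MemW (D : Set E) (v : E → ℝ) : Prop :=
  MemH1 D v ∧ MemH1w (ext D) v ∧ JumpZero D v

/-- The norm of `W`. -/
noncomputable def normW (D : Set E) (v : E → ℝ) : ℝ :=
  √(normSqH1 D v + normSqH1w (ext D) v)

/-- `f ∈ W*`, the dual with respect to the `L²` inner product: `φ ↦ ∫ f φ` is bounded for the norm
of `W` on the test functions (which are dense in `W`), so it extends to a bounded functional. -/
def MemDualW (D : Set E) (f : E → ℝ) : Prop :=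
  ∃ C : ℝ, ∀ φ : E → ℝ, IsTest φ → |∫ x, f x * φ x| ≤ C * normW D φ

open Classical in
/-- The piecewise constant coefficient. -/
noncomputable def coeff (D : Set E) (αm αp : ℝ) (x : E) : ℝ := if x ∈ D then αm else αp

/-- `u ∈ W` is the weak solution of the transmission problem
`-∇·(α∇u) = f` in `D₋ ∪ D₊`, `[u] = 0` and `[α ∂u/∂n] = 0` on `Γ`, `u` decaying at infinity. -/
def IsWeakSolution (D : Set E) (αm αp : ℝ) (f u : E → ℝ) : Prop :=
  MemW D u ∧ ∀ φ : E → ℝ, IsTest φ →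
    ∫ x in D ∪ ext D, coeff D αm αp x * inner ℝ (pgrad D u x) (gradient φ x) = ∫ x, f x * φ x

/-! ### Domains of class `C^{1,1}` and their normals -/

/-- `ψ` is, near the boundary point `p`, a `C^{1,1}` defining function of `D`. -/
def IsC11DefiningFunction (D : Set E) (p : E) (ψ : E → ℝ) : Prop :=
  ∃ U : Set E, IsOpen U ∧ p ∈ U ∧ DifferentiableOn ℝ ψ U ∧
    (∃ K, LipschitzOnWith K (gradient ψ) U) ∧ gradient ψ p ≠ 0 ∧ ∀ x ∈ U, x ∈ D ↔ ψ x < 0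

/-- A bounded domain with boundary of class `C^{1,1}`, lying locally on one side of it. -/
structure IsC11Domain (D : Set E) : Prop where
  isOpen : IsOpen D
  isConnected : IsConnected D
  isBounded : Bornology.IsBounded D
  boundary : ∀ p ∈ frontier D, ∃ ψ, IsC11DefiningFunction D p ψ

/-- `n` is the outward unit normal field on the boundary of `D`. -/
def IsOutwardUnitNormal (D : Set E) (n : frontier D → E) : Prop :=
  ∀ (p : frontier D) (ψ : E → ℝ), IsC11DefiningFunction D p ψ →
    n p = ‖gradient ψ p‖⁻¹ • gradient ψ p

/-- `κ ∈ C¹(Γ)`: near each point of `Γ`, `κ` is the restriction of a `C¹` function. -/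
def IsC1OnSurface (Γ : Set E) (κ : Γ → ℝ) : Prop :=
  ∀ p : Γ, ∃ g : E → ℝ, ContDiff ℝ 1 g ∧ ∀ᶠ x in 𝓝 p, κ x = g x

/-! ### The perturbation -/

/-- The perturbed interface `Γ^ε = {x + ε κ(x) n(x) : x ∈ Γ}`. -/
def perturbedInterface (D : Set E) (κ : frontier D → ℝ) (n : frontier D → E) (ε : ℝ) : Set E :=
  Set.range fun x : frontier D => (x : E) + (ε * κ x) • n x

/-- The map `T^ε = id + ε V`. -/
def perturbMap (V : E → E) (ε : ℝ) (x : E) : E := x + ε • V x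

/-- The Jacobian matrix of `T^ε`. -/
noncomputable def jacobian (V : E → E) (ε : ℝ) (x : E) : Matrix (Fin 3) (Fin 3) ℝ :=
  Matrix.of fun i j => (fderiv ℝ (perturbMap V ε) x (EuclideanSpace.single j 1)) i

/-- `A(ε, x) = γ J⁻¹ J⁻ᵀ`, with `J` the Jacobian matrix of `T^ε` and `γ = |det J|`. -/
noncomputable def matA (V : E → E) (ε : ℝ) (x : E) : Matrix (Fin 3) (Fin 3) ℝ :=
  |(jacobian V ε x).det| • ((jacobian V ε x)⁻¹ * ((jacobian V ε x)⁻¹).transpose)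

/-- `A'(0, x)`, the derivative of `ε ↦ A(ε, x)` at `0`. -/
noncomputable def matA' (V : E → E) (x : E) : Matrix (Fin 3) (Fin 3) ℝ :=
  Matrix.of fun i j => deriv (fun ε : ℝ => matA V ε x i j) 0

/-- The difference quotient `(u^ε ∘ T^ε - u⁰) / ε`. -/
noncomputable def diffQuot (V : E → E) (u : ℝ → E → ℝ) (ε : ℝ) (x : E) : ℝ :=
  (u ε (perturbMap V ε x) - u 0 x) / ε

/-- `z` is the material derivative of `u^ε` in the space `W` of the unperturbed partition. -/
def HasMaterialDerivative (D : Set E) (V : E → E) (u : ℝ → E → ℝ) (z : E → ℝ) : Prop :=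
  MemW D z ∧ (∀ᶠ ε in 𝓝[>] (0 : ℝ), MemW D (diffQuot V u ε)) ∧
    Tendsto (fun ε => normW D (diffQuot V u ε - z)) (𝓝[>] 0) (𝓝 0)

/-- `z ∈ W` solves
`∫ α ∇z·∇w = -∫ α ∇u⁰ A'(0) (∇w)ᵀ + ∫ div(V f) w` for all `w ∈ W`. -/
def SolvesDerivativeProblem (D : Set E) (αm αp : ℝ) (V : E → E) (f u₀ z : E → ℝ) : Prop :=
  MemW D z ∧ ∀ w : E → ℝ, MemW D w →
    ∫ x in D ∪ ext D, coeff D αm αp x * inner ℝ (pgrad D z x) (pgrad D w x) =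
      - (∫ x in D ∪ ext D, coeff D αm αp x *
          ∑ i, ∑ j, pgrad D u₀ x i * matA' V x i j * pgrad D w x j) +
        ∫ x in D ∪ ext D, weakDiv (fun y => f y • V y) x * w x

end Transmission

open Transmission

/-!
The proof first removes the partition from the function spaces. A boundary of class `C^{1,1}` is a
null set, because small translates of a piece of it in the normal direction are pairwise disjoint
(`IsC11Domain.volume_frontier`), and bi-Lipschitz maps preserve null sets. The vanishing of the jump
then says exactly that the piecewise gradient is the weak gradient on the whole space, so every one
of the spaces `W_ε` is `H¹_w(ℝ³)` (`MemW.hasWGrad`, `HasWGrad.memW`), and only the coefficient of the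
equation depends on `ε`. Test functions are dense in `H¹_w(ℝ³)` (`HasWGrad.exists_test`), and
integrating `φ²` against the divergence of `x / (1 + |x|²)` gives Hardy's inequality
(`HasWGrad.hardy`): the norm is controlled by the gradient alone. The energy form is therefore
coercive, and the Lax–Milgram theorem solves the transmission problem (`exists_isWeakSolution`) as
well as the problem for the derivative (`exists_solvesDerivativeProblem`). The right-hand side is a
functional `F` on `H¹_w(ℝ³)` extending `φ ↦ ∫ f φ` (`MemDualW.exists_functional`); it is given by the
integral on compactly supported elements (`functional_eq_integral`), although `f w` need not be
integrable for a general `w`.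

The field `V` is Lipschitz with compact support, so for small `ε` the map `T^ε` is a bi-Lipschitz
homeomorphism (`exists_homeomorph_perturbMap`). By Rademacher's theorem and density, weak gradients
obey the chain rule under such maps (`HasWGrad.comp`), and the change of variables turns the
equation for `u^ε` into an equation for `u^ε ∘ T^ε` on the unperturbed partition
(`transformed_equation`): the matrix is `A(ε)`, and the right-hand side is
`F w + ∫ (γ f ∘ T^ε - f) w`, where `γ` is the Jacobian determinant of `T^ε` and the integrand is
supported in the support of `V`.

Both `A(ε)` and `γ` are functions of the matrix `ε DV` that are differentiable at `0`, and `DV` is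
bounded, so `A(ε) = 1 + ε A'(0) + o(ε)` and `γ = 1 + ε div V + o(ε)` uniformly in space
(`eventually_pertMat`, `eventually_pertDet`). Since `f` has a square integrable gradient, its
difference quotients along `T^ε` converge in `L²` to `∇f · V`
(`HasWGrad.tendsto_difference_quotient`), and the difference quotients of the right-hand side
converge to `div (f V)` uniformly over `w` with bounded gradient (`HasWGrad.eventually_rhs_le`).
Subtracting the equations for `u^ε ∘ T^ε`, for `u⁰` and for `z`, and testing with the error
`(u^ε ∘ T^ε - u⁰) / ε - z` itself, the coercivity of `A(ε)` bounds the gradient of the error by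
quantities that tend to zero (`norm_quotient_error_le`). By Hardy's inequality the error tends to
zero in `W_0` (`hasMaterialDerivative`).
-/

namespace Transmission

/-! ### Test functions and weak gradients on the whole space -/

/-- The weight `√(1 + |x|²)` of `H¹_w`. -/
noncomputable def wt (x : E) : ℝ := √(1 + ‖x‖ ^ 2)

lemma wt_sq (x : E) : wt x ^ 2 = 1 + ‖x‖ ^ 2 := Real.sq_sqrt (by positivity)

lemma one_le_wt (x : E) : 1 ≤ wt x := Real.one_le_sqrt.2 (by nlinarith [sq_nonneg ‖x‖])

lemma wt_pos (x : E) : 0 < wt x := zero_lt_one.trans_le (one_le_wt x)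

lemma wt_ne (x : E) : wt x ≠ 0 := (wt_pos x).ne'

@[fun_prop]
lemma continuous_wt : Continuous wt := by unfold wt; fun_prop

lemma wt_le (x : E) : wt x ≤ 1 + ‖x‖ := by
  unfold wt
  rw [Real.sqrt_le_left (by positivity)]
  nlinarith [norm_nonneg x]

lemma IsTest.continuous {φ : E → ℝ} (h : IsTest φ) : Continuous φ := h.1.continuous

lemma IsTest.differentiable {φ : E → ℝ} (h : IsTest φ) : Differentiable ℝ φ :=
  h.1.differentiable (by simp)

lemma contDiff_gradient {φ : E → ℝ} (h : ContDiff ℝ ∞ φ) : ContDiff ℝ ∞ (gradient φ) := by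
  have := (h.fderiv_right (m := ∞) (by simp))
  exact (InnerProductSpace.toDual ℝ E).symm.contDiff.comp this

lemma IsTest.continuous_gradient {φ : E → ℝ} (h : IsTest φ) : Continuous (gradient φ) :=
  (contDiff_gradient h.1).continuous

lemma tsupport_gradient_subset (φ : E → ℝ) : tsupport (gradient φ) ⊆ tsupport φ := by
  refine (closure_mono ?_).trans (tsupport_fderiv_subset ℝ (f := φ))
  intro x hx hx'
  exact hx (by simp [gradient, hx'])

lemma hasCompactSupport_gradient {φ : E → ℝ} (h : HasCompactSupport φ) :
    HasCompactSupport (gradient φ) :=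
  h.of_isClosed_subset (isClosed_tsupport _) (tsupport_gradient_subset φ)

lemma IsTest.memLp {φ : E → ℝ} (h : IsTest φ) : MemLp φ 2 volume :=
  h.continuous.memLp_of_hasCompactSupport h.2

lemma IsTest.memLp_gradient {φ : E → ℝ} (h : IsTest φ) : MemLp (gradient φ) 2 volume :=
  h.continuous_gradient.memLp_of_hasCompactSupport (hasCompactSupport_gradient h.2)

lemma IsTest.mul_right {φ χ : E → ℝ} (h : IsTest φ) (hχ : ContDiff ℝ ∞ χ) :
    IsTest fun x => φ x * χ x :=
  ⟨h.1.mul hχ, h.2.mul_right⟩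

lemma gradient_mul {φ χ : E → ℝ} {x : E} (h : DifferentiableAt ℝ φ x)
    (hχ : DifferentiableAt ℝ χ x) :
    gradient (fun x => φ x * χ x) x = φ x • gradient χ x + χ x • gradient φ x := by
  have := fderiv_fun_mul h hχ
  simp [gradient, this, map_add]

lemma IsTest.exists_lipschitz {φ : E → ℝ} (h : IsTest φ) : ∃ K, LipschitzWith K φ :=
  ContDiff.lipschitzWith_of_hasCompactSupport h.2 (n := 1) (h.1.of_le (by simp)) one_ne_zero

/-- `v ∈ H¹_w(ℝ³)` with weak gradient `g`, the latter tested against one direction at a time. -/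
structure HasWGrad (v : E → ℝ) (g : E → E) : Prop where
  memLp : MemLp (fun x => v x / wt x) 2 volume
  memLp_grad : MemLp g 2 volume
  weak : ∀ φ, IsTest φ → ∀ e : E,
    ∫ x, v x * inner ℝ (gradient φ x) e = - ∫ x, φ x * inner ℝ (g x) e

lemma memLp_of_memLp_div_wt {v : E → ℝ} {K : Set E} (hK : Bornology.IsBounded K)
    (h : MemLp (fun x => v x / wt x) 2 (volume.restrict K)) : MemLp v 2 (volume.restrict K) := by
  obtain ⟨R, hR⟩ := hK.exists_norm_le
  have hm : AEStronglyMeasurable v (volume.restrict K) := by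
    have := h.1.mul (continuous_wt.aestronglyMeasurable)
    refine this.congr (Eventually.of_forall fun x => ?_)
    simp [wt_ne]
  have hae : ∀ᵐ x ∂(volume.restrict K), ‖v x‖ ≤ (1 + R) * ‖v x / wt x‖ := by
    have : ∀ᵐ x ∂(volume.restrict K), ‖x‖ ≤ R := by
      have hcl : ∀ᵐ x ∂(volume.restrict K), x ∈ Metric.closedBall (0 : E) R :=
        ae_restrict_of_ae_restrict_of_subset (fun x hx => by simpa using hR x hx)
          (ae_restrict_mem Metric.isClosed_closedBall.measurableSet)
      simpa using hcl
    filter_upwards [this] with x hx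
    rw [norm_div, Real.norm_of_nonneg (wt_pos x).le, mul_div_assoc', le_div_iff₀ (wt_pos x)]
    have := wt_le x
    nlinarith [norm_nonneg (v x)]
  exact h.of_le_mul hm hae

lemma HasWGrad.locallyIntegrable {v : E → ℝ} {g : E → E} (h : HasWGrad v g) :
    LocallyIntegrable v volume := by
  have h1 : LocallyIntegrable (fun x => v x / wt x) volume :=
    h.memLp.locallyIntegrable (by norm_num)
  have := h1.locallyIntegrableOn univ |>.mul_continuousOn (g := wt) continuous_wt.continuousOn
    (by exact isOpen_univ.isLocallyClosed)
  rw [locallyIntegrableOn_univ] at this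
  simpa [wt_ne] using this

lemma HasWGrad.locallyIntegrable_grad {v : E → ℝ} {g : E → E} (h : HasWGrad v g) :
    LocallyIntegrable g volume :=
  h.memLp_grad.locallyIntegrable (by norm_num)

lemma integrable_mul_inner {v : E → ℝ} (h : LocallyIntegrable v volume) {G : E → E}
    (hG : Continuous G) (hG' : HasCompactSupport G) (e : E) :
    Integrable (fun x => v x * inner ℝ (G x) e) volume := by
  have h1 : HasCompactSupport fun x => (inner ℝ (G x) e : ℝ) :=
    hG'.comp_left (g := fun y => (inner ℝ y e : ℝ)) (by simp)
  have h2 : Continuous fun x => (inner ℝ (G x) e : ℝ) := by fun_prop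
  refine (h.integrable_smul_left_of_hasCompactSupport h2 h1).congr
    (Eventually.of_forall fun x => ?_)
  simp [mul_comm]

lemma integrable_mul_inner' {φ : E → ℝ} (hφ : Continuous φ) (hφ' : HasCompactSupport φ) {g : E → E}
    (h : LocallyIntegrable g volume) (e : E) :
    Integrable (fun x => φ x * inner ℝ (g x) e) volume := by
  refine ((h.integrable_smul_left_of_hasCompactSupport hφ hφ').inner_const e).congr
    (Eventually.of_forall fun x => ?_)
  simp [real_inner_smul_left]

/-- The weak gradient may be tested one direction at a time. -/
lemma weak_iff {v : E → ℝ} {g : E → E} (hv : LocallyIntegrable v volume)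
    (hg : LocallyIntegrable g volume) {φ : E → ℝ} (hφ : IsTest φ) :
    (∫ x, v x • gradient φ x = - ∫ x, φ x • g x) ↔
      ∀ e : E, ∫ x, v x * inner ℝ (gradient φ x) e = - ∫ x, φ x * inner ℝ (g x) e := by
  have h1 : Integrable (fun x => v x • gradient φ x) volume :=
    hv.integrable_smul_right_of_hasCompactSupport hφ.continuous_gradient
      (hasCompactSupport_gradient hφ.2)
  have h2 : Integrable (fun x => φ x • g x) volume :=
    hg.integrable_smul_left_of_hasCompactSupport hφ.continuous hφ.2
  have e1 : ∀ e : E, ∫ x, v x * inner ℝ (gradient φ x) e = inner ℝ (∫ x, v x • gradient φ x) e := by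
    intro e
    rw [real_inner_comm, ← integral_inner h1]
    simp [real_inner_smul_right]
  have e2 : ∀ e : E, ∫ x, φ x * inner ℝ (g x) e = inner ℝ (∫ x, φ x • g x) e := by
    intro e
    rw [real_inner_comm, ← integral_inner h2]
    simp [real_inner_smul_right, real_inner_comm]
  constructor
  · intro h e
    rw [e1, e2, h, inner_neg_left]
  · intro h
    refine ext_inner_right ℝ fun e => ?_
    rw [← e1, h, e2, inner_neg_left]

lemma HasWGrad.isWeakGrad {v : E → ℝ} {g : E → E} (h : HasWGrad v g) (U : Set E) :
    IsWeakGrad U v g := by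
  refine ⟨h.locallyIntegrable.locallyIntegrableOn U, h.locallyIntegrable_grad.locallyIntegrableOn U,
    fun φ hφ hsub => ?_⟩
  have h1 := (weak_iff h.locallyIntegrable h.locallyIntegrable_grad hφ).2 (h.weak φ hφ)
  rw [setIntegral_eq_integral_of_forall_compl_eq_zero,
    setIntegral_eq_integral_of_forall_compl_eq_zero, h1]
  · intro x hx
    rw [image_eq_zero_of_notMem_tsupport (fun h => hx (hsub h)), zero_smul]
  · intro x hx
    rw [image_eq_zero_of_notMem_tsupport
      (fun h => hx (hsub (tsupport_gradient_subset φ h))), smul_zero]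

lemma IsWeakGrad.hasWGrad {v : E → ℝ} {g : E → E} (h : IsWeakGrad univ v g)
    (h1 : MemLp (fun x => v x / wt x) 2 volume) (h2 : MemLp g 2 volume) : HasWGrad v g := by
  refine ⟨h1, h2, fun φ hφ => ?_⟩
  obtain ⟨a, b, c⟩ := h
  rw [locallyIntegrableOn_univ] at a b
  exact (weak_iff a b hφ).1 (by simpa using c φ hφ (subset_univ _))

/-- Weak gradients are unique up to null sets. -/
lemma IsWeakGrad.ae_eq {U : Set E} (hU : IsOpen U) {v v' : E → ℝ} {g g' : E → E}
    (h : IsWeakGrad U v g) (h' : IsWeakGrad U v' g') (hv : v =ᵐ[volume.restrict U] v') :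
    g =ᵐ[volume.restrict U] g' := by
  have key : ∀ᵐ x ∂volume, x ∈ U → (g - g') x = 0 := by
    refine hU.ae_eq_zero_of_integral_contDiff_smul_eq_zero (h.2.1.sub h'.2.1) ?_
    intro φ hφ hc hs
    have i1 : IntegrableOn (fun x => φ x • g x) U volume := by
      have := (h.2.1.integrableOn_compact_subset hs hc)
      exact (integrableOn_iff_integrable_of_support_subset
        (f := fun x => φ x • g x) (s := tsupport φ) (fun x hx => subset_tsupport _ (by
          intro h0; exact hx (by simp [h0])))).1
          (this.continuousOn_smul hφ.continuous.continuousOn hc) |>.integrableOn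
    have i2 : IntegrableOn (fun x => φ x • g' x) U volume := by
      have := (h'.2.1.integrableOn_compact_subset hs hc)
      exact (integrableOn_iff_integrable_of_support_subset
        (f := fun x => φ x • g' x) (s := tsupport φ) (fun x hx => subset_tsupport _ (by
          intro h0; exact hx (by simp [h0])))).1
          (this.continuousOn_smul hφ.continuous.continuousOn hc) |>.integrableOn
    rw [← setIntegral_eq_integral_of_forall_compl_eq_zero (s := U)]
    · simp only [Pi.sub_apply, smul_sub]
      rw [integral_sub i1 i2, sub_eq_zero, ← neg_inj, ← h.2.2 φ ⟨hφ, hc⟩ hs,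
        ← h'.2.2 φ ⟨hφ, hc⟩ hs]
      refine integral_congr_ae ?_
      filter_upwards [hv] with x hx
      rw [hx]
    · intro x hx
      rw [image_eq_zero_of_notMem_tsupport (fun h => hx (hs h)), zero_smul]
  rw [EventuallyEq, ae_restrict_iff' hU.measurableSet]
  filter_upwards [key] with x hx hxU
  exact sub_eq_zero.1 (hx hxU)

lemma HasWGrad.ae_eq {v v' : E → ℝ} {g g' : E → E} (h : HasWGrad v g) (h' : HasWGrad v' g')
    (hv : v =ᵐ[volume] v') : g =ᵐ[volume] g' := by
  have := (h.isWeakGrad univ).ae_eq isOpen_univ (h'.isWeakGrad univ)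
    (by simpa using hv)
  simpa using this

lemma HasWGrad.congr {v v' : E → ℝ} {g g' : E → E} (h : HasWGrad v g) (hv : v =ᵐ[volume] v')
    (hg : g =ᵐ[volume] g') : HasWGrad v' g' := by
  refine ⟨h.memLp.ae_eq ?_, h.memLp_grad.ae_eq hg, fun φ hφ e => ?_⟩
  · filter_upwards [hv] with x hx
    rw [hx]
  · rw [← integral_congr_ae (f := fun x => v x * inner ℝ (gradient φ x) e), h.weak φ hφ e,
      integral_congr_ae]
    · filter_upwards [hg] with x hx
      rw [hx]
    · filter_upwards [hv] with x hx
      rw [hx]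

lemma HasWGrad.sub {v v' : E → ℝ} {g g' : E → E} (h : HasWGrad v g) (h' : HasWGrad v' g') :
    HasWGrad (fun x => v x - v' x) (fun x => g x - g' x) := by
  refine ⟨?_, h.memLp_grad.sub h'.memLp_grad, fun φ hφ e => ?_⟩
  · refine (h.memLp.sub h'.memLp).ae_eq (Eventually.of_forall fun x => ?_)
    simp [sub_div]
  · simp only [sub_mul, inner_sub_left, mul_sub]
    have c1 := hφ.continuous_gradient
    have c2 := hasCompactSupport_gradient hφ.2
    rw [integral_sub (integrable_mul_inner h.locallyIntegrable c1 c2 e)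
      (integrable_mul_inner h'.locallyIntegrable c1 c2 e), integral_sub
      (integrable_mul_inner' hφ.continuous hφ.2 h.locallyIntegrable_grad e)
      (integrable_mul_inner' hφ.continuous hφ.2 h'.locallyIntegrable_grad e), h.weak φ hφ,
      h'.weak φ hφ]
    ring

lemma HasWGrad.const_mul {v : E → ℝ} {g : E → E} (h : HasWGrad v g) (c : ℝ) :
    HasWGrad (fun x => c * v x) (fun x => c • g x) := by
  refine ⟨?_, h.memLp_grad.const_smul c, fun φ hφ e => ?_⟩
  · refine (h.memLp.const_mul c).ae_eq (Eventually.of_forall fun x => ?_)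
    simp [mul_div_assoc]
  · simp only [mul_assoc, real_inner_smul_left, mul_left_comm _ c]
    rw [integral_const_mul, integral_const_mul, h.weak φ hφ e]
    ring

lemma memLp_div_wt {v : E → ℝ} {μ : Measure E} (h : MemLp v 2 μ) :
    MemLp (fun x => v x / wt x) 2 μ := by
  refine h.of_le (h.1.div₀ continuous_wt.aestronglyMeasurable) (Eventually.of_forall fun x => ?_)
  rw [norm_div]
  exact div_le_self (norm_nonneg _) (by rw [Real.norm_of_nonneg (wt_pos x).le]; exact one_le_wt x)

lemma integral_mul_inner_gradient {v φ : E → ℝ} {K : NNReal} (hv : LipschitzWith K v)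
    (hφ : IsTest φ) (e : E) :
    ∫ x, v x * inner ℝ (gradient φ x) e = - ∫ x, φ x * inner ℝ (gradient v x) e := by
  obtain ⟨K', hK'⟩ := hφ.exists_lipschitz
  have h := hv.integral_lineDeriv_mul_eq (μ := volume) hK' hφ.2 e
  have e1 : ∫ x, lineDeriv ℝ v x e * φ x = ∫ x, φ x * inner ℝ (gradient v x) e := by
    refine integral_congr_ae ?_
    filter_upwards [hv.ae_differentiableAt (μ := volume)] with x hx
    rw [hx.lineDeriv_eq_fderiv, inner_gradient_left, mul_comm]
  have e2 : ∫ x, lineDeriv ℝ φ x (-e) * v x = - ∫ x, v x * inner ℝ (gradient φ x) e := by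
    rw [← integral_neg]
    refine integral_congr_ae (Eventually.of_forall fun x => ?_)
    simp only
    rw [(hφ.differentiable x).lineDeriv_eq_fderiv, inner_gradient_left, map_neg]
    ring
  rw [← e1, h, e2, neg_neg]

lemma measurable_gradient (v : E → ℝ) : Measurable (gradient v) :=
  (InnerProductSpace.toDual ℝ E).symm.continuous.measurable.comp (measurable_fderiv ℝ v)

lemma norm_gradient (v : E → ℝ) (x : E) : ‖gradient v x‖ = ‖fderiv ℝ v x‖ :=
  (InnerProductSpace.toDual ℝ E).symm.norm_map _

lemma norm_gradient_le {v : E → ℝ} {K : NNReal} (hv : LipschitzWith K v) (x : E) :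
    ‖gradient v x‖ ≤ K := by
  rw [norm_gradient]
  exact norm_fderiv_le_of_lipschitz ℝ hv

/-- Compactly supported Lipschitz functions lie in `H¹_w(ℝ³)`. -/
lemma hasWGrad_of_lipschitz {v : E → ℝ} {K : NNReal} (hv : LipschitzWith K v)
    (hc : HasCompactSupport v) : HasWGrad v (gradient v) := by
  refine ⟨memLp_div_wt (hv.continuous.memLp_of_hasCompactSupport hc), ?_, fun φ hφ e =>
    integral_mul_inner_gradient hv hφ e⟩
  have hb : MemLp (fun x => (tsupport v).indicator (fun _ => (K : ℝ)) x) 2 (volume : Measure E) :=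
    memLp_indicator_const 2 (isClosed_tsupport v).measurableSet _ (Or.inr hc.measure_lt_top.ne)
  refine hb.of_le (measurable_gradient v).aestronglyMeasurable (Eventually.of_forall fun x => ?_)
  by_cases hx : x ∈ tsupport v
  · simpa [hx] using norm_gradient_le hv x
  · rw [image_eq_zero_of_notMem_tsupport (fun h => hx (tsupport_gradient_subset v h)), norm_zero]
    positivity

lemma IsTest.hasWGrad {φ : E → ℝ} (h : IsTest φ) : HasWGrad φ (gradient φ) := by
  obtain ⟨K, hK⟩ := h.exists_lipschitz
  exact hasWGrad_of_lipschitz hK h.2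

/-! ### Estimates in `L²` -/

lemma eLpNorm_two_sq {α F : Type*} {m : MeasurableSpace α} [NormedAddCommGroup F] (f : α → F)
    (μ : Measure α) : eLpNorm f 2 μ ^ 2 = ∫⁻ x, ‖f x‖ₑ ^ 2 ∂μ := by
  have h := eLpNorm_nnreal_pow_eq_lintegral (f := f) (μ := μ) (p := 2) two_ne_zero
  simpa using h

/-- Dominated convergence to zero in `L²`. -/
lemma tendsto_eLpNorm_two_zero {ι α F : Type*} {m : MeasurableSpace α} {μ : Measure α}
    [NormedAddCommGroup F] {l : Filter ι} [l.IsCountablyGenerated] {f : ι → α → F} {b : α → ℝ}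
    (hm : ∀ᶠ i in l, AEStronglyMeasurable (f i) μ) (hb : MemLp b 2 μ)
    (hle : ∀ᶠ i in l, ∀ᵐ x ∂μ, ‖f i x‖ ≤ b x)
    (hlim : ∀ᵐ x ∂μ, Tendsto (fun i => f i x) l (𝓝 0)) :
    Tendsto (fun i => eLpNorm (f i) 2 μ) l (𝓝 0) := by
  have h1 : Tendsto (fun i => ∫ x, ‖f i x‖ ^ 2 ∂μ) l (𝓝 (∫ _, (0 : ℝ) ∂μ)) := by
    refine tendsto_integral_filter_of_dominated_convergence (fun x => b x ^ 2) ?_ ?_ ?_ ?_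
    · filter_upwards [hm] with i hi using hi.norm.pow 2
    · filter_upwards [hle] with i hi
      filter_upwards [hi] with x hx
      rw [Real.norm_of_nonneg (by positivity)]
      exact pow_le_pow_left₀ (norm_nonneg _) hx 2
    · exact hb.integrable_sq
    · filter_upwards [hlim] with x hx
      simpa using hx.norm.pow 2
  have h2 : ∀ᶠ i in l, eLpNorm (f i) 2 μ = (ENNReal.ofReal (∫ x, ‖f i x‖ ^ 2 ∂μ)) ^ (1 / 2 : ℝ) := by
    filter_upwards [hm, hle] with i hi hi'
    have hL : MemLp (f i) 2 μ := hb.mono' hi hi'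
    rw [ofReal_integral_eq_lintegral_ofReal (hL.integrable_norm_pow two_ne_zero)
      (Eventually.of_forall fun x => by positivity)]
    have : ∫⁻ x, ENNReal.ofReal (‖f i x‖ ^ 2) ∂μ = eLpNorm (f i) 2 μ ^ 2 := by
      rw [eLpNorm_two_sq]
      refine lintegral_congr fun x => ?_
      rw [ENNReal.ofReal_pow (norm_nonneg _), ofReal_norm]
    rw [this, ← ENNReal.rpow_natCast, ← ENNReal.rpow_mul]
    norm_num
  rw [tendsto_congr' h2]
  have h3 := (ENNReal.tendsto_ofReal h1).ennrpow_const (1 / 2 : ℝ)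
  simpa using h3

/-- Minkowski's inequality for averages of a family of functions, in quadratic form: Jensen's
inequality in the parameter, then Tonelli's theorem. -/
lemma lintegral_average_sq_le {α : Type*} [MeasurableSpace α] {ν : Measure α}
    [IsProbabilityMeasure ν] {μ : Measure E} [SFinite μ] {f : α → E → ENNReal}
    (hf : Measurable (Function.uncurry f)) {C : ENNReal}
    (hC : ∀ᵐ a ∂ν, ∫⁻ x, f a x ^ 2 ∂μ ≤ C) :
    ∫⁻ x, (∫⁻ a, f a x ∂ν) ^ 2 ∂μ ≤ C := by
  have h1 : ∀ x, (∫⁻ a, f a x ∂ν) ^ 2 ≤ ∫⁻ a, f a x ^ 2 ∂ν := by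
    intro x
    have hx : AEMeasurable (fun a => f a x) ν := by
      have : Measurable fun a => Function.uncurry f (a, x) := by fun_prop
      exact this.aemeasurable
    have h := ENNReal.lintegral_mul_le_Lp_mul_Lq ν Real.HolderConjugate.two_two hx
      (aemeasurable_const (b := (1 : ENNReal)))
    simp only [Pi.mul_apply, mul_one, ENNReal.one_rpow, lintegral_const, measure_univ] at h
    calc (∫⁻ a, f a x ∂ν) ^ 2 ≤ ((∫⁻ a, f a x ^ (2 : ℝ) ∂ν) ^ (1 / 2 : ℝ)) ^ 2 := by gcongr
      _ = ∫⁻ a, f a x ^ 2 ∂ν := by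
        rw [← ENNReal.rpow_natCast, ← ENNReal.rpow_mul]
        norm_num
  calc ∫⁻ x, (∫⁻ a, f a x ∂ν) ^ 2 ∂μ ≤ ∫⁻ x, ∫⁻ a, f a x ^ 2 ∂ν ∂μ := lintegral_mono h1
    _ = ∫⁻ a, ∫⁻ x, f a x ^ 2 ∂μ ∂ν := by
      refine lintegral_lintegral_swap ?_
      have : Measurable fun p : E × α => Function.uncurry f (p.2, p.1) ^ 2 := by fun_prop
      exact this.aemeasurable
    _ ≤ ∫⁻ _, C ∂ν := lintegral_mono_ae hC
    _ = C := by simp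

/-- Translations are continuous in `L²`. -/
lemma exists_eLpNorm_translate_sub_le {F : Type*} [NormedAddCommGroup F] {g : E → F}
    (hg : MemLp g 2 volume) {δ : ENNReal} (hδ : 0 < δ) :
    ∃ r > 0, ∀ y : E, ‖y‖ < r → eLpNorm (fun x => g (x - y) - g x) 2 volume ≤ δ := by
  let T : E → C(E, E) := fun y => ⟨fun x => x - y, by fun_prop⟩
  have hT : Continuous T := by
    refine ContinuousMap.continuous_of_continuous_uncurry _ ?_
    change Continuous fun p : E × E => p.2 - p.1
    fun_prop
  have hmp : ∀ y, MeasurePreserving (T y) volume volume := fun y =>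
    measurePreserving_sub_right volume y
  have hc : Continuous fun y => Lp.compMeasurePreserving (T y) (hmp y) (hg.toLp g) :=
    (continuous_const (y := hg.toLp g)).compMeasurePreservingLp hT hmp (by simp)
  have h0 : Tendsto (fun y => edist (Lp.compMeasurePreserving (T y) (hmp y) (hg.toLp g))
      (Lp.compMeasurePreserving (T 0) (hmp 0) (hg.toLp g))) (𝓝 0) (𝓝 0) := by
    have := (hc.tendsto 0).edist (tendsto_const_nhds
      (x := Lp.compMeasurePreserving (T 0) (hmp 0) (hg.toLp g)))
    simpa using this
  obtain ⟨r, hr, h⟩ := Metric.eventually_nhds_iff.1 (h0.eventually (ge_mem_nhds hδ))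
  refine ⟨r, hr, fun y hy => ?_⟩
  have h1 := h (y := y) (by simpa using hy)
  rw [Lp.edist_def] at h1
  refine le_trans (le_of_eq (eLpNorm_congr_ae ?_)) h1
  have e : ∀ y, (Lp.compMeasurePreserving (T y) (hmp y) (hg.toLp g) : E → F)
      =ᵐ[volume] fun x => g (x - y) := by
    intro y
    refine (Lp.coeFn_compMeasurePreserving _ (hmp y)).trans ?_
    exact (hmp y).quasiMeasurePreserving.ae_eq_comp hg.coeFn_toLp
  filter_upwards [e y, e 0] with x h1 h2
  rw [Pi.sub_apply, h1, h2, sub_zero]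

open scoped Convolution in
/-- A mollification is as close to a function in `L²` as the small translates of the function. -/
lemma eLpNorm_convolution_sub_le {F : Type*} [NormedAddCommGroup F] [NormedSpace ℝ F]
    [CompleteSpace F] {g : E → F} (hg : MemLp g 2 volume) (ρ : ContDiffBump (0 : E)) {δ : ENNReal}
    (h : ∀ y : E, ‖y‖ < ρ.rOut → eLpNorm (fun x => g (x - y) - g x) 2 volume ≤ δ) :
    eLpNorm (fun x => (ρ.normed volume ⋆[ContinuousLinearMap.lsmul ℝ ℝ, volume] g) x - g x)
      2 volume ≤ δ := by
  obtain ⟨g', hg'm, hgg'⟩ := hg.1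
  have hg'2 : MemLp g' 2 volume := hg.ae_eq hgg'
  have hloc : LocallyIntegrable g' volume := hg'2.locallyIntegrable (by norm_num)
  have hcongr : eLpNorm (fun x => (ρ.normed volume ⋆[ContinuousLinearMap.lsmul ℝ ℝ, volume] g) x
      - g x) 2 volume = eLpNorm (fun x =>
      (ρ.normed volume ⋆[ContinuousLinearMap.lsmul ℝ ℝ, volume] g') x - g' x) 2 volume := by
    refine eLpNorm_congr_ae ?_
    filter_upwards [hgg'] with x hx
    rw [convolution_congr _ (EventuallyEq.refl _ _) hgg', hx]
  have hshift : ∀ y, eLpNorm (fun x => g' (x - y) - g' x) 2 volume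
      = eLpNorm (fun x => g (x - y) - g x) 2 volume := by
    intro y
    refine eLpNorm_congr_ae ?_
    filter_upwards [hgg', (measurePreserving_sub_right volume y).quasiMeasurePreserving.ae_eq_comp
      hgg'] with x h1 h2
    simp only [Function.comp_apply] at h2
    rw [h1, h2]
  -- The mollification averages translates with respect to the probability measure `ρ dy`.
  set ν : Measure E := volume.withDensity fun y => ENNReal.ofReal (ρ.normed volume y) with hν
  have hρm : Measurable fun y => ENNReal.ofReal (ρ.normed volume y) :=
    ρ.continuous_normed.measurable.ennreal_ofReal
  have : IsProbabilityMeasure ν := by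
    constructor
    rw [hν, withDensity_apply _ MeasurableSet.univ, Measure.restrict_univ,
      ← ofReal_integral_eq_lintegral_ofReal ρ.integrable_normed
        (Eventually.of_forall ρ.nonneg_normed), ρ.integral_normed, ENNReal.ofReal_one]
  have hpt : ∀ x, ‖(ρ.normed volume ⋆[ContinuousLinearMap.lsmul ℝ ℝ, volume] g') x - g' x‖ₑ
      ≤ ∫⁻ y, ‖g' (x - y) - g' x‖ₑ ∂ν := by
    intro x
    have hint : Integrable (fun y => ρ.normed volume y • g' (x - y)) volume :=
      (ρ.hasCompactSupport_normed.convolutionExists_left (ContinuousLinearMap.lsmul ℝ ℝ)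
        ρ.continuous_normed hloc) x
    have e1 : (ρ.normed volume ⋆[ContinuousLinearMap.lsmul ℝ ℝ, volume] g') x - g' x
        = ∫ y, ρ.normed volume y • (g' (x - y) - g' x) := by
      simp only [smul_sub]
      rw [integral_sub hint (ρ.integrable_normed.smul_const _), ρ.integral_normed_smul]
      rfl
    rw [e1, hν, lintegral_withDensity_eq_lintegral_mul _ hρm]
    · refine (enorm_integral_le_lintegral_enorm _).trans (le_of_eq ?_)
      refine lintegral_congr fun y => ?_
      rw [enorm_smul, Pi.mul_apply, Real.enorm_of_nonneg (ρ.nonneg_normed y)]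
    · have : StronglyMeasurable fun y => g' (x - y) - g' x :=
        (hg'm.comp_measurable (by fun_prop)).sub stronglyMeasurable_const
      exact this.enorm
  rw [hcongr, ← ENNReal.pow_le_pow_left_iff (n := 2) two_ne_zero, eLpNorm_two_sq]
  refine (lintegral_mono fun x => pow_le_pow_left' (hpt x) 2).trans ?_
  refine lintegral_average_sq_le (f := fun y x => ‖g' (x - y) - g' x‖ₑ) ?_ ?_
  · have : StronglyMeasurable fun p : E × E => g' (p.2 - p.1) - g' p.2 :=
      (hg'm.comp_measurable (by fun_prop)).sub (hg'm.comp_measurable (by fun_prop))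
    exact this.enorm
  · rw [hν, ae_withDensity_iff hρm]
    refine Eventually.of_forall fun y hy => ?_
    rw [← eLpNorm_two_sq, hshift]
    refine pow_le_pow_left' (h y ?_) 2
    have hy' : y ∈ Function.support (ρ.normed volume) := by
      intro h0
      exact hy (by simp [h0])
    rw [ρ.support_normed_eq] at hy'
    simpa using hy'

/-! ### Density of test functions -/

open scoped Convolution in
/-- The gradient of a mollification is the mollification of the weak gradient. -/
lemma HasWGrad.gradient_convolution {v : E → ℝ} {g : E → E} (h : HasWGrad v g)
    (ρ : ContDiffBump (0 : E)) (x : E) :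
    gradient (ρ.normed volume ⋆[ContinuousLinearMap.lsmul ℝ ℝ, volume] v) x
      = (ρ.normed volume ⋆[ContinuousLinearMap.lsmul ℝ ℝ, volume] g) x := by
  refine ext_inner_right ℝ fun e => ?_
  have hρ : ContDiff ℝ ∞ (ρ.normed volume) := ρ.contDiff_normed
  have hd := ρ.hasCompactSupport_normed.hasFDerivAt_convolution_left
    (ContinuousLinearMap.lsmul ℝ ℝ) (μ := volume) (hρ.of_le (by simp)) h.locallyIntegrable x
  -- the test function `y ↦ ρ (x - y)`
  have hT : IsTest fun y => ρ.normed volume (x - y) := by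
    refine ⟨hρ.comp (contDiff_const.sub contDiff_id), ?_⟩
    exact ρ.hasCompactSupport_normed.comp_homeomorph (Homeomorph.subLeft x)
  have hgT : ∀ y, inner ℝ (gradient (fun y => ρ.normed volume (x - y)) y) e
      = - fderiv ℝ (ρ.normed volume) (x - y) e := by
    intro y
    rw [inner_gradient_left]
    have h1 : HasFDerivAt (ρ.normed volume) (fderiv ℝ (ρ.normed volume) (x - y)) (x - y) :=
      (hρ.differentiable (by simp) _).hasFDerivAt
    have h2 : HasFDerivAt (fun y => x - y) (-ContinuousLinearMap.id ℝ E) y :=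
      (hasFDerivAt_id y).const_sub x
    have h3 := h1.comp y h2
    have : fderiv ℝ (fun y => ρ.normed volume (x - y)) y = _ := h3.fderiv
    rw [this]
    simp
  have hw := h.weak _ hT e
  simp only [hgT] at hw
  rw [inner_gradient_left, hd.fderiv]
  have hi : Integrable (fun y => (fderiv ℝ (ρ.normed volume) (x - y)).smulRight (v y)) volume := by
    have hc : Continuous fun y => fderiv ℝ (ρ.normed volume) (x - y) :=
      (hρ.continuous_fderiv (by simp)).comp (by fun_prop)
    have hs : HasCompactSupport fun y => fderiv ℝ (ρ.normed volume) (x - y) :=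
      (ρ.hasCompactSupport_normed.fderiv ℝ).comp_homeomorph (Homeomorph.subLeft x)
    have := h.locallyIntegrable.integrable_smul_right_of_hasCompactSupport hc hs
    refine this.congr (Eventually.of_forall fun y => ?_)
    ext e
    simp [mul_comm]
  have hi2 : Integrable (fun y => ρ.normed volume (x - y) • g y) volume :=
    h.locallyIntegrable_grad.integrable_smul_left_of_hasCompactSupport hT.continuous hT.2
  have e1 : (fderiv ℝ (ρ.normed volume) ⋆[(ContinuousLinearMap.lsmul ℝ ℝ).precompL E, volume] v) x e
      = ∫ y, v y * fderiv ℝ (ρ.normed volume) (x - y) e := by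
    rw [convolution_eq_swap]
    have : ∀ y, ((ContinuousLinearMap.lsmul ℝ ℝ).precompL E (fderiv ℝ (ρ.normed volume) (x - y))
        (v y) : E →L[ℝ] ℝ) = (fderiv ℝ (ρ.normed volume) (x - y)).smulRight (v y) := by
      intro y
      ext e
      simp
    simp only [this]
    rw [ContinuousLinearMap.integral_apply hi]
    refine integral_congr_ae (Eventually.of_forall fun y => ?_)
    simp [mul_comm]
  have e2 : inner ℝ ((ρ.normed volume ⋆[ContinuousLinearMap.lsmul ℝ ℝ, volume] g) x) e
      = ∫ y, ρ.normed volume (x - y) * inner ℝ (g y) e := by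
    rw [convolution_eq_swap]
    simp only [ContinuousLinearMap.lsmul_apply]
    rw [real_inner_comm, ← integral_inner hi2]
    simp [real_inner_smul_right, real_inner_comm]
  rw [e1, e2]
  simp only [mul_neg, integral_neg, neg_inj] at hw
  exact hw

open scoped Convolution in
/-- Mollification: a compactly supported `v` is approximated by test functions in `L²` together
with its gradient. -/
lemma HasWGrad.exists_test_of_hasCompactSupport {v : E → ℝ} {g : E → E} (h : HasWGrad v g)
    (hc : HasCompactSupport v) {η : ENNReal} (hη : 0 < η) :
    ∃ φ, IsTest φ ∧ eLpNorm (fun x => φ x - v x) 2 volume ≤ η ∧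
      eLpNorm (fun x => gradient φ x - g x) 2 volume ≤ η := by
  have hv : MemLp v 2 volume := by
    have hK : Bornology.IsBounded (tsupport v) := hc.isCompact.isBounded
    have h1 := memLp_of_memLp_div_wt hK (h.memLp.restrict _)
    rw [← memLp_indicator_iff_restrict (isClosed_tsupport v).measurableSet] at h1
    rwa [indicator_eq_self.2 (subset_tsupport v)] at h1
  obtain ⟨r₁, hr₁, h₁⟩ := exists_eLpNorm_translate_sub_le hv hη
  obtain ⟨r₂, hr₂, h₂⟩ := exists_eLpNorm_translate_sub_le h.memLp_grad hη
  have hr : 0 < min r₁ r₂ := lt_min hr₁ hr₂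
  let ρ : ContDiffBump (0 : E) := ⟨min r₁ r₂ / 2, min r₁ r₂, half_pos hr, half_lt_self hr⟩
  refine ⟨ρ.normed volume ⋆[ContinuousLinearMap.lsmul ℝ ℝ, volume] v, ⟨?_, ?_⟩, ?_, ?_⟩
  · exact ρ.hasCompactSupport_normed.contDiff_convolution_left _ ρ.contDiff_normed
      h.locallyIntegrable
  · exact ρ.hasCompactSupport_normed.convolution _ hc
  · exact eLpNorm_convolution_sub_le hv ρ fun y hy => h₁ y (hy.trans_le (min_le_left _ _))
  · simp only [h.gradient_convolution ρ]
    exact eLpNorm_convolution_sub_le h.memLp_grad ρ fun y hy => h₂ y (hy.trans_le (min_le_right _ _))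

lemma IsTest.exists_bound_gradient {φ : E → ℝ} (h : IsTest φ) : ∃ C, ∀ x, ‖gradient φ x‖ ≤ C := by
  obtain ⟨K, hK⟩ := h.exists_lipschitz
  exact ⟨K, norm_gradient_le hK⟩

lemma hasCompactSupport_smul_gradient {φ : E → ℝ} (h : HasCompactSupport φ) (χ : E → ℝ) :
    HasCompactSupport fun x => χ x • gradient φ x :=
  (hasCompactSupport_gradient h).mono fun x hx hx' => hx (by simp [hx'])

lemma HasWGrad.weak_mul_test {v : E → ℝ} {g : E → E} (h : HasWGrad v g) {χ : E → ℝ}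
    (hχ : IsTest χ) {φ : E → ℝ} (hφ : IsTest φ) (e : E) :
    ∫ x, χ x * v x * inner ℝ (gradient φ x) e
      = - ∫ x, φ x * inner ℝ (χ x • g x + v x • gradient χ x) e := by
  have hprod := h.weak _ (hφ.mul_right hχ.1) e
  have e1 : ∀ x, v x * inner ℝ (gradient (fun x => φ x * χ x) x) e
      = χ x * v x * inner ℝ (gradient φ x) e + φ x * (v x * inner ℝ (gradient χ x) e) := by
    intro x
    rw [gradient_mul (hφ.differentiable x) (hχ.differentiable x), inner_add_left,
      real_inner_smul_left, real_inner_smul_left]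
    ring
  have i0 := integrable_mul_inner h.locallyIntegrable (hχ.mul_right hφ.1).continuous_gradient
    (hasCompactSupport_gradient (hχ.mul_right hφ.1).2) e
  have i1 : Integrable (fun x => χ x * v x * inner ℝ (gradient φ x) e) volume := by
    have := integrable_mul_inner h.locallyIntegrable (G := fun x => χ x • gradient φ x)
      (hχ.continuous.smul hφ.continuous_gradient)
      (hasCompactSupport_smul_gradient hφ.2 _) e
    refine this.congr (Eventually.of_forall fun x => ?_)
    simp only [real_inner_smul_left]
    ring
  have i2 : Integrable (fun x => φ x * (v x * inner ℝ (gradient χ x) e)) volume := by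
    have := integrable_mul_inner h.locallyIntegrable (G := fun x => φ x • gradient χ x)
      (hφ.continuous.smul hχ.continuous_gradient)
      (hasCompactSupport_smul_gradient hχ.2 _) e
    refine this.congr (Eventually.of_forall fun x => ?_)
    simp only [real_inner_smul_left]
    ring
  have i3 : Integrable (fun x => φ x * χ x * inner ℝ (g x) e) volume :=
    integrable_mul_inner' (hφ.continuous.mul hχ.continuous) (hφ.mul_right hχ.1).2
      h.locallyIntegrable_grad e
  simp only [e1] at hprod
  rw [integral_add i1 i2] at hprod
  have e2 : ∀ x, φ x * inner ℝ (χ x • g x + v x • gradient χ x) e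
      = φ x * χ x * inner ℝ (g x) e + φ x * (v x * inner ℝ (gradient χ x) e) := by
    intro x
    rw [inner_add_left, real_inner_smul_left, real_inner_smul_left]
    ring
  simp only [e2]
  rw [integral_add i3 i2]
  linarith

/-- The product rule with a test function. The term `v ∇χ` is square integrable because the weight is
bounded on the support of `χ`. -/
lemma HasWGrad.mul_test {v : E → ℝ} {g : E → E} (h : HasWGrad v g) {χ : E → ℝ} (hχ : IsTest χ) :
    HasWGrad (fun x => χ x * v x) (fun x => χ x • g x + v x • gradient χ x) := by
  obtain ⟨C, hC⟩ := hχ.continuous.bounded_above_of_compact_support hχ.2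
  have hcv : Continuous fun x => wt x • gradient χ x :=
    continuous_wt.smul hχ.continuous_gradient
  obtain ⟨C', hC'⟩ := hcv.bounded_above_of_compact_support
    (hasCompactSupport_smul_gradient hχ.2 _)
  refine ⟨?_, MemLp.add ?_ ?_, fun φ hφ e => h.weak_mul_test hχ hφ e⟩
  · refine h.memLp.of_le_mul (c := C) ((hχ.continuous.aestronglyMeasurable.mul
      h.locallyIntegrable.aestronglyMeasurable).div₀ continuous_wt.aestronglyMeasurable)
      (Eventually.of_forall fun x => ?_)
    rw [mul_div_assoc, norm_mul]
    exact mul_le_mul_of_nonneg_right (hC x) (norm_nonneg _)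
  · refine h.memLp_grad.of_le_mul (c := C)
      (hχ.continuous.aestronglyMeasurable.smul h.memLp_grad.1) (Eventually.of_forall fun x => ?_)
    rw [norm_smul]
    exact mul_le_mul_of_nonneg_right (hC x) (norm_nonneg _)
  · refine h.memLp.of_le_mul (c := C') (h.locallyIntegrable.aestronglyMeasurable.smul
      hχ.continuous_gradient.aestronglyMeasurable) (Eventually.of_forall fun x => ?_)
    have : v x • gradient χ x = (v x / wt x) • (wt x • gradient χ x) := by
      rw [smul_smul, div_mul_cancel₀ _ (wt_ne x)]
    rw [this, norm_smul, mul_comm]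
    exact mul_le_mul_of_nonneg_right (hC' x) (norm_nonneg _)

/-- Cut-off functions equal to `1` on the ball of radius `n + 1`, whose gradients are bounded by a
multiple of `1 / √(1 + |x|²)` uniformly in `n`. -/
lemma exists_cutoff : ∃ χ : ℕ → E → ℝ, ∃ C : ℝ, (∀ n, IsTest (χ n)) ∧
    (∀ n x, χ n x ∈ Icc (0 : ℝ) 1) ∧ (∀ (n : ℕ) x, ‖x‖ < n + 1 → χ n x = 1) ∧
    (∀ (n : ℕ) x, ‖x‖ < n + 1 → gradient (χ n) x = 0) ∧ (∀ n x, wt x * ‖gradient (χ n) x‖ ≤ C) := by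
  let ψ : ContDiffBump (0 : E) := ⟨1, 2, one_pos, one_lt_two⟩
  have hψ : IsTest ψ := ⟨ψ.contDiff, ψ.hasCompactSupport⟩
  obtain ⟨C, hC⟩ := hψ.exists_bound_gradient
  have hpos : ∀ n : ℕ, (0 : ℝ) < n + 1 := fun n => by positivity
  have hT : ∀ n : ℕ, IsTest fun x => ψ ((n + 1 : ℝ)⁻¹ • x) := by
    intro n
    refine ⟨hψ.1.comp (contDiff_const_smul _), ?_⟩
    exact hψ.2.comp_homeomorph (Homeomorph.smulOfNeZero _ (inv_ne_zero (hpos n).ne'))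
  have hG : ∀ (n : ℕ) x, gradient (fun x => ψ ((n + 1 : ℝ)⁻¹ • x)) x
      = (n + 1 : ℝ)⁻¹ • gradient ψ ((n + 1 : ℝ)⁻¹ • x) := by
    intro n x
    have := fderiv_comp_smul (f := ψ) (𝕜 := ℝ) ((n + 1 : ℝ)⁻¹) (x := x)
    simp only [gradient]
    rw [show fderiv ℝ (fun x => ψ ((n + 1 : ℝ)⁻¹ • x)) x = _ from this, map_smul]
  have hlt : ∀ (n : ℕ) (x : E), ‖x‖ < n + 1 → ‖(n + 1 : ℝ)⁻¹ • x‖ < 1 := by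
    intro n x hx
    rw [norm_smul, norm_inv, Real.norm_of_nonneg (hpos n).le, inv_mul_lt_iff₀ (hpos n), mul_one]
    exact hx
  refine ⟨fun n x => ψ ((n + 1 : ℝ)⁻¹ • x), 3 * C, hT, fun n x => ⟨ψ.nonneg, ψ.le_one⟩, ?_, ?_, ?_⟩
  · intro n x hx
    exact ψ.one_of_mem_closedBall (by simpa using (hlt n x hx).le)
  · intro n x hx
    rw [hG]
    have : gradient ψ ((n + 1 : ℝ)⁻¹ • x) = 0 := by
      have h1 : (ψ : E → ℝ) =ᶠ[𝓝 ((n + 1 : ℝ)⁻¹ • x)] fun _ => 1 := by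
        filter_upwards [Metric.isOpen_ball.mem_nhds (show (n + 1 : ℝ)⁻¹ • x ∈ Metric.ball (0 : E) 1
          by simpa using hlt n x hx)] with y hy
        exact ψ.one_of_mem_closedBall (Metric.ball_subset_closedBall hy)
      simp [gradient, h1.fderiv_eq]
    rw [this, smul_zero]
  · intro n x
    rw [hG, norm_smul, norm_inv, Real.norm_of_nonneg (hpos n).le]
    by_cases hx : ‖x‖ ≤ 2 * (n + 1)
    · have h1 := wt_le x
      have h2 : wt x * (n + 1 : ℝ)⁻¹ ≤ 3 := by
        rw [← div_eq_mul_inv, div_le_iff₀ (hpos n)]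
        have : (0 : ℝ) ≤ n := n.cast_nonneg
        linarith
      rw [← mul_assoc]
      exact mul_le_mul h2 (hC _) (norm_nonneg _) (by norm_num)
    · have : gradient ψ ((n + 1 : ℝ)⁻¹ • x) = 0 := by
        refine image_eq_zero_of_notMem_tsupport fun h => hx ?_
        have h1 := tsupport_gradient_subset _ h
        rw [ψ.tsupport_eq, mem_closedBall_zero_iff, norm_smul, norm_inv,
          Real.norm_of_nonneg (hpos n).le, inv_mul_le_iff₀ (hpos n)] at h1
        linarith
      rw [this, norm_zero, mul_zero, mul_zero]
      have := (norm_nonneg _).trans (hC 0)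
      positivity

/-- Cutting off far away changes `v` and its gradient little: the error term `v ∇χ` is dominated by a
multiple of `|v| / √(1 + |x|²)`, uniformly in the radius. -/
lemma HasWGrad.exists_cutoff {v : E → ℝ} {g : E → E} (h : HasWGrad v g) {η : ENNReal}
    (hη : 0 < η) : ∃ χ, IsTest χ ∧
      eLpNorm (fun x => χ x * v x / wt x - v x / wt x) 2 volume ≤ η ∧
      eLpNorm (fun x => χ x • g x + v x • gradient χ x - g x) 2 volume ≤ η := by
  obtain ⟨χ, C, hT, h01, hone, hzero, hbd⟩ := Transmission.exists_cutoff
  have hlarge : ∀ x : E, ∀ᶠ n : ℕ in atTop, ‖x‖ < n + 1 := by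
    intro x
    obtain ⟨N, hN⟩ := exists_nat_gt ‖x‖
    filter_upwards [eventually_ge_atTop N] with n hn
    have : (N : ℝ) ≤ n := by exact_mod_cast hn
    linarith
  have hC : 0 ≤ C := le_trans (mul_nonneg (wt_pos 0).le (norm_nonneg _)) (hbd 0 0)
  have habs : ∀ n x, ‖χ n x - 1‖ ≤ 1 := by
    intro n x
    obtain ⟨h0, h1⟩ := h01 n x
    rw [Real.norm_eq_abs, abs_le]
    constructor <;> linarith
  have hvm := h.locallyIntegrable.aestronglyMeasurable
  have t1 : Tendsto (fun n => eLpNorm (fun x => χ n x * v x / wt x - v x / wt x) 2 volume) atTop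
      (𝓝 0) := by
    refine tendsto_eLpNorm_two_zero (b := fun x => ‖v x / wt x‖) (Eventually.of_forall fun n => ?_)
      h.memLp.norm (Eventually.of_forall fun n => Eventually.of_forall fun x => ?_)
      (Eventually.of_forall fun x => ?_)
    · exact (((hT n).continuous.aestronglyMeasurable.mul hvm).div₀
        continuous_wt.aestronglyMeasurable).sub (hvm.div₀ continuous_wt.aestronglyMeasurable)
    · have : χ n x * v x / wt x - v x / wt x = (χ n x - 1) * (v x / wt x) := by ring
      rw [this, norm_mul]
      exact mul_le_of_le_one_left (norm_nonneg _) (habs n x)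
    · refine tendsto_const_nhds.congr' ?_
      filter_upwards [hlarge x] with n hn
      rw [hone n x hn, one_mul, sub_self]
  have t2 : Tendsto (fun n => eLpNorm (fun x => χ n x • g x + v x • gradient (χ n) x - g x) 2
      volume) atTop (𝓝 0) := by
    refine tendsto_eLpNorm_two_zero (b := fun x => ‖g x‖ + C * ‖v x / wt x‖)
      (Eventually.of_forall fun n => ?_) (h.memLp_grad.norm.add (h.memLp.norm.const_mul C))
      (Eventually.of_forall fun n => Eventually.of_forall fun x => ?_)
      (Eventually.of_forall fun x => ?_)
    · exact (((hT n).continuous.aestronglyMeasurable.smul h.memLp_grad.1).add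
        (hvm.smul (hT n).continuous_gradient.aestronglyMeasurable)).sub h.memLp_grad.1
    · have : χ n x • g x + v x • gradient (χ n) x - g x
          = (χ n x - 1) • g x + (v x / wt x) • (wt x • gradient (χ n) x) := by
        rw [smul_smul, div_mul_cancel₀ _ (wt_ne x), sub_smul, one_smul]
        abel
      rw [this]
      refine (norm_add_le _ _).trans (add_le_add ?_ ?_)
      · rw [norm_smul]
        exact mul_le_of_le_one_left (norm_nonneg _) (habs n x)
      · rw [norm_smul, norm_smul, Real.norm_of_nonneg (wt_pos x).le, mul_comm]
        exact mul_le_mul_of_nonneg_right (hbd n x) (norm_nonneg _)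
    · refine tendsto_const_nhds.congr' ?_
      filter_upwards [hlarge x] with n hn
      rw [hone n x hn, hzero n x hn, one_smul, smul_zero, add_zero, sub_self]
  obtain ⟨n, h1, h2⟩ := ((t1.eventually (ge_mem_nhds hη)).and
    (t2.eventually (ge_mem_nhds hη))).exists
  exact ⟨χ n, hT n, h1, h2⟩

/-- Test functions are dense in `H¹_w(ℝ³)`. -/
lemma HasWGrad.exists_test {v : E → ℝ} {g : E → E} (h : HasWGrad v g) {η : ENNReal}
    (hη : 0 < η) : ∃ φ, IsTest φ ∧
      eLpNorm (fun x => φ x / wt x - v x / wt x) 2 volume ≤ η ∧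
      eLpNorm (fun x => gradient φ x - g x) 2 volume ≤ η := by
  have hη2 : 0 < η / 2 := ENNReal.half_pos hη.ne'
  obtain ⟨χ, hχ, h1, h2⟩ := h.exists_cutoff hη2
  have hm := h.mul_test hχ
  obtain ⟨φ, hφ, h3, h4⟩ := hm.exists_test_of_hasCompactSupport hχ.2.mul_right hη2
  have hφw := hφ.hasWGrad
  refine ⟨φ, hφ, ?_, ?_⟩
  · have e : (fun x => φ x / wt x - v x / wt x) = (fun x => φ x / wt x - χ x * v x / wt x) +
        fun x => χ x * v x / wt x - v x / wt x := by
      ext x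
      simp
    rw [e, ← ENNReal.add_halves η]
    refine (eLpNorm_add_le (hφw.memLp.1.sub hm.memLp.1) (hm.memLp.1.sub h.memLp.1)
      (by norm_num)).trans (add_le_add (le_trans (eLpNorm_mono fun x => ?_) h3) h1)
    rw [Pi.sub_apply, ← sub_div, norm_div]
    exact div_le_self (norm_nonneg _)
      (by rw [Real.norm_of_nonneg (wt_pos x).le]; exact one_le_wt x)
  · have e : (fun x => gradient φ x - g x) =
        (fun x => gradient φ x - (χ x • g x + v x • gradient χ x)) +
        fun x => χ x • g x + v x • gradient χ x - g x := by
      ext1 x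
      simp
    rw [e, ← ENNReal.add_halves η]
    exact (eLpNorm_add_le (hφw.memLp_grad.1.sub hm.memLp_grad.1) (hm.memLp_grad.1.sub h.memLp_grad.1)
      (by norm_num)).trans (add_le_add h4 h2)

/-! ### Hardy's inequality -/

lemma toReal_eLpNorm_sq {α F : Type*} {m : MeasurableSpace α} {μ : Measure α}
    [NormedAddCommGroup F] {f : α → F} (hf : MemLp f 2 μ) :
    (eLpNorm f 2 μ).toReal ^ 2 = ∫ x, ‖f x‖ ^ 2 ∂μ := by
  rw [← ENNReal.toReal_pow, eLpNorm_two_sq, integral_eq_lintegral_of_nonneg_ae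
    (Eventually.of_forall fun x => by positivity)
    (show AEStronglyMeasurable (fun x => ‖f x‖ ^ 2) μ from hf.1.norm.pow 2)]
  congr 1
  refine lintegral_congr fun x => ?_
  rw [ENNReal.ofReal_pow (norm_nonneg _), ofReal_norm]

/-- The derivative of the components of the vector field `x / (1 + |x|²)`, whose divergence gives
Hardy's inequality. -/
lemma hasFDerivAt_hardyField (i : Fin 3) (x : E) :
    HasFDerivAt (fun x : E => x i / (1 + ‖x‖ ^ 2))
      ((1 + ‖x‖ ^ 2)⁻¹ • (EuclideanSpace.proj i : E →L[ℝ] ℝ)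
        - (2 * x i / (1 + ‖x‖ ^ 2) ^ 2) • innerSL ℝ x) x := by
  have h1 : HasFDerivAt (fun x : E => x i) (EuclideanSpace.proj i : E →L[ℝ] ℝ) x :=
    (EuclideanSpace.proj i : E →L[ℝ] ℝ).hasFDerivAt
  have h2 : HasFDerivAt (fun x : E => 1 + ‖x‖ ^ 2) (2 • innerSL ℝ x) x :=
    ((hasStrictFDerivAt_norm_sq x).hasFDerivAt).const_add 1
  have hne : 1 + ‖x‖ ^ 2 ≠ 0 := by positivity
  have h3 := h1.mul ((hasDerivAt_inv hne).comp_hasFDerivAt x h2)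
  refine (h3.congr_of_eventuallyEq (Eventually.of_forall fun y => ?_)).congr_fderiv ?_
  · simp [div_eq_mul_inv]
  · ext e
    simp
    ring

/-- Hardy's inequality for test functions. With `Y = x / (1 + |x|²)`, the integral of `div (φ² Y)`
vanishes, and this divergence is at least `φ² / (2 (1 + |x|²)) - 2 |∇φ|²`. -/
lemma IsTest.hardy {φ : E → ℝ} (hφ : IsTest φ) :
    ∫ x, ‖φ x / wt x‖ ^ 2 ≤ 4 * ∫ x, ‖gradient φ x‖ ^ 2 := by
  set Y : Fin 3 → E → ℝ := fun i x => x i / (1 + ‖x‖ ^ 2) with hY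
  have hne : ∀ x : E, 1 + ‖x‖ ^ 2 ≠ 0 := fun x => by positivity
  have hYc : ∀ i, Continuous (Y i) := fun i => by
    simp only [hY]
    exact Continuous.div (by fun_prop) (by fun_prop) hne
  have hsq : IsTest fun x => φ x * φ x := hφ.mul_right hφ.1
  have hYd : ∀ i x, fderiv ℝ (Y i) x (EuclideanSpace.single i 1)
      = (1 + ‖x‖ ^ 2)⁻¹ - 2 * x i ^ 2 / (1 + ‖x‖ ^ 2) ^ 2 := by
    intro i x
    rw [(hasFDerivAt_hardyField i x).fderiv]
    simp [EuclideanSpace.inner_single_right]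
    ring
  have hYdc : ∀ i, Continuous fun x => fderiv ℝ (Y i) x (EuclideanSpace.single i 1) := by
    intro i
    simp only [hYd]
    refine Continuous.sub (Continuous.inv₀ (by fun_prop) hne) (Continuous.div (by fun_prop)
      (by fun_prop) fun x => pow_ne_zero 2 (hne x))
  have hgc : ∀ e : E, Continuous fun x => fderiv ℝ (fun x => φ x * φ x) x e := fun e =>
    (hsq.1.continuous_fderiv (by simp)).clm_apply continuous_const
  have hgs : ∀ e : E, HasCompactSupport fun x => fderiv ℝ (fun x => φ x * φ x) x e := fun e =>
    (hsq.2.fderiv ℝ).mono fun x hx hx' => hx (by simp [hx'])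
  have i1 : ∀ i, Integrable (fun x => φ x * φ x * fderiv ℝ (Y i) x (EuclideanSpace.single i 1))
      volume := fun i =>
    (hsq.continuous.mul (hYdc i)).integrable_of_hasCompactSupport hsq.2.mul_right
  have i2 : ∀ i, Integrable (fun x => fderiv ℝ (fun x => φ x * φ x) x (EuclideanSpace.single i 1)
      * Y i x) volume := fun i =>
    ((hgc _).mul (hYc i)).integrable_of_hasCompactSupport (hgs _).mul_right
  have key : ∀ i, ∫ x, φ x * φ x * fderiv ℝ (Y i) x (EuclideanSpace.single i 1)
      = - ∫ x, fderiv ℝ (fun x => φ x * φ x) x (EuclideanSpace.single i 1) * Y i x := fun i =>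
    integral_mul_fderiv_eq_neg_fderiv_mul_of_integrable (i2 i) (i1 i)
      ((hsq.continuous.mul (hYc i)).integrable_of_hasCompactSupport hsq.2.mul_right)
      (fun x _ => hsq.differentiable x)
      (fun x _ => (hasFDerivAt_hardyField i x).differentiableAt)
  have ha : Integrable (fun x => ‖φ x / wt x‖ ^ 2) volume :=
    hφ.hasWGrad.memLp.integrable_norm_pow two_ne_zero
  have hb : Integrable (fun x => ‖gradient φ x‖ ^ 2) volume :=
    hφ.memLp_gradient.integrable_norm_pow two_ne_zero
  have hsum : ∫ x, ∑ i, (φ x * φ x * fderiv ℝ (Y i) x (EuclideanSpace.single i 1)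
      + fderiv ℝ (fun x => φ x * φ x) x (EuclideanSpace.single i 1) * Y i x) = 0 := by
    rw [integral_finsetSum _ fun i _ => by exact (i1 i).add (i2 i)]
    refine Finset.sum_eq_zero fun i _ => ?_
    rw [integral_add (i1 i) (i2 i), key i]
    ring
  have hnormsq : ∀ x : E, ‖x‖ ^ 2 = x 0 ^ 2 + x 1 ^ 2 + x 2 ^ 2 := by
    intro x
    rw [EuclideanSpace.norm_sq_eq]
    simp [Fin.sum_univ_three]
  have hinner : ∀ x : E, ∑ i, fderiv ℝ (fun x => φ x * φ x) x (EuclideanSpace.single i 1) * Y i x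
      = 2 * φ x * inner ℝ (gradient φ x) x / (1 + ‖x‖ ^ 2) := by
    intro x
    have h1 : ∀ i, fderiv ℝ (fun x => φ x * φ x) x (EuclideanSpace.single i 1)
        = 2 * φ x * gradient φ x i := by
      intro i
      rw [← inner_gradient_left, gradient_mul (hφ.differentiable x) (hφ.differentiable x)]
      simp [EuclideanSpace.inner_single_right]
      ring
    simp only [h1, hY, PiLp.inner_apply, Fin.sum_univ_three]
    simp
    ring
  have hpt : ∀ x, ‖φ x / wt x‖ ^ 2 / 2 - 2 * ‖gradient φ x‖ ^ 2 ≤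
      ∑ i, (φ x * φ x * fderiv ℝ (Y i) x (EuclideanSpace.single i 1)
      + fderiv ℝ (fun x => φ x * φ x) x (EuclideanSpace.single i 1) * Y i x) := by
    intro x
    rw [Finset.sum_add_distrib, hinner, ← Finset.mul_sum]
    simp only [hYd]
    rw [Finset.sum_sub_distrib, norm_div, div_pow, Real.norm_of_nonneg (wt_pos x).le, wt_sq,
      Real.norm_eq_abs, sq_abs]
    have hs : ∑ i : Fin 3, 2 * x i ^ 2 / (1 + ‖x‖ ^ 2) ^ 2 = 2 * ‖x‖ ^ 2 / (1 + ‖x‖ ^ 2) ^ 2 := by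
      rw [← Finset.sum_div, ← Finset.mul_sum, hnormsq x, Fin.sum_univ_three]
    rw [hs]
    simp only [Finset.sum_const, Finset.card_univ, Fintype.card_fin, nsmul_eq_mul]
    have hcs := abs_real_inner_le_norm (gradient φ x) x
    set s := (inner ℝ (gradient φ x) x : ℝ)
    set p := ‖gradient φ x‖
    set r := ‖x‖
    have hr : 0 ≤ r := norm_nonneg _
    have hp : 0 ≤ p := norm_nonneg _
    have hq : 0 < 1 + r ^ 2 := by positivity
    have hs2 : s ^ 2 ≤ p ^ 2 * (1 + r ^ 2) := by
      have : s ^ 2 ≤ (p * r) ^ 2 := sq_le_sq' (by linarith [abs_le.1 hcs]) (abs_le.1 hcs).2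
      nlinarith [sq_nonneg p]
    -- Completing the square writes the difference of the two sides as a sum of nonnegative terms.
    have h3 : φ x * φ x * (((3 : ℕ) : ℝ) * (1 + r ^ 2)⁻¹ - 2 * r ^ 2 / (1 + r ^ 2) ^ 2) +
        2 * φ x * s / (1 + r ^ 2) - (φ x ^ 2 / (1 + r ^ 2) / 2 - 2 * p ^ 2)
        = ((φ x + 2 * s) ^ 2 / (1 + r ^ 2) / 2) + 2 * (p ^ 2 * (1 + r ^ 2) - s ^ 2) / (1 + r ^ 2)
          + 2 * φ x ^ 2 / (1 + r ^ 2) ^ 2 := by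
      push_cast
      field_simp
      ring
    have h4 : 0 ≤ 2 * (p ^ 2 * (1 + r ^ 2) - s ^ 2) / (1 + r ^ 2) :=
      div_nonneg (by linarith) hq.le
    have h5 : 0 ≤ (φ x + 2 * s) ^ 2 / (1 + r ^ 2) / 2 := by positivity
    have h6 : 0 ≤ 2 * φ x ^ 2 / (1 + r ^ 2) ^ 2 := by positivity
    linarith
  have hfin := integral_mono ((ha.div_const 2).sub (hb.const_mul 2))
    (integrable_finsetSum _ fun i _ => (i1 i).add (i2 i)) hpt
  simp only [Pi.sub_apply] at hfin
  rw [integral_sub (ha.div_const 2) (hb.const_mul 2), integral_div, integral_const_mul] at hfin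
  have hsum' := hsum
  linarith [hfin.trans_eq hsum']

/-- Hardy's inequality: the norm of `H¹_w(ℝ³)` is controlled by the gradient. -/
lemma HasWGrad.hardy {v : E → ℝ} {g : E → E} (h : HasWGrad v g) :
    eLpNorm (fun x => v x / wt x) 2 volume ≤ 2 * eLpNorm g 2 volume := by
  have htest : ∀ φ, IsTest φ →
      eLpNorm (fun x => φ x / wt x) 2 volume ≤ 2 * eLpNorm (gradient φ) 2 volume := by
    intro φ hφ
    have h1 := hφ.hardy
    rw [← toReal_eLpNorm_sq hφ.hasWGrad.memLp, ← toReal_eLpNorm_sq hφ.memLp_gradient] at h1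
    have h2 : (eLpNorm (fun x => φ x / wt x) 2 volume).toReal
        ≤ 2 * (eLpNorm (gradient φ) 2 volume).toReal := by
      refine abs_le_of_sq_le_sq' ?_ (by positivity) |>.2
      nlinarith
    rw [← ENNReal.toReal_le_toReal hφ.hasWGrad.memLp.2.ne
      (ENNReal.mul_ne_top (by simp) hφ.memLp_gradient.2.ne), ENNReal.toReal_mul]
    simpa using h2
  refine ENNReal.le_of_forall_pos_le_add fun η hη _ => ?_
  have hη3 : (0 : ENNReal) < η / 3 := ENNReal.div_pos (by exact_mod_cast hη.ne') (by simp)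
  obtain ⟨φ, hφ, h1, h2⟩ := h.exists_test hη3
  have hφw := hφ.hasWGrad
  have e1 : (fun x => v x / wt x) = (fun x => φ x / wt x) - fun x => φ x / wt x - v x / wt x := by
    ext x
    simp
  have e2 : gradient φ = g + fun x => gradient φ x - g x := by
    ext1 x
    simp
  have b2 : eLpNorm (gradient φ) 2 volume ≤ eLpNorm g 2 volume + η / 3 := by
    rw [e2]
    refine (eLpNorm_add_le h.memLp_grad.1 (hφw.memLp_grad.1.sub h.memLp_grad.1)
      (by norm_num)).trans (add_le_add_right h2 _)
  calc eLpNorm (fun x => v x / wt x) 2 volume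
      ≤ eLpNorm (fun x => φ x / wt x) 2 volume + η / 3 := by
        rw [e1]
        refine (eLpNorm_sub_le hφw.memLp.1 (hφw.memLp.1.sub h.memLp.1) (by norm_num)).trans (add_le_add_right h1 _)
    _ ≤ 2 * (eLpNorm g 2 volume + η / 3) + η / 3 := by
        gcongr
        exact (htest φ hφ).trans (by gcongr)
    _ = 2 * eLpNorm g 2 volume + 3 * (η / 3) := by ring
    _ = 2 * eLpNorm g 2 volume + η := by
        rw [ENNReal.mul_div_cancel (by simp) (by simp)]

/-! ### The Hilbert space of pairs and the Lax–Milgram theorem -/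

lemma integral_norm_mul_norm_le {α F G : Type*} {m : MeasurableSpace α} {μ : Measure α}
    [NormedAddCommGroup F] [NormedAddCommGroup G] {f : α → F} {g : α → G} (hf : MemLp f 2 μ)
    (hg : MemLp g 2 μ) :
    ∫ x, ‖f x‖ * ‖g x‖ ∂μ ≤ (eLpNorm f 2 μ).toReal * (eLpNorm g 2 μ).toReal := by
  have h := real_inner_le_norm (hf.norm.toLp _) (hg.norm.toLp _)
  rw [L2.inner_def, Lp.norm_toLp, Lp.norm_toLp, eLpNorm_norm, eLpNorm_norm] at h
  refine le_trans (le_of_eq (integral_congr_ae ?_)) h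
  filter_upwards [hf.norm.coeFn_toLp, hg.norm.coeFn_toLp] with x h1 h2
  rw [h1, h2]
  simp [mul_comm]

lemma integrable_norm_mul_norm {α F G : Type*} {m : MeasurableSpace α} {μ : Measure α}
    [NormedAddCommGroup F] [NormedAddCommGroup G] {f : α → F} {g : α → G} (hf : MemLp f 2 μ)
    (hg : MemLp g 2 μ) : Integrable (fun x => ‖f x‖ * ‖g x‖) μ :=
  MemLp.integrable_mul hf.norm hg.norm

lemma integrable_inner_of_memLp {α F : Type*} {m : MeasurableSpace α} {μ : Measure α}
    [NormedAddCommGroup F] [InnerProductSpace ℝ F] {f g : α → F} (hf : MemLp f 2 μ)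
    (hg : MemLp g 2 μ) : Integrable (fun x => (inner ℝ (f x) (g x) : ℝ)) μ :=
  (integrable_norm_mul_norm hf hg).mono' (hf.1.inner hg.1)
    (Eventually.of_forall fun _ => norm_inner_le_norm _ _)

/-- The Hilbert space `L²(ℝ³) × L²(ℝ³; ℝ³)`, which contains `H¹_w(ℝ³)` through
`v ↦ (v / √(1 + |x|²), ∇v)`. -/
abbrev PairSpace : Type := WithLp 2 (Lp ℝ 2 (volume : Measure E) × Lp E 2 (volume : Measure E))

/-- The pair `(a, b)` as an element of the Hilbert space. -/
noncomputable def mkPair {a : E → ℝ} {b : E → E} (ha : MemLp a 2 volume) (hb : MemLp b 2 volume) :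
    PairSpace := WithLp.toLp 2 (ha.toLp a, hb.toLp b)

/-- The pair `(v / √(1 + |x|²), ∇v)`. -/
noncomputable def HasWGrad.toPair {v : E → ℝ} {g : E → E} (h : HasWGrad v g) : PairSpace :=
  mkPair h.memLp h.memLp_grad

lemma inner_mkPair {a : E → ℝ} {b : E → E} (ha : MemLp a 2 volume) (hb : MemLp b 2 volume)
    (x : PairSpace) :
    inner ℝ (mkPair ha hb) x = (∫ y, a y * x.fst y) + ∫ y, inner ℝ (b y) (x.snd y) := by
  rw [WithLp.prod_inner_apply, L2.inner_def, L2.inner_def]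
  congr 1
  · refine integral_congr_ae ?_
    filter_upwards [ha.coeFn_toLp] with y hy
    simp only [mkPair, hy, WithLp.fst]
    simp [mul_comm]
  · refine integral_congr_ae ?_
    filter_upwards [hb.coeFn_toLp] with y hy
    simp only [mkPair, hy, WithLp.snd]

lemma HasWGrad.toPair_fst {v : E → ℝ} {g : E → E} (h : HasWGrad v g) :
    h.toPair.fst =ᵐ[volume] fun x => v x / wt x := h.memLp.coeFn_toLp

lemma HasWGrad.toPair_snd {v : E → ℝ} {g : E → E} (h : HasWGrad v g) :
    h.toPair.snd =ᵐ[volume] g := h.memLp_grad.coeFn_toLp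

lemma inner_toPair {a : E → ℝ} {b : E → E} (ha : MemLp a 2 volume) (hb : MemLp b 2 volume)
    {v : E → ℝ} {g : E → E} (h : HasWGrad v g) :
    inner ℝ (mkPair ha hb) h.toPair = (∫ y, a y * (v y / wt y)) + ∫ y, inner ℝ (b y) (g y) := by
  rw [inner_mkPair]
  congr 1
  · refine integral_congr_ae ?_
    filter_upwards [h.toPair_fst] with y hy
    rw [hy]
  · refine integral_congr_ae ?_
    filter_upwards [h.toPair_snd] with y hy
    rw [hy]

lemma norm_mkPair_le {a : E → ℝ} {b : E → E} (ha : MemLp a 2 volume) (hb : MemLp b 2 volume) :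
    ‖mkPair ha hb‖ ≤ (eLpNorm a 2 volume).toReal + (eLpNorm b 2 volume).toReal := by
  have h := WithLp.prod_norm_sq_eq_of_L2 (mkPair ha hb)
  have h1 : ‖(mkPair ha hb).fst‖ = (eLpNorm a 2 volume).toReal := Lp.norm_toLp a ha
  have h2 : ‖(mkPair ha hb).snd‖ = (eLpNorm b 2 volume).toReal := Lp.norm_toLp b hb
  rw [h1, h2] at h
  refine abs_le_of_sq_le_sq' ?_ (by positivity) |>.2
  rw [h]
  nlinarith [mul_nonneg (ENNReal.toReal_nonneg (a := eLpNorm a 2 volume))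
    (ENNReal.toReal_nonneg (a := eLpNorm b 2 volume))]

lemma norm_mkPair_sub_le {a a' : E → ℝ} {b b' : E → E} (ha : MemLp a 2 volume)
    (hb : MemLp b 2 volume) (ha' : MemLp a' 2 volume) (hb' : MemLp b' 2 volume) {η : ENNReal}
    (hη : η ≠ ⊤) (h1 : eLpNorm (fun x => a x - a' x) 2 volume ≤ η)
    (h2 : eLpNorm (fun x => b x - b' x) 2 volume ≤ η) :
    ‖mkPair ha hb - mkPair ha' hb'‖ ≤ 2 * η.toReal := by
  have e : mkPair ha hb - mkPair ha' hb' = mkPair (ha.sub ha') (hb.sub hb') := by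
    rfl
  rw [e, two_mul]
  exact (norm_mkPair_le _ _).trans (add_le_add (ENNReal.toReal_mono hη h1)
    (ENNReal.toReal_mono hη h2))

lemma HasWGrad.toPair_mem_closure {v : E → ℝ} {g : E → E} (h : HasWGrad v g) :
    h.toPair ∈ closure {x | ∃ φ, ∃ hφ : IsTest φ, x = hφ.hasWGrad.toPair} := by
  rw [Metric.mem_closure_iff]
  intro δ hδ
  obtain ⟨φ, hφ, h1, h2⟩ := h.exists_test (η := ENNReal.ofReal (δ / 4)) (by simpa using hδ)
  refine ⟨_, ⟨φ, hφ, rfl⟩, ?_⟩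
  rw [dist_comm, dist_eq_norm]
  refine (norm_mkPair_sub_le _ _ _ _ ENNReal.ofReal_ne_top h1 h2).trans_lt ?_
  rw [ENNReal.toReal_ofReal (by positivity)]
  linarith

/-- Bounded functionals that agree on test functions agree on `H¹_w(ℝ³)`. -/
lemma HasWGrad.eq_of_eq_on_test {v : E → ℝ} {g : E → E} (h : HasWGrad v g)
    {F G : PairSpace → ℝ} (hF : Continuous F) (hG : Continuous G)
    (hFG : ∀ φ, ∀ hφ : IsTest φ, F hφ.hasWGrad.toPair = G hφ.hasWGrad.toPair) :
    F h.toPair = G h.toPair := by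
  refine (isClosed_eq hF hG).closure_subset_iff.2 ?_ h.toPair_mem_closure
  rintro x ⟨φ, hφ, rfl⟩
  exact hFG φ hφ

lemma memLp_wt_mul_inner {φ : E → ℝ} (hφ : IsTest φ) (e : E) :
    MemLp (fun x => wt x * inner ℝ (gradient φ x) e) 2 volume := by
  have hc := hφ.continuous_gradient
  refine Continuous.memLp_of_hasCompactSupport (by fun_prop) ?_
  exact (hasCompactSupport_gradient hφ.2).mono fun x hx hx' => hx (by simp [hx'])

lemma memLp_smul_const {φ : E → ℝ} (hφ : IsTest φ) (e : E) :
    MemLp (fun x => φ x • e) 2 volume := by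
  have hc := hφ.continuous
  refine Continuous.memLp_of_hasCompactSupport (by fun_prop) ?_
  exact hφ.2.mono fun x hx hx' => hx (by simp [hx'])

/-- `H¹_w(ℝ³)` as a closed subspace of the Hilbert space of pairs: the orthogonal complement of the
pairs through which the definition of a weak gradient is tested. -/
noncomputable def sobolevSpace : Submodule ℝ PairSpace :=
  (Submodule.span ℝ {ξ : PairSpace | ∃ φ, ∃ hφ : IsTest φ, ∃ e : E,
    ξ = mkPair (memLp_wt_mul_inner hφ e) (memLp_smul_const hφ e)})ᗮ

/-- The elements of `sobolevSpace` are the pairs `(v / √(1 + |x|²), ∇v)` with `v ∈ H¹_w(ℝ³)`. -/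
lemma mem_sobolevSpace_iff (x : PairSpace) :
    x ∈ sobolevSpace ↔ HasWGrad (fun y => wt y * x.fst y) x.snd := by
  have h1 : x ∈ sobolevSpace ↔ ∀ φ, ∀ hφ : IsTest φ, ∀ e : E,
      inner ℝ (mkPair (memLp_wt_mul_inner hφ e) (memLp_smul_const hφ e)) x = 0 := by
    rw [sobolevSpace, Submodule.mem_orthogonal]
    constructor
    · intro h φ hφ e
      exact h _ (Submodule.subset_span ⟨φ, hφ, e, rfl⟩)
    · intro h u hu
      induction hu using Submodule.span_induction with
      | mem u hu =>
        obtain ⟨φ, hφ, e, rfl⟩ := hu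
        exact h φ hφ e
      | zero => simp
      | add u w _ _ hu hw => rw [inner_add_left, hu, hw, add_zero]
      | smul c u _ hu => rw [real_inner_smul_left, hu, mul_zero]
  have h2 : ∀ φ, ∀ hφ : IsTest φ, ∀ e : E,
      (inner ℝ (mkPair (memLp_wt_mul_inner hφ e) (memLp_smul_const hφ e)) x = 0 ↔
        ∫ y, wt y * x.fst y * inner ℝ (gradient φ y) e = - ∫ y, φ y * inner ℝ (x.snd y) e) := by
    intro φ hφ e
    rw [inner_mkPair, add_eq_zero_iff_eq_neg]
    have e1 : ∫ y, wt y * inner ℝ (gradient φ y) e * x.fst y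
        = ∫ y, wt y * x.fst y * inner ℝ (gradient φ y) e :=
      integral_congr_ae (Eventually.of_forall fun y => by simp only; ring)
    have e2 : ∫ y, inner ℝ (φ y • e) (x.snd y) = ∫ y, φ y * inner ℝ (x.snd y) e :=
      integral_congr_ae (Eventually.of_forall fun y => by
        simp only [real_inner_smul_left, real_inner_comm])
    rw [e1, e2]
  rw [h1]
  constructor
  · intro h
    refine ⟨?_, Lp.memLp _, fun φ hφ e => (h2 φ hφ e).1 (h φ hφ e)⟩
    refine (Lp.memLp x.fst).ae_eq (Eventually.of_forall fun y => ?_)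
    simp only
    rw [mul_div_cancel_left₀ _ (wt_ne y)]
  · intro h φ hφ e
    exact (h2 φ hφ e).2 (h.weak φ hφ e)

lemma HasWGrad.toPair_mem {v : E → ℝ} {g : E → E} (h : HasWGrad v g) :
    h.toPair ∈ sobolevSpace := by
  rw [mem_sobolevSpace_iff]
  refine h.congr ?_ h.toPair_snd.symm
  filter_upwards [h.toPair_fst] with x hx
  rw [hx, mul_div_cancel₀ _ (wt_ne x)]

/-- `H¹_w(ℝ³)` is closed under limits in the Hilbert space of pairs. -/
lemma hasWGrad_of_approx {v : E → ℝ} {g : E → E} (h1 : MemLp (fun x => v x / wt x) 2 volume)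
    (h2 : MemLp g 2 volume) (h : ∀ η : ENNReal, 0 < η → ∃ v' g', HasWGrad v' g' ∧
      eLpNorm (fun x => v' x / wt x - v x / wt x) 2 volume ≤ η ∧
      eLpNorm (fun x => g' x - g x) 2 volume ≤ η) : HasWGrad v g := by
  have hmem : mkPair h1 h2 ∈ sobolevSpace := by
    have hcl : IsClosed (sobolevSpace : Set PairSpace) := Submodule.isClosed_orthogonal _
    rw [← SetLike.mem_coe, ← hcl.closure_eq, Metric.mem_closure_iff]
    intro δ hδ
    obtain ⟨v', g', h', h3, h4⟩ := h (ENNReal.ofReal (δ / 4)) (by simpa using hδ)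
    refine ⟨_, h'.toPair_mem, ?_⟩
    rw [dist_comm, dist_eq_norm]
    refine (norm_mkPair_sub_le _ _ _ _ ENNReal.ofReal_ne_top h3 h4).trans_lt ?_
    rw [ENNReal.toReal_ofReal (by positivity)]
    linarith
  rw [mem_sobolevSpace_iff] at hmem
  refine hmem.congr ?_ h2.coeFn_toLp
  have : (mkPair h1 h2).fst =ᵐ[volume] fun x => v x / wt x := h1.coeFn_toLp
  filter_upwards [this] with x hx
  rw [hx, mul_div_cancel₀ _ (wt_ne x)]

/-- By Hardy's inequality, the gradient controls the norm of the pair. -/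
lemma HasWGrad.norm_toPair_le {v : E → ℝ} {g : E → E} (h : HasWGrad v g) :
    ‖h.toPair‖ ≤ 3 * (eLpNorm g 2 volume).toReal := by
  have h1 := norm_mkPair_le h.memLp h.memLp_grad
  have h2 := ENNReal.toReal_mono (ENNReal.mul_ne_top (by simp) h.memLp_grad.2.ne) h.hardy
  rw [ENNReal.toReal_mul, ENNReal.toReal_ofNat] at h2
  refine h1.trans ?_
  linarith

lemma integrable_coeff_inner {a : E → ℝ} (ha : Measurable a) {C : ℝ} (hC : ∀ x, |a x| ≤ C)
    {g h : E → E} (hg : MemLp g 2 volume) (hh : MemLp h 2 volume) :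
    Integrable (fun x => a x * inner ℝ (g x) (h x)) volume := by
  refine ((integrable_norm_mul_norm hg hh).const_mul C).mono'
    (ha.aestronglyMeasurable.mul (hg.1.inner hh.1)) (Eventually.of_forall fun x => ?_)
  rw [norm_mul]
  exact mul_le_mul (hC x) (norm_inner_le_norm _ _) (norm_nonneg _) ((abs_nonneg _).trans (hC x))

lemma abs_integral_coeff_inner_le {a : E → ℝ} (ha : Measurable a) {C : ℝ} (hC : ∀ x, |a x| ≤ C)
    {g h : E → E} (hg : MemLp g 2 volume) (hh : MemLp h 2 volume) :
    |∫ x, a x * inner ℝ (g x) (h x)| ≤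
      C * ((eLpNorm g 2 volume).toReal * (eLpNorm h 2 volume).toReal) := by
  have hC0 : 0 ≤ C := (abs_nonneg _).trans (hC 0)
  calc |∫ x, a x * inner ℝ (g x) (h x)| ≤ ∫ x, |a x * inner ℝ (g x) (h x)| :=
        abs_integral_le_integral_abs
    _ ≤ ∫ x, C * (‖g x‖ * ‖h x‖) := by
        refine integral_mono (integrable_coeff_inner ha hC hg hh).norm
          ((integrable_norm_mul_norm hg hh).const_mul C) fun x => ?_
        simp only
        rw [abs_mul]
        exact mul_le_mul (hC x) (abs_real_inner_le_norm _ _) (abs_nonneg _) hC0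
    _ ≤ _ := by
        rw [integral_const_mul]
        exact mul_le_mul_of_nonneg_left (integral_norm_mul_norm_le hg hh) hC0

/-- The form `∫ a g · h` on `L²(ℝ³; ℝ³)`, as a bilinear map. -/
noncomputable def coeffBilin {a : E → ℝ} (ha : Measurable a) {C : ℝ} (hC : ∀ x, |a x| ≤ C) :
    Lp E 2 (volume : Measure E) →ₗ[ℝ] Lp E 2 (volume : Measure E) →ₗ[ℝ] ℝ :=
  LinearMap.mk₂ ℝ (fun g h => ∫ x, a x * inner ℝ (g x) (h x))
    (by
      intro v v' w
      rw [← integral_add (integrable_coeff_inner ha hC (Lp.memLp v) (Lp.memLp w))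
        (integrable_coeff_inner ha hC (Lp.memLp v') (Lp.memLp w))]
      refine integral_congr_ae ?_
      filter_upwards [Lp.coeFn_add v v'] with x hx
      rw [hx, Pi.add_apply, inner_add_left, mul_add])
    (by
      intro c v w
      rw [smul_eq_mul, ← integral_const_mul]
      refine integral_congr_ae ?_
      filter_upwards [Lp.coeFn_smul c v] with x hx
      rw [hx, Pi.smul_apply, real_inner_smul_left]
      ring)
    (by
      intro v w w'
      rw [← integral_add (integrable_coeff_inner ha hC (Lp.memLp v) (Lp.memLp w))
        (integrable_coeff_inner ha hC (Lp.memLp v) (Lp.memLp w'))]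
      refine integral_congr_ae ?_
      filter_upwards [Lp.coeFn_add w w'] with x hx
      rw [hx, Pi.add_apply, inner_add_right, mul_add])
    (by
      intro c v w
      rw [smul_eq_mul, ← integral_const_mul]
      refine integral_congr_ae ?_
      filter_upwards [Lp.coeFn_smul c w] with x hx
      rw [hx, Pi.smul_apply, real_inner_smul_right]
      ring)

lemma norm_coeffBilin_le {a : E → ℝ} (ha : Measurable a) {C : ℝ} (hC : ∀ x, |a x| ≤ C)
    (v w : Lp E 2 (volume : Measure E)) : ‖coeffBilin ha hC v w‖ ≤ C * ‖v‖ * ‖w‖ := by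
  have h := abs_integral_coeff_inner_le ha hC (Lp.memLp v) (Lp.memLp w)
  rw [← mul_assoc] at h
  exact h

/-- The form `∫ a g · h` on `L²(ℝ³; ℝ³)`, as a bounded bilinear map. -/
noncomputable def coeffForm {a : E → ℝ} (ha : Measurable a) {C : ℝ} (hC : ∀ x, |a x| ≤ C) :
    Lp E 2 (volume : Measure E) →L[ℝ] Lp E 2 (volume : Measure E) →L[ℝ] ℝ :=
  LinearMap.mkContinuous₂ (coeffBilin ha hC) C (norm_coeffBilin_le ha hC)

/-- The form `∫ a ∇v · ∇w` on `H¹_w(ℝ³)`. -/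
noncomputable def energyForm {a : E → ℝ} (ha : Measurable a) {C : ℝ} (hC : ∀ x, |a x| ≤ C) :
    sobolevSpace →L[ℝ] sobolevSpace →L[ℝ] ℝ :=
  (coeffForm ha hC).bilinearComp ((WithLp.sndL 2 ℝ _ _).comp sobolevSpace.subtypeL)
    ((WithLp.sndL 2 ℝ _ _).comp sobolevSpace.subtypeL)

lemma energyForm_apply {a : E → ℝ} (ha : Measurable a) {C : ℝ} (hC : ∀ x, |a x| ≤ C)
    (v w : sobolevSpace) : energyForm ha hC v w
      = ∫ x, a x * inner ℝ ((v : PairSpace).snd x) ((w : PairSpace).snd x) := rfl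

lemma norm_le_of_mem_sobolevSpace {x : PairSpace} (hx : x ∈ sobolevSpace) :
    ‖x‖ ≤ 3 * (eLpNorm x.snd 2 volume).toReal := by
  have hv := (mem_sobolevSpace_iff x).1 hx
  have h2 := hv.norm_toPair_le
  have h3 : hv.toPair = x := by
    refine WithLp.ofLp_injective 2 (Prod.ext ?_ ?_)
    · refine Lp.ext ?_
      filter_upwards [hv.toPair_fst] with y hy
      refine hy.trans ?_
      rw [mul_div_cancel_left₀ _ (wt_ne y)]
      rfl
    · exact Lp.ext hv.toPair_snd
  rwa [h3] at h2

/-- The energy form is coercive: the gradient controls the norm up to the factor `3`, whence the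
constant `c / 9`. -/
lemma isCoercive_energyForm {a : E → ℝ} (ha : Measurable a) {c C : ℝ} (hc : 0 < c)
    (hca : ∀ x, c ≤ a x) (hC : ∀ x, |a x| ≤ C) : IsCoercive (energyForm ha hC) := by
  refine ⟨c / 9, by positivity, fun v => ?_⟩
  have h1 := norm_le_of_mem_sobolevSpace v.2
  have h4 : c * (eLpNorm (v : PairSpace).snd 2 volume).toReal ^ 2 ≤ energyForm ha hC v v := by
    rw [energyForm_apply, toReal_eLpNorm_sq (Lp.memLp _), ← integral_const_mul]
    refine integral_mono (((Lp.memLp (v : PairSpace).snd).integrable_norm_pow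
      two_ne_zero).const_mul c) (integrable_coeff_inner ha hC (Lp.memLp _) (Lp.memLp _))
      fun x => ?_
    simp only
    rw [real_inner_self_eq_norm_sq]
    exact mul_le_mul_of_nonneg_right (hca x) (by positivity)
  refine le_trans ?_ h4
  rw [Submodule.coe_norm]
  have h5 : ‖(v : PairSpace)‖ ^ 2 ≤ 9 * (eLpNorm (v : PairSpace).snd 2 volume).toReal ^ 2 := by
    nlinarith [norm_nonneg (v : PairSpace)]
  nlinarith

/-- The Lax–Milgram theorem for the energy form. -/
lemma exists_energyForm_eq {a : E → ℝ} (ha : Measurable a) {c C : ℝ} (hc : 0 < c)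
    (hca : ∀ x, c ≤ a x) (hC : ∀ x, |a x| ≤ C) (F : PairSpace →L[ℝ] ℝ) :
    ∃ u : sobolevSpace, ∀ w : sobolevSpace, energyForm ha hC u w = F w := by
  have : CompleteSpace sobolevSpace := by
    unfold sobolevSpace
    infer_instance
  have hcoer := isCoercive_energyForm ha hc hca hC
  generalize energyForm ha hC = B at hcoer
  refine ⟨hcoer.continuousLinearEquivOfBilin.symm ((InnerProductSpace.toDual ℝ sobolevSpace).symm
    (F.comp sobolevSpace.subtypeL)), fun w => ?_⟩
  rw [← hcoer.continuousLinearEquivOfBilin_apply, ContinuousLinearEquiv.apply_symm_apply,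
    InnerProductSpace.toDual_symm_apply]
  rfl

/-- Existence for the transmission problem, for bounded data on the Hilbert space of pairs. -/
lemma exists_weak_solution {a : E → ℝ} (ha : Measurable a) {c C : ℝ} (hc : 0 < c)
    (hca : ∀ x, c ≤ a x) (hC : ∀ x, |a x| ≤ C) (F : PairSpace →L[ℝ] ℝ) :
    ∃ v g, HasWGrad v g ∧ ∀ w h, ∀ hw : HasWGrad w h,
      ∫ x, a x * inner ℝ (g x) (h x) = F hw.toPair := by
  obtain ⟨u, hu⟩ := exists_energyForm_eq ha hc hca hC F
  refine ⟨_, _, (mem_sobolevSpace_iff u).1 u.2, fun w h hw => ?_⟩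
  rw [← hu ⟨hw.toPair, hw.toPair_mem⟩, energyForm_apply]
  refine integral_congr_ae ?_
  filter_upwards [hw.toPair_snd] with x hx
  simp only [hx]

/-! ### Right-hand sides in the dual space -/

lemma mkPair_congr {a a' : E → ℝ} {b b' : E → E} (ha : MemLp a 2 volume) (hb : MemLp b 2 volume)
    (ha' : MemLp a' 2 volume) (hb' : MemLp b' 2 volume) (h1 : a =ᵐ[volume] a')
    (h2 : b =ᵐ[volume] b') : mkPair ha hb = mkPair ha' hb' := by
  unfold mkPair
  rw [(MemLp.toLp_eq_toLp_iff ha ha').2 h1, (MemLp.toLp_eq_toLp_iff hb hb').2 h2]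

lemma HasWGrad.toPair_sub {v v' : E → ℝ} {g g' : E → E} (h : HasWGrad v g) (h' : HasWGrad v' g') :
    (h.sub h').toPair = h.toPair - h'.toPair := by
  have e : h.toPair - h'.toPair
      = mkPair (h.memLp.sub h'.memLp) (h.memLp_grad.sub h'.memLp_grad) := rfl
  rw [e]
  exact mkPair_congr _ _ _ _ (Eventually.of_forall fun x => sub_div _ _ _) (EventuallyEq.refl _ _)

lemma HasWGrad.toPair_const_mul {v : E → ℝ} {g : E → E} (h : HasWGrad v g) (c : ℝ) :
    (h.const_mul c).toPair = c • h.toPair := by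
  have e : c • h.toPair = mkPair (h.memLp.const_smul c) (h.memLp_grad.const_smul c) := rfl
  rw [e]
  exact mkPair_congr _ _ _ _ (Eventually.of_forall fun x => mul_div_assoc _ _ _)
    (EventuallyEq.refl _ _)

lemma HasWGrad.toPair_congr {v v' : E → ℝ} {g g' : E → E} (h : HasWGrad v g) (h' : HasWGrad v' g')
    (hv : v =ᵐ[volume] v') : h.toPair = h'.toPair := by
  refine mkPair_congr _ _ _ _ ?_ (h.ae_eq h' hv)
  filter_upwards [hv] with x hx
  rw [hx]

lemma IsTest.sub {φ ψ : E → ℝ} (h : IsTest φ) (h' : IsTest ψ) : IsTest fun x => φ x - ψ x :=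
  ⟨h.1.sub h'.1, h.2.sub h'.2⟩

lemma IsTest.const_mul {φ : E → ℝ} (h : IsTest φ) (c : ℝ) : IsTest fun x => c * φ x :=
  ⟨contDiff_const.mul h.1, h.2.mul_left⟩

/-- The test functions as a subspace of the Hilbert space of pairs. -/
noncomputable def testSpace : Submodule ℝ PairSpace where
  carrier := {x | ∃ φ, ∃ hφ : IsTest φ, x = hφ.hasWGrad.toPair}
  zero_mem' := by
    have h0 : IsTest fun _ => 0 := ⟨contDiff_const, HasCompactSupport.zero⟩
    refine ⟨_, h0, ?_⟩
    rw [← zero_smul ℝ h0.hasWGrad.toPair, ← HasWGrad.toPair_const_mul]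
    exact HasWGrad.toPair_congr _ _ (Eventually.of_forall fun x => by simp)
  add_mem' := by
    rintro _ _ ⟨φ, hφ, rfl⟩ ⟨ψ, hψ, rfl⟩
    refine ⟨fun x => φ x - (-1) * ψ x, hφ.sub (hψ.const_mul _), ?_⟩
    rw [HasWGrad.toPair_congr _ (hφ.hasWGrad.sub (hψ.hasWGrad.const_mul (-1)))
      (EventuallyEq.refl _ _), hφ.hasWGrad.toPair_sub (hψ.hasWGrad.const_mul (-1)),
      hψ.hasWGrad.toPair_const_mul]
    simp
  smul_mem' := by
    rintro c _ ⟨φ, hφ, rfl⟩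
    refine ⟨fun x => c * φ x, hφ.const_mul c, ?_⟩
    rw [HasWGrad.toPair_congr _ (hφ.hasWGrad.const_mul c) (EventuallyEq.refl _ _),
      HasWGrad.toPair_const_mul]

lemma mul_wt_mul_toPair_fst {f v : E → ℝ} {g : E → E} (h : HasWGrad v g) :
    (fun x => f x * (wt x * h.toPair.fst x)) =ᵐ[volume] fun x => f x * v x := by
  filter_upwards [h.toPair_fst] with x hx
  rw [hx, mul_div_cancel₀ _ (wt_ne x)]

/-- An `f` in the dual space extends to a bounded functional on the Hilbert space of pairs. -/
lemma exists_functional {f : E → ℝ} (hf : MemLp f 2 volume) {C : ℝ}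
    (h : ∀ φ, ∀ hφ : IsTest φ, |∫ x, f x * φ x| ≤ C * ‖hφ.hasWGrad.toPair‖) :
    ∃ F : PairSpace →L[ℝ] ℝ, ∀ φ, ∀ hφ : IsTest φ,
      F hφ.hasWGrad.toPair = ∫ x, f x * φ x := by
  have hint : ∀ x : testSpace, Integrable
      (fun y => f y * (wt y * (x : PairSpace).fst y)) volume := by
    rintro ⟨_, φ, hφ, rfl⟩
    refine (MemLp.integrable_mul hf hφ.memLp).congr ?_
    exact (mul_wt_mul_toPair_fst hφ.hasWGrad).symm
  let ℓ : testSpace →ₗ[ℝ] ℝ :=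
    { toFun := fun x => ∫ y, f y * (wt y * (x : PairSpace).fst y)
      map_add' := by
        intro x y
        rw [← integral_add (hint x) (hint y)]
        refine integral_congr_ae ?_
        filter_upwards [Lp.coeFn_add (x : PairSpace).fst (y : PairSpace).fst] with z hz
        rw [Submodule.coe_add, WithLp.add_fst, hz, Pi.add_apply]
        ring
      map_smul' := by
        intro c x
        rw [RingHom.id_apply, smul_eq_mul, ← integral_const_mul]
        refine integral_congr_ae ?_
        filter_upwards [Lp.coeFn_smul c (x : PairSpace).fst] with z hz
        rw [Submodule.coe_smul, WithLp.smul_fst, hz, Pi.smul_apply, smul_eq_mul]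
        ring }
  have hℓ : ∀ φ, ∀ hφ : IsTest φ, ℓ ⟨hφ.hasWGrad.toPair, φ, hφ, rfl⟩ = ∫ x, f x * φ x := by
    intro φ hφ
    exact integral_congr_ae (mul_wt_mul_toPair_fst hφ.hasWGrad)
  have hbd : ∀ x, ‖ℓ x‖ ≤ C * ‖x‖ := by
    rintro ⟨_, φ, hφ, rfl⟩
    rw [hℓ φ hφ, Submodule.coe_norm]
    exact h φ hφ
  obtain ⟨F, hF, -⟩ := exists_extension_norm_eq testSpace (ℓ.mkContinuous C hbd)
  refine ⟨F, fun φ hφ => ?_⟩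
  rw [← hℓ φ hφ]
  exact hF ⟨hφ.hasWGrad.toPair, φ, hφ, rfl⟩

/-- The functional extending `φ ↦ ∫ f φ` is still given by the integral on the compactly supported
elements of `H¹_w(ℝ³)`. -/
lemma functional_eq_integral {f : E → ℝ} (hf : MemLp f 2 volume) {F : PairSpace →L[ℝ] ℝ}
    (hF : ∀ φ, ∀ hφ : IsTest φ, F hφ.hasWGrad.toPair = ∫ x, f x * φ x) {v : E → ℝ} {g : E → E}
    (h : HasWGrad v g) (hc : HasCompactSupport v) : F h.toPair = ∫ x, f x * v x := by
  have hv : MemLp v 2 volume := by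
    have h1 := memLp_of_memLp_div_wt hc.isCompact.isBounded (h.memLp.restrict _)
    rw [← memLp_indicator_iff_restrict (isClosed_tsupport v).measurableSet] at h1
    rwa [indicator_eq_self.2 (subset_tsupport v)] at h1
  set K := ‖F‖ * 2 + (eLpNorm f 2 volume).toReal with hK
  have hK0 : 0 ≤ K := by positivity
  have key : ∀ δ > 0, |F h.toPair - ∫ x, f x * v x| ≤ K * δ := by
    intro δ hδ
    obtain ⟨φ, hφ, h1, h2⟩ := h.exists_test_of_hasCompactSupport hc
      (η := ENNReal.ofReal δ) (by simpa using hδ)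
    have h1' : eLpNorm (fun x => φ x / wt x - v x / wt x) 2 volume ≤ ENNReal.ofReal δ := by
      refine le_trans (eLpNorm_mono fun x => ?_) h1
      rw [← sub_div, norm_div]
      exact div_le_self (norm_nonneg _)
        (by rw [Real.norm_of_nonneg (wt_pos x).le]; exact one_le_wt x)
    have e1 : |F h.toPair - F hφ.hasWGrad.toPair| ≤ ‖F‖ * (2 * δ) := by
      rw [← map_sub, ← Real.norm_eq_abs]
      refine (F.le_opNorm _).trans (mul_le_mul_of_nonneg_left ?_ (norm_nonneg _))
      rw [← norm_neg, neg_sub]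
      refine (norm_mkPair_sub_le _ _ _ _ ENNReal.ofReal_ne_top h1' h2).trans (le_of_eq ?_)
      rw [ENNReal.toReal_ofReal hδ.le]
    have e2 : |(∫ x, f x * φ x) - ∫ x, f x * v x| ≤ (eLpNorm f 2 volume).toReal * δ := by
      have i1 : Integrable (fun x => f x * φ x) volume := MemLp.integrable_mul hf hφ.memLp
      have i2 : Integrable (fun x => f x * v x) volume := MemLp.integrable_mul hf hv
      rw [← integral_sub i1 i2]
      refine abs_integral_le_integral_abs.trans ?_
      have e3 : ∫ x, |f x * φ x - f x * v x| = ∫ x, ‖f x‖ * ‖φ x - v x‖ := by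
        refine integral_congr_ae (Eventually.of_forall fun x => ?_)
        simp only
        rw [← mul_sub, abs_mul, Real.norm_eq_abs, Real.norm_eq_abs]
      rw [e3]
      refine (integral_norm_mul_norm_le hf (hφ.memLp.sub hv)).trans
        (mul_le_mul_of_nonneg_left ?_ ENNReal.toReal_nonneg)
      have := ENNReal.toReal_mono ENNReal.ofReal_ne_top h1
      rwa [ENNReal.toReal_ofReal hδ.le] at this
    rw [hF φ hφ] at e1
    have := abs_sub_le (F h.toPair) (∫ x, f x * φ x) (∫ x, f x * v x)
    rw [hK]
    linarith
  by_contra hne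
  have hpos : 0 < |F h.toPair - ∫ x, f x * v x| := abs_pos.2 (sub_ne_zero.2 hne)
  have h1 := key (|F h.toPair - ∫ x, f x * v x| / (2 * (K + 1))) (by positivity)
  rw [mul_div_assoc', le_div_iff₀ (by positivity)] at h1
  nlinarith

/-! ### Functions on a partition with null interface -/

/-- What the analysis uses of a partition: `D` is open and bounded with a null boundary. -/
structure IsNiceDomain (D : Set E) : Prop where
  isOpen : IsOpen D
  isBounded : Bornology.IsBounded D
  null : volume (frontier D) = 0

lemma isOpen_ext (D : Set E) : IsOpen (ext D) := isClosed_closure.isOpen_compl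

lemma disjoint_ext (D : Set E) : Disjoint D (ext D) :=
  disjoint_compl_right.mono_left subset_closure

lemma IsNiceDomain.ae_mem {D : Set E} (hD : IsNiceDomain D) : ∀ᵐ x ∂volume, x ∈ D ∪ ext D := by
  have h : ∀ᵐ x ∂volume, x ∉ frontier D := measure_eq_zero_iff_ae_notMem.1 hD.null
  filter_upwards [h] with x hx
  by_cases h1 : x ∈ D
  · exact Or.inl h1
  · refine Or.inr fun h2 => hx ?_
    rw [hD.isOpen.frontier_eq]
    exact ⟨h2, h1⟩

lemma IsNiceDomain.restrict_eq {D : Set E} (hD : IsNiceDomain D) :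
    volume.restrict (D ∪ ext D) = volume := Measure.restrict_eq_self_of_ae_mem hD.ae_mem

lemma IsNiceDomain.ae_of_restrict {D : Set E} (hD : IsNiceDomain D) {p : E → Prop}
    (h1 : ∀ᵐ x ∂volume.restrict D, p x) (h2 : ∀ᵐ x ∂volume.restrict (ext D), p x) :
    ∀ᵐ x ∂volume, p x := by
  rw [← hD.restrict_eq]
  exact (ae_restrict_union_iff _ _ _).2 ⟨h1, h2⟩

lemma IsNiceDomain.memLp {D : Set E} (hD : IsNiceDomain D) {F : Type*} [NormedAddCommGroup F]
    {v : E → F} (h1 : MemLp v 2 (volume.restrict D)) (h2 : MemLp v 2 (volume.restrict (ext D))) :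
    MemLp v 2 volume := by
  rw [← memLp_indicator_iff_restrict hD.isOpen.measurableSet] at h1
  rw [← memLp_indicator_iff_restrict (isOpen_ext D).measurableSet] at h2
  refine (h1.add h2).ae_eq ?_
  filter_upwards [hD.ae_mem] with x hx
  have hdis := disjoint_ext D
  rcases hx with hx | hx
  · simp [hx, Set.disjoint_left.1 hdis hx]
  · simp [hx, Set.disjoint_right.1 hdis hx]

lemma IsWeakGrad.weakGrad {U : Set E} (hU : IsOpen U) {v : E → ℝ} {g : E → E}
    (h : IsWeakGrad U v g) :
    IsWeakGrad U v (weakGrad U v) ∧ Transmission.weakGrad U v =ᵐ[volume.restrict U] g := by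
  have hex : ∃ g, IsWeakGrad U v g := ⟨g, h⟩
  have h1 : IsWeakGrad U v (Transmission.weakGrad U v) := by
    unfold Transmission.weakGrad
    rw [dif_pos hex]
    exact hex.choose_spec
  exact ⟨h1, h1.ae_eq hU h (EventuallyEq.refl _ _)⟩

lemma pgrad_of_mem {D : Set E} (v : E → ℝ) : ∀ x ∈ D, pgrad D v x = weakGrad D v x := by
  intro x hx
  simp [pgrad, hx]

lemma pgrad_of_mem_ext {D : Set E} (v : E → ℝ) :
    ∀ x ∈ ext D, pgrad D v x = weakGrad (ext D) v x := by
  intro x hx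
  simp [pgrad, Set.disjoint_right.1 (disjoint_ext D) hx]

lemma HasWGrad.pgrad_ae_eq {D : Set E} (hD : IsNiceDomain D) {v : E → ℝ} {g : E → E}
    (h : HasWGrad v g) : pgrad D v =ᵐ[volume] g := by
  refine hD.ae_of_restrict ?_ ?_
  · filter_upwards [((h.isWeakGrad D).weakGrad hD.isOpen).2,
      ae_restrict_mem hD.isOpen.measurableSet] with x h1 h2
    rw [pgrad_of_mem v x h2, h1]
  · filter_upwards [((h.isWeakGrad (ext D)).weakGrad (isOpen_ext D)).2,
      ae_restrict_mem (isOpen_ext D).measurableSet] with x h1 h2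
    rw [pgrad_of_mem_ext v x h2, h1]

lemma divergence_smul_const {φ : E → ℝ} (hφ : Differentiable ℝ φ) (e x : E) :
    divergence (fun x => φ x • e) x = inner ℝ (gradient φ x) e := by
  have h : fderiv ℝ (fun x => φ x • e) x = (fderiv ℝ φ x).smulRight e :=
    ((hφ x).hasFDerivAt.smul_const e).fderiv
  rw [inner_gradient_left]
  simp only [divergence, h, ContinuousLinearMap.smulRight_apply, PiLp.smul_apply, smul_eq_mul]
  have he : e = ∑ i, e i • EuclideanSpace.single i (1 : ℝ) := by
    ext j
    simp [Finset.sum_apply, Pi.single_apply]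
  conv_rhs => rw [he, map_sum]
  refine Finset.sum_congr rfl fun i _ => ?_
  rw [map_smul, smul_eq_mul, mul_comm]

/-- With a null interface, the space `W` is `H¹_w(ℝ³)`: the vanishing of the jump says that the
piecewise gradient is the gradient on the whole space. -/
lemma MemW.hasWGrad {D : Set E} (hD : IsNiceDomain D) {v : E → ℝ} (h : MemW D v) :
    HasWGrad v (pgrad D v) := by
  obtain ⟨⟨h1, g, hg, hg2⟩, ⟨h3, g', hg', hg'2⟩, hJ⟩ := h
  have hvw : MemLp (fun x => v x / wt x) 2 volume := hD.memLp (memLp_div_wt h1) h3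
  have hp : MemLp (pgrad D v) 2 volume := by
    refine hD.memLp (hg2.ae_eq ?_) (hg'2.ae_eq ?_)
    · filter_upwards [(hg.weakGrad hD.isOpen).2, ae_restrict_mem hD.isOpen.measurableSet] with x a b
      rw [pgrad_of_mem v x b, a]
    · filter_upwards [(hg'.weakGrad (isOpen_ext D)).2,
        ae_restrict_mem (isOpen_ext D).measurableSet] with x a b
      rw [pgrad_of_mem_ext v x b, a]
  have hloc : LocallyIntegrable v volume := by
    have h1 : LocallyIntegrable (fun x => v x / wt x) volume :=
      hvw.locallyIntegrable (by norm_num)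
    have := h1.locallyIntegrableOn univ |>.mul_continuousOn (g := wt) continuous_wt.continuousOn
      isOpen_univ.isLocallyClosed
    rw [locallyIntegrableOn_univ] at this
    simpa [wt_ne] using this
  refine ⟨hvw, hp, fun φ hφ e => ?_⟩
  have h5 := hJ (fun x => φ x • e) (hφ.1.smul contDiff_const)
    (hφ.2.mono fun x hx hx' => hx (by simp [hx']))
  rw [hD.restrict_eq] at h5
  simp only [divergence_smul_const hφ.differentiable, real_inner_smul_right] at h5
  rw [integral_add (integrable_mul_inner' hφ.continuous hφ.2
    (hp.locallyIntegrable (by norm_num)) e) (integrable_mul_inner hloc hφ.continuous_gradient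
    (hasCompactSupport_gradient hφ.2) e)] at h5
  linarith

lemma isTest_apply {Φ : E → E} (h : ContDiff ℝ ∞ Φ) (hc : HasCompactSupport Φ) (i : Fin 3) :
    IsTest fun x => Φ x i :=
  ⟨(EuclideanSpace.proj i : E →L[ℝ] ℝ).contDiff.comp h,
    hc.mono fun x hx hx' => hx (by simp [hx'])⟩

/-- Conversely, an element of `H¹_w(ℝ³)` lies in `W`: the jump vanishes because the piecewise gradient
is the restriction of a weak gradient on the whole space. -/
lemma HasWGrad.memW {D : Set E} (hD : IsNiceDomain D) {v : E → ℝ} {g : E → E}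
    (h : HasWGrad v g) : MemW D v := by
  refine ⟨⟨memLp_of_memLp_div_wt hD.isBounded (h.memLp.restrict _), g, h.isWeakGrad D,
    h.memLp_grad.restrict _⟩, ⟨h.memLp.restrict _, g, h.isWeakGrad _, h.memLp_grad.restrict _⟩,
    fun Φ hΦ hc => ?_⟩
  rw [hD.restrict_eq]
  have hT := isTest_apply hΦ hc
  have e1 : ∀ᵐ x ∂volume, inner ℝ (pgrad D v x) (Φ x) + v x * divergence Φ x
      = ∑ i, (Φ x i * inner ℝ (g x) (EuclideanSpace.single i 1)
        + v x * inner ℝ (gradient (fun x => Φ x i) x) (EuclideanSpace.single i 1)) := by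
    filter_upwards [h.pgrad_ae_eq hD] with x hx
    rw [hx, Finset.sum_add_distrib, ← Finset.mul_sum, divergence]
    congr 1
    · simp [PiLp.inner_apply]
    · congr 1
      refine Finset.sum_congr rfl fun i _ => ?_
      rw [inner_gradient_left]
      have hd : HasFDerivAt (fun x => Φ x i)
          ((EuclideanSpace.proj i : E →L[ℝ] ℝ).comp (fderiv ℝ Φ x)) x :=
        (EuclideanSpace.proj i : E →L[ℝ] ℝ).hasFDerivAt.comp x
          (hΦ.differentiable (by simp) x).hasFDerivAt
      rw [hd.fderiv]
      rfl
  have i1 := fun i => integrable_mul_inner' (hT i).continuous (hT i).2 h.locallyIntegrable_grad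
    (EuclideanSpace.single i 1)
  have i2 := fun i => integrable_mul_inner h.locallyIntegrable (hT i).continuous_gradient
    (hasCompactSupport_gradient (hT i).2) (EuclideanSpace.single i 1)
  rw [integral_congr_ae e1, integral_finsetSum _ fun i _ => by exact (i1 i).add (i2 i)]
  refine Finset.sum_eq_zero fun i _ => ?_
  rw [integral_add (i1 i) (i2 i), h.weak _ (hT i), add_neg_cancel]

/-- The norm of `W` is controlled by the gradient. -/
lemma IsNiceDomain.exists_normW_le {D : Set E} (hD : IsNiceDomain D) :
    ∃ C, 0 ≤ C ∧ ∀ v g, HasWGrad v g → normW D v ≤ C * (eLpNorm g 2 volume).toReal := by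
  obtain ⟨R, hR⟩ := hD.isBounded.exists_norm_le
  refine ⟨√(2 + 4 * (2 + R ^ 2)), Real.sqrt_nonneg _, fun v g h => ?_⟩
  have ig : Integrable (fun x => ‖g x‖ ^ 2) volume :=
    h.memLp_grad.integrable_norm_pow two_ne_zero
  have iv : Integrable (fun x => ‖v x / wt x‖ ^ 2) volume :=
    h.memLp.integrable_norm_pow two_ne_zero
  have hsq : ∀ x, ‖v x / wt x‖ ^ 2 = v x ^ 2 / (1 + ‖x‖ ^ 2) := by
    intro x
    rw [norm_div, div_pow, Real.norm_of_nonneg (wt_pos x).le, wt_sq, Real.norm_eq_abs, sq_abs]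
  have n1 : normSqH1 D v ≤ ∫ x, (‖g x‖ ^ 2 + (1 + R ^ 2) * ‖v x / wt x‖ ^ 2) := by
    refine le_trans (integral_mono_of_nonneg (Eventually.of_forall fun x => by positivity)
      (ig.add (iv.const_mul (1 + R ^ 2))).restrict ?_)
      (setIntegral_le_integral (ig.add (iv.const_mul (1 + R ^ 2)))
        (Eventually.of_forall fun x => by
          simp only [Pi.add_apply, Pi.zero_apply]
          positivity))
    filter_upwards [((h.isWeakGrad D).weakGrad hD.isOpen).2,
      ae_restrict_mem hD.isOpen.measurableSet] with x a b
    simp only [Pi.add_apply]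
    rw [a, hsq]
    have h1 : ‖x‖ ^ 2 ≤ R ^ 2 := pow_le_pow_left₀ (norm_nonneg _) (hR x b) 2
    have h2 : v x ^ 2 ≤ (1 + R ^ 2) * (v x ^ 2 / (1 + ‖x‖ ^ 2)) := by
      rw [mul_div_assoc', le_div_iff₀ (by positivity)]
      nlinarith [sq_nonneg (v x)]
    linarith
  have n2 : normSqH1w (ext D) v ≤ ∫ x, (‖g x‖ ^ 2 + ‖v x / wt x‖ ^ 2) := by
    refine le_trans (integral_mono_of_nonneg (Eventually.of_forall fun x => by positivity)
      (ig.add iv).restrict ?_) (setIntegral_le_integral (ig.add iv)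
        (Eventually.of_forall fun x => by
          simp only [Pi.add_apply, Pi.zero_apply]
          positivity))
    filter_upwards [((h.isWeakGrad (ext D)).weakGrad (isOpen_ext D)).2] with x a
    simp only [Pi.add_apply]
    rw [a, hsq]
  rw [integral_add ig (iv.const_mul _), integral_const_mul, ← toReal_eLpNorm_sq h.memLp,
    ← toReal_eLpNorm_sq h.memLp_grad] at n1
  rw [integral_add ig iv, ← toReal_eLpNorm_sq h.memLp, ← toReal_eLpNorm_sq h.memLp_grad] at n2
  have hH := ENNReal.toReal_mono (ENNReal.mul_ne_top (by simp) h.memLp_grad.2.ne) h.hardy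
  rw [ENNReal.toReal_mul, ENNReal.toReal_ofNat] at hH
  have hH2 := pow_le_pow_left₀ ENNReal.toReal_nonneg hH 2
  have hN : (0 : ℝ) ≤ (eLpNorm g 2 volume).toReal := ENNReal.toReal_nonneg
  rw [normW, ← Real.sqrt_sq hN, ← Real.sqrt_mul (by positivity)]
  refine Real.sqrt_le_sqrt ?_
  nlinarith [sq_nonneg R]

/-! ### Bi-Lipschitz changes of variables -/

/-- The Lebesgue measure is a multiple of the three-dimensional Hausdorff measure, so a `K`-Lipschitz
map increases it by at most the factor `K ^ 3`. -/
lemma volume_image_le_of_lipschitz {S : E → E} {K : NNReal} (hS : LipschitzWith K S) (A : Set E) :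
    volume (S '' A) ≤ (K : ENNReal) ^ 3 * volume A := by
  have hd : ((Module.finrank ℝ E : ℕ) : ℝ) = 3 := by simp
  have hH : (μH[(3 : ℝ)] : Measure E).IsAddHaarMeasure := by
    have := isAddHaarMeasure_hausdorffMeasure (E := E)
    rwa [hd] at this
  have hv := Measure.isAddLeftInvariant_eq_smul (volume : Measure E) (μH[(3 : ℝ)] : Measure E)
  generalize Measure.addHaarScalarFactor (volume : Measure E) (μH[(3 : ℝ)] : Measure E) = c at hv
  have h := hS.hausdorffMeasure_image_le (d := 3) (by norm_num) A
  rw [hv, Measure.smul_apply, Measure.smul_apply]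
  simp only [ENNReal.smul_def, smul_eq_mul]
  calc (c : ENNReal) * μH[(3 : ℝ)] (S '' A) ≤ c * ((K : ENNReal) ^ (3 : ℝ) * μH[(3 : ℝ)] A) := by
        gcongr
    _ = (K : ENNReal) ^ 3 * (c * μH[(3 : ℝ)] A) := by
        rw [show (3 : ℝ) = ((3 : ℕ) : ℝ) by norm_num, ENNReal.rpow_natCast]
        ring

/-- A homeomorphism of the space that is Lipschitz together with its inverse. -/
structure IsBiLipschitz (T : E ≃ₜ E) (K : NNReal) : Prop where
  lip : LipschitzWith K T
  lip_symm : LipschitzWith K T.symm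

namespace IsBiLipschitz

variable {T : E ≃ₜ E} {K : NNReal}

lemma symm (hT : IsBiLipschitz T K) : IsBiLipschitz T.symm K :=
  ⟨hT.lip_symm, hT.lip⟩

lemma map_le (hT : IsBiLipschitz T K) :
    Measure.map T (volume : Measure E) ≤ ((K : ENNReal) ^ 3) • volume := by
  refine Measure.le_iff.2 fun A hA => ?_
  rw [Measure.map_apply T.continuous.measurable hA, Measure.smul_apply, smul_eq_mul,
    ← T.image_symm]
  exact volume_image_le_of_lipschitz hT.lip_symm A

lemma quasiMeasurePreserving (hT : IsBiLipschitz T K) :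
    Measure.QuasiMeasurePreserving T volume volume := by
  refine ⟨T.continuous.measurable, ?_⟩
  exact (Measure.absolutelyContinuous_of_le hT.map_le).trans Measure.smul_absolutelyContinuous

lemma eLpNorm_comp_le (hT : IsBiLipschitz T K) {F : Type*} [NormedAddCommGroup F] (h : E → F) :
    eLpNorm (fun x => h (T x)) 2 volume ≤ ((K : ENNReal) ^ 3) ^ (1 / 2 : ℝ) * eLpNorm h 2 volume := by
  have h1 : eLpNorm (fun x => h (T x)) 2 volume = eLpNorm h 2 (Measure.map T volume) :=
    (T.measurableEmbedding.eLpNorm_map_measure).symm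
  rw [h1]
  refine (eLpNorm_mono_measure h hT.map_le).trans (le_of_eq ?_)
  rw [eLpNorm_smul_measure_of_ne_top (by simp)]
  simp

lemma eLpNorm_le_of_norm_le (hT : IsBiLipschitz T K) {F G : Type*} [NormedAddCommGroup F]
    [NormedAddCommGroup G] {h : E → F} {k : E → G} {M : ℝ}
    (hM : ∀ᵐ x ∂volume, ‖k x‖ ≤ M * ‖h (T x)‖) :
    eLpNorm k 2 volume
      ≤ ENNReal.ofReal M * ((K : ENNReal) ^ 3) ^ (1 / 2 : ℝ) * eLpNorm h 2 volume := by
  refine (eLpNorm_le_mul_eLpNorm_of_ae_le_mul hM 2).trans ?_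
  rw [mul_assoc]
  gcongr
  exact hT.eLpNorm_comp_le h

lemma memLp_comp (hT : IsBiLipschitz T K) {F : Type*} [NormedAddCommGroup F] {h : E → F}
    (hh : MemLp h 2 volume) : MemLp (fun x => h (T x)) 2 volume := by
  refine ⟨hh.1.comp_quasiMeasurePreserving hT.quasiMeasurePreserving,
    (hT.eLpNorm_comp_le h).trans_lt ?_⟩
  refine ENNReal.mul_lt_top (ENNReal.rpow_lt_top_of_nonneg (by norm_num) (by simp)) hh.2

/-- The change of variables formula. -/
lemma integral_eq (hT : IsBiLipschitz T K) (h : E → ℝ) :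
    ∫ x, h x = ∫ x, |(fderiv ℝ T x).det| * h (T x) := by
  set s := {x | DifferentiableAt ℝ T x} with hs
  have hsm : MeasurableSet s := measurableSet_of_differentiableAt ℝ T
  have hae : ∀ᵐ x ∂volume, x ∈ s := hT.lip.ae_differentiableAt
  have hae' : ∀ᵐ x ∂volume, x ∈ T '' s := by
    filter_upwards [hT.symm.quasiMeasurePreserving.ae hae] with x hx
    exact ⟨T.symm x, hx, T.apply_symm_apply x⟩
  have key := integral_image_eq_integral_abs_det_fderiv_smul volume hsm
    (fun x hx => (DifferentiableAt.hasFDerivAt hx).hasFDerivWithinAt) T.injective.injOn h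
  rw [Measure.restrict_eq_self_of_ae_mem hae, Measure.restrict_eq_self_of_ae_mem hae'] at key
  exact key

end IsBiLipschitz

/-- The gradient of `v ∘ T`, in terms of the gradient `g` of `v`. -/
noncomputable def pullGrad (T : E → E) (g : E → E) (x : E) : E :=
  ContinuousLinearMap.adjoint (fderiv ℝ T x) (g (T x))

lemma norm_pullGrad_le {T : E → E} {K : NNReal} (hT : LipschitzWith K T) (g : E → E) (x : E) :
    ‖pullGrad T g x‖ ≤ K * ‖g (T x)‖ := by
  refine (ContinuousLinearMap.le_opNorm _ _).trans
    (mul_le_mul_of_nonneg_right ?_ (norm_nonneg _))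
  rw [LinearIsometryEquiv.norm_map]
  exact norm_fderiv_le_of_lipschitz ℝ hT

lemma pullGrad_sub (T : E → E) (g h : E → E) (x : E) :
    pullGrad T (fun y => g y - h y) x = pullGrad T g x - pullGrad T h x :=
  map_sub _ _ _

lemma gradient_comp {T : E → E} {φ : E → ℝ} {x : E} (hT : DifferentiableAt ℝ T x)
    (hφ : DifferentiableAt ℝ φ (T x)) :
    gradient (fun y => φ (T y)) x = pullGrad T (gradient φ) x := by
  refine ext_inner_right ℝ fun e => ?_
  rw [inner_gradient_left, pullGrad, ContinuousLinearMap.adjoint_inner_left, inner_gradient_left]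
  have h := hφ.hasFDerivAt.comp x hT.hasFDerivAt
  have h2 : fderiv ℝ (fun y => φ (T y)) x = _ := h.fderiv
  rw [h2]
  rfl

lemma exists_wt_comp_le {T : E → E} {K : NNReal} (hT : LipschitzWith K T) :
    ∃ M : ℝ, 0 ≤ M ∧ ∀ x, wt (T x) ≤ M * wt x := by
  refine ⟨1 + ‖T 0‖ + K, by positivity, fun x => ?_⟩
  have h1 := wt_le (T x)
  have h2 : ‖T x - T 0‖ ≤ K * ‖x - 0‖ := hT.norm_sub_le x 0
  rw [sub_zero] at h2
  have h3 : ‖T x‖ ≤ ‖T x - T 0‖ + ‖T 0‖ := by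
    simpa using norm_add_le (T x - T 0) (T 0)
  have h4 : ‖x‖ ≤ wt x := by
    refine abs_le_of_sq_le_sq' ?_ (wt_pos x).le |>.2
    rw [wt_sq]
    linarith
  have h5 := one_le_wt x
  have h6 := norm_nonneg (T 0)
  have h7 : (K : ℝ) * ‖x‖ ≤ K * wt x := mul_le_mul_of_nonneg_left h4 K.2
  nlinarith

lemma aestronglyMeasurable_pullGrad {T : E ≃ₜ E} {K : NNReal} (hT : IsBiLipschitz T K) {g : E → E}
    (hg : AEStronglyMeasurable g volume) : AEStronglyMeasurable (pullGrad T g) volume := by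
  have h1 : AEStronglyMeasurable (fun x => fderiv ℝ T x) (volume : Measure E) :=
    (measurable_fderiv ℝ T).aestronglyMeasurable
  have h2 : AEStronglyMeasurable (fun x => ContinuousLinearMap.adjoint (fderiv ℝ T x))
      (volume : Measure E) :=
    (ContinuousLinearMap.adjoint : (E →L[ℝ] E) ≃ₗᵢ⋆[ℝ] (E →L[ℝ] E)).continuous.comp_aestronglyMeasurable h1
  have h3 := hg.comp_quasiMeasurePreserving hT.quasiMeasurePreserving
  exact (isBoundedBilinearMap_apply (𝕜 := ℝ) (E := E) (F := E)).continuous.comp_aestronglyMeasurable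
    (h2.prodMk h3)

lemma norm_comp_div_wt_le {T : E → E} {M : ℝ} (hM : ∀ x, wt (T x) ≤ M * wt x) (v : E → ℝ) (x : E) :
    ‖v (T x) / wt x‖ ≤ M * ‖v (T x) / wt (T x)‖ := by
  rw [norm_div, norm_div, Real.norm_of_nonneg (wt_pos x).le, Real.norm_of_nonneg (wt_pos (T x)).le,
    div_le_iff₀ (wt_pos x), mul_div_assoc', div_mul_eq_mul_div, le_div_iff₀ (wt_pos (T x))]
  have := mul_le_mul_of_nonneg_left (hM x) (norm_nonneg (v (T x)))
  linarith

/-- The chain rule for weak gradients under bi-Lipschitz changes of variables. -/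
lemma HasWGrad.comp {T : E ≃ₜ E} {K : NNReal} (hT : IsBiLipschitz T K) {v : E → ℝ} {g : E → E}
    (h : HasWGrad v g) : HasWGrad (fun x => v (T x)) (pullGrad T g) := by
  obtain ⟨M, hM0, hM⟩ := exists_wt_comp_le hT.lip
  have hdiff : ∀ᵐ x ∂volume, DifferentiableAt ℝ T x := hT.lip.ae_differentiableAt
  have htest : ∀ φ, IsTest φ → HasWGrad (fun x => φ (T x)) (pullGrad T (gradient φ)) := by
    intro φ hφ
    obtain ⟨K', hK'⟩ := hφ.exists_lipschitz
    refine (hasWGrad_of_lipschitz (hK'.comp hT.lip) (hφ.2.comp_homeomorph T)).congr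
      (EventuallyEq.refl _ _) ?_
    filter_upwards [hdiff] with x hx
    exact gradient_comp hx (hφ.differentiable _)
  refine hasWGrad_of_approx ?_ ?_ fun η hη => ?_
  · refine (hT.memLp_comp h.memLp).of_le_mul (c := M)
      ((h.locallyIntegrable.aestronglyMeasurable.comp_quasiMeasurePreserving
        hT.quasiMeasurePreserving).div₀ continuous_wt.aestronglyMeasurable)
      (Eventually.of_forall fun x => norm_comp_div_wt_le hM v x)
  · exact (hT.memLp_comp h.memLp_grad).of_le_mul (c := K)
      (aestronglyMeasurable_pullGrad hT h.memLp_grad.1)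
      (Eventually.of_forall fun x => norm_pullGrad_le hT.lip g x)
  · set A : ENNReal := ENNReal.ofReal (M + K) * ((K : ENNReal) ^ 3) ^ (1 / 2 : ℝ) with hA
    have hAtop : A ≠ ⊤ := ENNReal.mul_ne_top ENNReal.ofReal_ne_top
      (ENNReal.rpow_ne_top_of_nonneg (by norm_num) (by simp))
    have hη' : 0 < η / (A + 1) := ENNReal.div_pos hη.ne' (by simp [hAtop])
    have hle : A * (η / (A + 1)) ≤ η := by
      calc A * (η / (A + 1)) ≤ (A + 1) * (η / (A + 1)) := by
            gcongr
            exact le_self_add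
        _ = η := ENNReal.mul_div_cancel (by simp) (by simp [hAtop])
    obtain ⟨φ, hφ, h1, h2⟩ := h.exists_test hη'
    refine ⟨_, _, htest φ hφ, ?_, ?_⟩
    · refine (hT.eLpNorm_le_of_norm_le (h := fun x => φ x / wt x - v x / wt x) (M := M + K)
        (Eventually.of_forall fun x => ?_)).trans ((by gcongr : _ ≤ _).trans hle)
      have := norm_comp_div_wt_le hM (fun x => φ x - v x) x
      simp only [sub_div] at this
      refine this.trans (mul_le_mul_of_nonneg_right ?_ (norm_nonneg _))
      linarith [K.2]
    · refine (hT.eLpNorm_le_of_norm_le (h := fun x => gradient φ x - g x) (M := M + K)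
        (Eventually.of_forall fun x => ?_)).trans ((by gcongr : _ ≤ _).trans hle)
      rw [← pullGrad_sub]
      refine (norm_pullGrad_le hT.lip _ x).trans (mul_le_mul_of_nonneg_right ?_ (norm_nonneg _))
      linarith

/-! ### The perturbation of the identity -/

lemma lipschitzWith_perturbMap {V : E → E} {L : NNReal} (hV : LipschitzWith L V) {ε : ℝ}
    (h0 : 0 ≤ ε) (h1 : ε * L ≤ 1 / 2) : LipschitzWith 2 (perturbMap V ε) := by
  refine LipschitzWith.of_dist_le_mul fun x y => ?_
  rw [dist_eq_norm, dist_eq_norm]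
  have e : perturbMap V ε x - perturbMap V ε y = (x - y) + ε • (V x - V y) := by
    simp only [perturbMap, smul_sub]
    abel
  rw [e]
  refine (norm_add_le _ _).trans ?_
  rw [norm_smul, Real.norm_of_nonneg h0]
  have := mul_le_mul_of_nonneg_left (hV.norm_sub_le x y) h0
  have h2 := mul_le_mul_of_nonneg_right h1 (norm_nonneg (x - y))
  push_cast
  nlinarith [norm_nonneg (x - y)]

lemma antilipschitzWith_perturbMap {V : E → E} {L : NNReal} (hV : LipschitzWith L V) {ε : ℝ}
    (h0 : 0 ≤ ε) (h1 : ε * L ≤ 1 / 2) : AntilipschitzWith 2 (perturbMap V ε) := by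
  refine AntilipschitzWith.of_le_mul_dist fun x y => ?_
  rw [dist_eq_norm, dist_eq_norm]
  have e : x - y = (perturbMap V ε x - perturbMap V ε y) - ε • (V x - V y) := by
    simp only [perturbMap, smul_sub]
    abel
  have h3 : ‖x - y‖ ≤ ‖perturbMap V ε x - perturbMap V ε y‖ + ‖ε • (V x - V y)‖ := by
    conv_lhs => rw [e]
    exact norm_sub_le _ _
  rw [norm_smul, Real.norm_of_nonneg h0] at h3
  have := mul_le_mul_of_nonneg_left (hV.norm_sub_le x y) h0
  have h2 := mul_le_mul_of_nonneg_right h1 (norm_nonneg (x - y))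
  push_cast
  nlinarith [norm_nonneg (x - y)]

/-- For small `ε`, the map `T^ε` is a bi-Lipschitz homeomorphism. -/
lemma exists_homeomorph_perturbMap {V : E → E} {L : NNReal} (hV : LipschitzWith L V) {ε : ℝ}
    (h0 : 0 ≤ ε) (h1 : ε * L ≤ 1 / 2) :
    ∃ T : E ≃ₜ E, (T : E → E) = perturbMap V ε ∧ IsBiLipschitz T 2 := by
  have happ : ApproximatesLinearOn (perturbMap V ε) (ContinuousLinearEquiv.refl ℝ E : E →L[ℝ] E)
      univ (1 / 2 : NNReal) := by
    refine ApproximatesLinearOn.approximatesLinearOn_iff_lipschitzOnWith.2 (LipschitzWith.lipschitzOnWith ?_)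
    refine LipschitzWith.of_dist_le_mul fun x y => ?_
    rw [dist_eq_norm, dist_eq_norm]
    have e : (perturbMap V ε - ⇑(ContinuousLinearEquiv.refl ℝ E : E →L[ℝ] E)) x
        - (perturbMap V ε - ⇑(ContinuousLinearEquiv.refl ℝ E : E →L[ℝ] E)) y
        = ε • (V x - V y) := by
      simp [perturbMap, smul_sub]
    rw [e, norm_smul, Real.norm_of_nonneg h0]
    have := mul_le_mul_of_nonneg_left (hV.norm_sub_le x y) h0
    have h2 := mul_le_mul_of_nonneg_right h1 (norm_nonneg (x - y))
    push_cast
    linarith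
  have hc : Subsingleton E ∨ (1 / 2 : NNReal) <
      ‖((ContinuousLinearEquiv.refl ℝ E).symm : E →L[ℝ] E)‖₊⁻¹ := by
    refine Or.inr ?_
    have : ‖((ContinuousLinearEquiv.refl ℝ E).symm : E →L[ℝ] E)‖₊ = 1 := by
      rw [← NNReal.coe_inj, coe_nnnorm]
      exact ContinuousLinearMap.norm_id
    rw [this, inv_one]
    exact NNReal.half_lt_self one_ne_zero
  refine ⟨happ.toHomeomorph _ hc, rfl, ?_, ?_⟩
  · exact lipschitzWith_perturbMap hV h0 h1
  · exact (antilipschitzWith_perturbMap hV h0 h1).to_rightInverse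
      (happ.toHomeomorph _ hc).apply_symm_apply

/-! ### Difference quotients along the perturbation -/

lemma perturbMap_of_notMem {V : E → E} {ε : ℝ} {x : E} (hx : x ∉ tsupport V) :
    perturbMap V ε x = x := by
  simp [perturbMap, image_eq_zero_of_notMem_tsupport hx]

lemma continuous_perturbMap_uncurry {V : E → E} (hV : Continuous V) :
    Continuous fun p : ℝ × E => perturbMap V p.1 p.2 := by
  unfold perturbMap
  fun_prop

/-- The `L²` norm of the increment of a test function along the perturbation: the increment at `x` is
the integral of the derivative along `s ↦ T^{sε} x`, and each of the maps `T^{sε}` distorts the `L²`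
norm by a bounded factor. -/
lemma IsTest.eLpNorm_perturb_sub_le {V : E → E} {L : NNReal} (hV : LipschitzWith L V) {B : ℝ}
    (hB : ∀ x, ‖V x‖ ≤ B) {ε : ℝ} (h0 : 0 ≤ ε) (h1 : ε * L ≤ 1 / 2) {φ : E → ℝ} (hφ : IsTest φ) :
    eLpNorm (fun x => φ (perturbMap V ε x) - φ x) 2 volume ≤
      ENNReal.ofReal ε * (ENNReal.ofReal B * ((2 : ENNReal) ^ 3) ^ (1 / 2 : ℝ) *
        eLpNorm (gradient φ) 2 volume) := by
  have hB0 : 0 ≤ B := (norm_nonneg _).trans (hB 0)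
  let ν : Measure ℝ := volume.restrict (Ioc 0 1)
  have hν : IsProbabilityMeasure ν := ⟨by simp [ν]⟩
  have hcont : Continuous fun p : ℝ × E => gradient φ (perturbMap V (p.1 * ε) p.2) := by
    refine hφ.continuous_gradient.comp ?_
    exact (continuous_perturbMap_uncurry hV.continuous).comp
      (f := fun p : ℝ × E => (p.1 * ε, p.2)) (by fun_prop)
  have hpt : ∀ x, ‖φ (perturbMap V ε x) - φ x‖ₑ ≤
      ENNReal.ofReal (ε * B) * ∫⁻ s, ‖gradient φ (perturbMap V (s * ε) x)‖ₑ ∂ν := by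
    intro x
    have hd : ∀ s : ℝ, HasDerivAt (fun s => φ (perturbMap V (s * ε) x))
        (inner ℝ (gradient φ (perturbMap V (s * ε) x)) (ε • V x)) s := by
      intro s
      have e1 : HasDerivAt (fun s : ℝ => perturbMap V (s * ε) x) (ε • V x) s := by
        unfold perturbMap
        have := (((hasDerivAt_id s).mul_const ε).smul_const (V x)).const_add x
        simpa using this
      have e2 := (hφ.differentiable (perturbMap V (s * ε) x)).hasFDerivAt.comp_hasDerivAt s e1
      rw [inner_gradient_left]
      exact e2
    have hc : Continuous fun s : ℝ =>
        (inner ℝ (gradient φ (perturbMap V (s * ε) x)) (ε • V x) : ℝ) := by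
      have : Continuous fun s : ℝ => gradient φ (perturbMap V (s * ε) x) :=
        hcont.comp (f := fun s : ℝ => (s, x)) (by fun_prop)
      fun_prop
    have hftc := intervalIntegral.integral_eq_sub_of_hasDerivAt (a := 0) (b := 1)
      (fun s _ => hd s) (hc.intervalIntegrable _ _)
    have e3 : φ (perturbMap V (0 * ε) x) = φ x := by simp [perturbMap]
    rw [one_mul, e3, intervalIntegral.integral_of_le zero_le_one] at hftc
    rw [← hftc]
    refine (enorm_integral_le_lintegral_enorm _).trans ?_
    rw [← lintegral_const_mul']
    · refine lintegral_mono fun s => ?_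
      rw [← ofReal_norm, ← ofReal_norm (gradient φ _), ← ENNReal.ofReal_mul (by positivity)]
      refine ENNReal.ofReal_le_ofReal ((norm_inner_le_norm _ _).trans ?_)
      rw [norm_smul, Real.norm_of_nonneg h0, mul_comm]
      gcongr
      exact hB x
    · exact ENNReal.ofReal_ne_top
  rw [← ENNReal.pow_le_pow_left_iff (n := 2) two_ne_zero, eLpNorm_two_sq]
  calc ∫⁻ x, ‖φ (perturbMap V ε x) - φ x‖ₑ ^ 2
      ≤ ∫⁻ x, (ENNReal.ofReal (ε * B) * ∫⁻ s, ‖gradient φ (perturbMap V (s * ε) x)‖ₑ ∂ν) ^ 2 :=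
        lintegral_mono fun x => pow_le_pow_left' (hpt x) 2
    _ = ENNReal.ofReal (ε * B) ^ 2 *
          ∫⁻ x, (∫⁻ s, ‖gradient φ (perturbMap V (s * ε) x)‖ₑ ∂ν) ^ 2 := by
        simp only [mul_pow]
        rw [lintegral_const_mul' _ _ (by simp)]
    _ ≤ ENNReal.ofReal (ε * B) ^ 2 *
          (((2 : ENNReal) ^ 3) ^ (1 / 2 : ℝ) * eLpNorm (gradient φ) 2 volume) ^ 2 := by
        gcongr
        refine lintegral_average_sq_le (f := fun s x => ‖gradient φ (perturbMap V (s * ε) x)‖ₑ)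
          hcont.enorm.measurable ?_
        filter_upwards [ae_restrict_mem measurableSet_Ioc] with s hs
        rw [← eLpNorm_two_sq]
        have hsε : s * ε * L ≤ 1 / 2 := by
          have : 0 ≤ ε * L := mul_nonneg h0 L.2
          nlinarith [hs.1, hs.2]
        obtain ⟨T, hT, hbi⟩ := exists_homeomorph_perturbMap hV (mul_nonneg hs.1.le h0) hsε
        have := hbi.eLpNorm_comp_le (gradient φ)
        rw [hT] at this
        exact pow_le_pow_left' this 2
    _ = _ := by
        rw [ENNReal.ofReal_mul h0]
        ring

/-- The `L²` norm of the increment of a function along the perturbation is controlled by that of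
its weak gradient. -/
lemma HasWGrad.eLpNorm_perturb_sub_le {V : E → E} {L : NNReal} (hV : LipschitzWith L V)
    (hVc : HasCompactSupport V) {B : ℝ} (hB : ∀ x, ‖V x‖ ≤ B) {ε : ℝ} (h0 : 0 ≤ ε)
    (h1 : ε * L ≤ 1 / 2) {f : E → ℝ} {g : E → E} (h : HasWGrad f g) :
    eLpNorm (fun x => f (perturbMap V ε x) - f x) 2 volume ≤
      ENNReal.ofReal ε * (ENNReal.ofReal B * ((2 : ENNReal) ^ 3) ^ (1 / 2 : ℝ) *
        eLpNorm g 2 volume) := by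
  obtain ⟨T, hT, hbi⟩ := exists_homeomorph_perturbMap hV h0 h1
  obtain ⟨M, hM0, hM⟩ := exists_wt_comp_le hbi.lip
  obtain ⟨R, hR⟩ := hVc.isCompact.exists_bound_of_continuousOn continuous_wt.continuousOn
  set D : ENNReal := ((2 : ENNReal) ^ 3) ^ (1 / 2 : ℝ) with hD
  have hDtop : D ≠ ⊤ := ENNReal.rpow_ne_top_of_nonneg (by norm_num) (by simp)
  set A : ENNReal := ENNReal.ofReal B * D with hA
  have hAtop : A ≠ ⊤ := ENNReal.mul_ne_top ENNReal.ofReal_ne_top hDtop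
  set P : ENNReal := ENNReal.ofReal R * (ENNReal.ofReal M * D + 1) with hP
  have hPtop : P ≠ ⊤ := ENNReal.mul_ne_top ENNReal.ofReal_ne_top
    (ENNReal.add_ne_top.2 ⟨ENNReal.mul_ne_top ENNReal.ofReal_ne_top hDtop, by simp⟩)
  -- a crude bound, used only for the error of the approximation by test functions
  have crude : ∀ v k, HasWGrad v k → eLpNorm (fun x => v (perturbMap V ε x) - v x) 2 volume
      ≤ P * eLpNorm (fun x => v x / wt x) 2 volume := by
    intro v k hv
    have hvT := (hv.comp hbi).memLp
    have s1 : eLpNorm (fun x => v (perturbMap V ε x) - v x) 2 volume ≤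
        ENNReal.ofReal R * eLpNorm (fun x => v (T x) / wt x - v x / wt x) 2 volume := by
      refine eLpNorm_le_mul_eLpNorm_of_ae_le_mul (Eventually.of_forall fun x => ?_) 2
      rw [hT]
      by_cases hx : x ∈ tsupport V
      · rw [← sub_div, norm_div, mul_div_assoc', le_div_iff₀ (norm_pos_iff.2 (wt_ne x)), mul_comm]
        exact mul_le_mul_of_nonneg_right (hR x hx) (norm_nonneg _)
      · rw [perturbMap_of_notMem hx]
        simp
    have s2 : eLpNorm (fun x => v (T x) / wt x - v x / wt x) 2 volume ≤
        (ENNReal.ofReal M * D + 1) * eLpNorm (fun x => v x / wt x) 2 volume := by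
      refine (eLpNorm_sub_le hvT.1 hv.memLp.1 (by norm_num)).trans ?_
      rw [add_mul, one_mul]
      gcongr
      exact hbi.eLpNorm_le_of_norm_le (h := fun x => v x / wt x)
        (Eventually.of_forall fun x => norm_comp_div_wt_le hM v x)
    rw [hP, mul_assoc]
    exact s1.trans (by gcongr)
  have hmeas : ∀ v k, HasWGrad v k →
      AEStronglyMeasurable (fun x => v (perturbMap V ε x) - v x) volume := by
    intro v k hv
    have := (hv.comp hbi).locallyIntegrable.aestronglyMeasurable
    rw [hT] at this
    exact this.sub hv.locallyIntegrable.aestronglyMeasurable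
  have hεtop : ENNReal.ofReal ε ≠ ⊤ := ENNReal.ofReal_ne_top
  set Q : ENNReal := ENNReal.ofReal ε * A + P + 1 with hQ
  have hQtop : Q ≠ ⊤ := by simp [hQ, ENNReal.mul_ne_top hεtop hAtop, hPtop]
  have hQ0 : Q ≠ 0 := by simp [hQ]
  refine ENNReal.le_of_forall_pos_le_add fun η hη _ => ?_
  have hη' : (0 : ENNReal) < η / Q := ENNReal.div_pos (by exact_mod_cast hη.ne') hQtop
  obtain ⟨φ, hφ, a1, a2⟩ := h.exists_test hη'
  have hsub := hφ.hasWGrad.sub h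
  have e : (fun x => f (perturbMap V ε x) - f x) = (fun x => φ (perturbMap V ε x) - φ x) -
      fun x => (φ (perturbMap V ε x) - f (perturbMap V ε x)) - (φ x - f x) := by
    ext x
    simp only [Pi.sub_apply]
    ring
  have e2 : gradient φ = g + fun x => gradient φ x - g x := by
    ext1 x
    simp
  have b2 : eLpNorm (gradient φ) 2 volume ≤ eLpNorm g 2 volume + η / Q := by
    rw [e2]
    exact (eLpNorm_add_le h.memLp_grad.1 (hφ.memLp_gradient.1.sub h.memLp_grad.1)
      (by norm_num)).trans (add_le_add_right a2 _)
  have b3 := crude _ _ hsub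
  simp only [sub_div] at b3
  calc eLpNorm (fun x => f (perturbMap V ε x) - f x) 2 volume
      ≤ ENNReal.ofReal ε * (A * (eLpNorm g 2 volume + η / Q)) + P * (η / Q) := by
        rw [e]
        refine (eLpNorm_sub_le (hmeas _ _ hφ.hasWGrad) (hmeas _ _ hsub) (by norm_num)).trans
          (add_le_add ?_ (b3.trans (by gcongr)))
        exact (hφ.eLpNorm_perturb_sub_le hV hB h0 h1).trans (by gcongr)
    _ = ENNReal.ofReal ε * (A * eLpNorm g 2 volume) + (ENNReal.ofReal ε * A + P) * (η / Q) := by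
        ring
    _ ≤ ENNReal.ofReal ε * (A * eLpNorm g 2 volume) + Q * (η / Q) := by
        gcongr
        exact le_self_add
    _ = _ := by rw [ENNReal.mul_div_cancel hQ0 hQtop]

lemma eventually_mul_le {L : NNReal} : ∀ᶠ ε : ℝ in 𝓝[>] (0 : ℝ), 0 < ε ∧ ε * (L : ℝ) ≤ 1 / 2 := by
  have h : Tendsto (fun ε : ℝ => ε * L) (𝓝[>] 0) (𝓝 (0 * L)) :=
    (tendsto_id.mul_const _).mono_left nhdsWithin_le_nhds
  rw [zero_mul] at h
  filter_upwards [self_mem_nhdsWithin, h.eventually (ge_mem_nhds (show (0 : ℝ) < 1 / 2 by norm_num))]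
    with ε h1 h2 using ⟨h1, h2⟩

/-- Pointwise convergence is the chain rule; the difference quotients are dominated by a multiple of
the compactly supported `|V|`. -/
lemma IsTest.tendsto_difference_quotient {V : E → E} {L : NNReal} (hV : LipschitzWith L V)
    (hVc : HasCompactSupport V) {φ : E → ℝ} (hφ : IsTest φ) :
    Tendsto (fun ε : ℝ => eLpNorm (fun x => ε⁻¹ * (φ (perturbMap V ε x) - φ x)
      - inner ℝ (gradient φ x) (V x)) 2 volume) (𝓝[>] 0) (𝓝 0) := by
  obtain ⟨K, hK⟩ := hφ.exists_lipschitz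
  have hVL : MemLp V 2 volume := hV.continuous.memLp_of_hasCompactSupport hVc
  refine tendsto_eLpNorm_two_zero (b := fun x => (2 * K) * ‖V x‖) ?_ (hVL.norm.const_mul _) ?_ ?_
  · refine Eventually.of_forall fun ε => Continuous.aestronglyMeasurable ?_
    have h1 := hφ.continuous
    have h2 := hφ.continuous_gradient
    have h3 := hV.continuous
    unfold perturbMap
    fun_prop
  · filter_upwards [self_mem_nhdsWithin] with ε hε
    have hε' : 0 < ε := hε
    refine Eventually.of_forall fun x => (norm_sub_le _ _).trans ?_
    have h1 : ‖φ (perturbMap V ε x) - φ x‖ ≤ K * (ε * ‖V x‖) := by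
      refine (hK.norm_sub_le _ _).trans (le_of_eq ?_)
      simp [perturbMap, norm_smul, abs_of_pos hε']
    have h2 : ‖ε⁻¹ * (φ (perturbMap V ε x) - φ x)‖ ≤ K * ‖V x‖ := by
      rw [norm_mul, norm_inv, Real.norm_of_nonneg hε'.le, inv_mul_le_iff₀ hε']
      refine h1.trans (le_of_eq ?_)
      ring
    have h3 : ‖(inner ℝ (gradient φ x) (V x) : ℝ)‖ ≤ K * ‖V x‖ :=
      (norm_inner_le_norm _ _).trans
        (mul_le_mul_of_nonneg_right (norm_gradient_le hK x) (norm_nonneg _))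
    linarith
  · refine Eventually.of_forall fun x => ?_
    have hd : HasDerivAt (fun ε : ℝ => φ (perturbMap V ε x)) (inner ℝ (gradient φ x) (V x)) 0 := by
      have e1 : HasDerivAt (fun s : ℝ => perturbMap V s x) (V x) 0 := by
        unfold perturbMap
        have := ((hasDerivAt_id (0 : ℝ)).smul_const (V x)).const_add x
        simpa using this
      have e0 : perturbMap V 0 x = x := by simp [perturbMap]
      have e2 := (hφ.differentiable (perturbMap V 0 x)).hasFDerivAt.comp_hasDerivAt 0 e1
      rw [e0] at e2
      rw [inner_gradient_left]
      exact e2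
    have h1 := (hd.tendsto_slope_zero).mono_left
      (nhdsWithin_mono 0 (show Ioi (0 : ℝ) ⊆ {0}ᶜ from fun y hy => ne_of_gt hy))
    have h2 := h1.sub_const (inner ℝ (gradient φ x) (V x))
    rw [sub_self] at h2
    refine h2.congr fun ε => ?_
    simp [perturbMap]

/-- The difference quotients of `f ∈ H¹_w(ℝ³)` along the perturbation converge in `L²`: this holds for
test functions, and the quotients are bounded in `L²` by the gradient, uniformly in `ε`. -/
lemma HasWGrad.tendsto_difference_quotient {V : E → E} {L : NNReal} (hV : LipschitzWith L V)
    (hVc : HasCompactSupport V) {f : E → ℝ} {g : E → E} (h : HasWGrad f g) :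
    Tendsto (fun ε : ℝ => eLpNorm (fun x => ε⁻¹ * (f (perturbMap V ε x) - f x)
      - inner ℝ (g x) (V x)) 2 volume) (𝓝[>] 0) (𝓝 0) := by
  obtain ⟨B, hB⟩ := hV.continuous.bounded_above_of_compact_support hVc
  set A : ENNReal := ENNReal.ofReal B * ((2 : ENNReal) ^ 3) ^ (1 / 2 : ℝ) with hA
  have hAtop : A ≠ ⊤ := ENNReal.mul_ne_top ENNReal.ofReal_ne_top
    (ENNReal.rpow_ne_top_of_nonneg (by norm_num) (by simp))
  set Q : ENNReal := A + ENNReal.ofReal B + 1 with hQ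
  have hQtop : Q ≠ ⊤ := by simp [hQ, hAtop]
  have hQ0 : Q ≠ 0 := by simp [hQ]
  refine ENNReal.tendsto_nhds_zero.2 fun η hη => ?_
  have hη2 : 0 < η / 2 := ENNReal.half_pos hη.ne'
  obtain ⟨φ, hφ, a1, a2⟩ := h.exists_test (ENNReal.div_pos hη2.ne' hQtop)
  have hsub := h.sub hφ.hasWGrad
  have a2' : eLpNorm (fun x => g x - gradient φ x) 2 volume ≤ η / 2 / Q := by
    refine le_trans (le_of_eq ?_) a2
    rw [← eLpNorm_neg]
    congr 1
    ext1 x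
    simp
  have hT := (hφ.tendsto_difference_quotient hV hVc).eventually (ge_mem_nhds hη2)
  filter_upwards [hT, eventually_mul_le (L := L)] with ε hε hε2
  obtain ⟨hε0, hεL⟩ := hε2
  obtain ⟨T, hTV, hbi⟩ := exists_homeomorph_perturbMap hV hε0.le hεL
  have hmeas : ∀ v k, HasWGrad v k →
      AEStronglyMeasurable (fun x => ε⁻¹ * (v (perturbMap V ε x) - v x)) volume := by
    intro v k hv
    have := (hv.comp hbi).locallyIntegrable.aestronglyMeasurable
    rw [hTV] at this
    exact (this.sub hv.locallyIntegrable.aestronglyMeasurable).const_mul _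
  have hmeas2 : ∀ k : E → E, MemLp k 2 volume →
      AEStronglyMeasurable (fun x => (inner ℝ (k x) (V x) : ℝ)) volume := fun k hk =>
    hk.1.inner hV.continuous.aestronglyMeasurable
  have e : (fun x => ε⁻¹ * (f (perturbMap V ε x) - f x) - inner ℝ (g x) (V x))
      = ((fun x => ε⁻¹ * ((f (perturbMap V ε x) - φ (perturbMap V ε x)) - (f x - φ x)))
        - fun x => inner ℝ (g x - gradient φ x) (V x))
        + fun x => ε⁻¹ * (φ (perturbMap V ε x) - φ x) - inner ℝ (gradient φ x) (V x) := by
    ext x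
    simp only [Pi.add_apply, Pi.sub_apply, inner_sub_left]
    ring
  have b1 : eLpNorm (fun x => ε⁻¹ * ((f (perturbMap V ε x) - φ (perturbMap V ε x)) - (f x - φ x)))
      2 volume ≤ A * (η / 2 / Q) := by
    have := hsub.eLpNorm_perturb_sub_le hV hVc hB hε0.le hεL
    calc _ = ENNReal.ofReal ε⁻¹ * eLpNorm (fun x => (f (perturbMap V ε x) - φ (perturbMap V ε x))
          - (f x - φ x)) 2 volume := by
          rw [← Real.enorm_of_nonneg (inv_nonneg.2 hε0.le), ← eLpNorm_const_smul]
          rfl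
      _ ≤ ENNReal.ofReal ε⁻¹ * (ENNReal.ofReal ε * (A * (η / 2 / Q))) := by
          gcongr
          exact this.trans (by gcongr)
      _ = A * (η / 2 / Q) := by
          rw [← mul_assoc, ← ENNReal.ofReal_mul (inv_nonneg.2 hε0.le), inv_mul_cancel₀ hε0.ne',
            ENNReal.ofReal_one, one_mul]
  have b2 : eLpNorm (fun x => (inner ℝ (g x - gradient φ x) (V x) : ℝ)) 2 volume
      ≤ ENNReal.ofReal B * (η / 2 / Q) := by
    refine (eLpNorm_le_mul_eLpNorm_of_ae_le_mul (g := fun x => g x - gradient φ x) (c := B)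
      (Eventually.of_forall fun x => ?_) 2).trans (by gcongr)
    refine (norm_inner_le_norm _ _).trans ?_
    rw [mul_comm]
    exact mul_le_mul_of_nonneg_right (hB x) (norm_nonneg _)
  rw [e]
  calc _ ≤ (A * (η / 2 / Q) + ENNReal.ofReal B * (η / 2 / Q)) + η / 2 := by
        refine (eLpNorm_add_le ((hmeas _ _ hsub).sub (hmeas2 _ hsub.memLp_grad))
          ((hmeas _ _ hφ.hasWGrad).sub (hmeas2 _ hφ.memLp_gradient)) (by norm_num)).trans
          (add_le_add ?_ hε)
        exact (eLpNorm_sub_le (hmeas _ _ hsub) (hmeas2 _ hsub.memLp_grad) (by norm_num)).trans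
          (add_le_add b1 b2)
    _ ≤ Q * (η / 2 / Q) + η / 2 := by
        gcongr
        rw [← add_mul]
        gcongr
        exact le_self_add
    _ = η := by rw [ENNReal.mul_div_cancel hQ0 hQtop, ENNReal.add_halves]

/-! ### The divergence of `f V` -/

lemma norm_fderiv_apply_apply_le {V : E → E} {L : NNReal} (hV : LipschitzWith L V) (x : E)
    (i j : Fin 3) : |(fderiv ℝ V x (EuclideanSpace.single j 1)) i| ≤ L := by
  have h1 := PiLp.norm_apply_le (fderiv ℝ V x (EuclideanSpace.single j (1 : ℝ))) i
  have h2 := (fderiv ℝ V x).le_opNorm (EuclideanSpace.single j (1 : ℝ))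
  rw [PiLp.norm_single, norm_one, mul_one] at h2
  exact (h1.trans h2).trans (norm_fderiv_le_of_lipschitz ℝ hV)

lemma measurable_fderiv_apply_apply (V : E → E) (i j : Fin 3) :
    Measurable fun x => (fderiv ℝ V x (EuclideanSpace.single j (1 : ℝ))) i :=
  (EuclideanSpace.proj i : E →L[ℝ] ℝ).continuous.measurable.comp
    (measurable_fderiv_apply_const ℝ V (EuclideanSpace.single j (1 : ℝ)))

lemma measurable_divergence (V : E → E) : Measurable (divergence V) :=
  Finset.measurable_sum _ fun i _ => measurable_fderiv_apply_apply V i i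

lemma abs_divergence_le {V : E → E} {L : NNReal} (hV : LipschitzWith L V) (x : E) :
    |divergence V x| ≤ 3 * L := by
  refine (Finset.abs_sum_le_sum_abs _ _).trans ?_
  refine (Finset.sum_le_sum fun i _ => norm_fderiv_apply_apply_le hV x i i).trans (le_of_eq ?_)
  simp

lemma fderiv_of_notMem_tsupport {V : E → E} {x : E} (hx : x ∉ tsupport V) : fderiv ℝ V x = 0 :=
  image_eq_zero_of_notMem_tsupport fun h => hx (tsupport_fderiv_subset ℝ h)

lemma divergence_of_notMem {V : E → E} {x : E} (hx : x ∉ tsupport V) : divergence V x = 0 := by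
  simp [divergence, fderiv_of_notMem_tsupport hx]

/-- Integration by parts against a Lipschitz field, whose classical derivative exists almost
everywhere and is its weak derivative. -/
lemma integral_inner_gradient_eq {V : E → E} {L : NNReal} (hV : LipschitzWith L V) {ψ : E → ℝ}
    (hψ : IsTest ψ) : ∫ x, inner ℝ (V x) (gradient ψ x) = - ∫ x, ψ x * divergence V x := by
  have hVi : ∀ i : Fin 3, LipschitzWith L fun x => V x i := by
    intro i
    have h1 : LipschitzWith 1 fun x : E => x i := by
      refine LipschitzWith.of_dist_le_mul fun x y => ?_
      rw [NNReal.coe_one, one_mul, dist_eq_norm, dist_eq_norm]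
      exact PiLp.norm_apply_le (x - y) i
    rw [← one_mul L]
    exact h1.comp hV
  have h1 : ∀ i, ∫ x, V x i * inner ℝ (gradient ψ x) (EuclideanSpace.single i 1)
      = - ∫ x, ψ x * (fderiv ℝ V x (EuclideanSpace.single i (1 : ℝ))) i := by
    intro i
    rw [integral_mul_inner_gradient (hVi i) hψ, neg_inj]
    refine integral_congr_ae ?_
    filter_upwards [hV.ae_differentiableAt (μ := volume)] with x hx
    rw [inner_gradient_left]
    have hd : HasFDerivAt (fun x => V x i) ((EuclideanSpace.proj i : E →L[ℝ] ℝ).comp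
        (fderiv ℝ V x)) x :=
      (EuclideanSpace.proj i : E →L[ℝ] ℝ).hasFDerivAt.comp x hx.hasFDerivAt
    rw [hd.fderiv]
    rfl
  have i1 : ∀ i : Fin 3, Integrable
      (fun x => V x i * inner ℝ (gradient ψ x) (EuclideanSpace.single i 1)) volume := fun i =>
    integrable_mul_inner (hVi i).continuous.locallyIntegrable hψ.continuous_gradient
      (hasCompactSupport_gradient hψ.2) _
  have i2 : ∀ i : Fin 3, Integrable
      (fun x => ψ x * (fderiv ℝ V x (EuclideanSpace.single i (1 : ℝ))) i) volume := by
    intro i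
    refine (hψ.continuous.integrable_of_hasCompactSupport hψ.2).mul_bdd
      (measurable_fderiv_apply_apply V i i).aestronglyMeasurable (c := L) ?_
    exact Eventually.of_forall fun x => norm_fderiv_apply_apply_le hV x i i
  have e1 : ∫ x, inner ℝ (V x) (gradient ψ x)
      = ∫ x, ∑ i, V x i * inner ℝ (gradient ψ x) (EuclideanSpace.single i 1) := by
    refine integral_congr_ae (Eventually.of_forall fun x => ?_)
    simp only [PiLp.inner_apply]
    simp [mul_comm]
  have e2 : ∫ x, ψ x * divergence V x
      = ∫ x, ∑ i, ψ x * (fderiv ℝ V x (EuclideanSpace.single i (1 : ℝ))) i := by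
    refine integral_congr_ae (Eventually.of_forall fun x => ?_)
    simp only [divergence, Finset.mul_sum]
  rw [e1, e2, integral_finsetSum _ fun i _ => i1 i, integral_finsetSum _ fun i _ => i2 i,
    ← Finset.sum_neg_distrib]
  exact Finset.sum_congr rfl fun i _ => h1 i

/-- `div (f V) = f div V + ∇f · V`, with the classical divergence of the Lipschitz field `V`. -/
noncomputable def divMul (V : E → E) (f : E → ℝ) (g : E → E) (x : E) : ℝ :=
  f x * divergence V x + inner ℝ (g x) (V x)

lemma HasWGrad.memLp_divMul {V : E → E} {L : NNReal} (hV : LipschitzWith L V)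
    (hVc : HasCompactSupport V) {f : E → ℝ} {g : E → E} (h : HasWGrad f g) :
    MemLp (fun x => wt x * divMul V f g x) 2 volume := by
  obtain ⟨R, hR⟩ := hVc.isCompact.exists_bound_of_continuousOn
    (f := fun x => wt x * wt x) (by fun_prop)
  have hc : Continuous fun x => wt x • V x := continuous_wt.smul hV.continuous
  obtain ⟨B, hB⟩ := hc.bounded_above_of_compact_support
    (hVc.mono fun x hx hx' => hx (by simp [hx']))
  have hR' : ∀ x, ‖wt x * wt x * divergence V x‖ ≤ |R| * (3 * L) := by
    intro x
    by_cases hx : x ∈ tsupport V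
    · rw [norm_mul]
      exact mul_le_mul ((hR x hx).trans (le_abs_self R)) (abs_divergence_le hV x) (norm_nonneg _)
        (abs_nonneg _)
    · rw [divergence_of_notMem hx, mul_zero, norm_zero]
      positivity
  have e : (fun x => wt x * divMul V f g x) = (fun x => (wt x * wt x * divergence V x) *
      (f x / wt x)) + fun x => inner ℝ (g x) (wt x • V x) := by
    ext x
    simp only [divMul, Pi.add_apply, real_inner_smul_right]
    field_simp [wt_ne x]
  rw [e]
  refine MemLp.add ?_ ?_
  · refine h.memLp.of_le_mul (c := |R| * (3 * L)) (((continuous_wt.mul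
      continuous_wt).aestronglyMeasurable.mul (measurable_divergence V).aestronglyMeasurable).mul
      h.memLp.1) (Eventually.of_forall fun x => ?_)
    rw [norm_mul]
    exact mul_le_mul_of_nonneg_right (hR' x) (norm_nonneg _)
  · refine h.memLp_grad.of_le_mul (c := B) (h.memLp_grad.1.inner hc.aestronglyMeasurable)
      (Eventually.of_forall fun x => ?_)
    refine (norm_inner_le_norm _ _).trans ?_
    rw [mul_comm]
    exact mul_le_mul_of_nonneg_right (hB x) (norm_nonneg _)

lemma HasWGrad.locallyIntegrable_divMul {V : E → E} {L : NNReal} (hV : LipschitzWith L V)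
    (hVc : HasCompactSupport V) {f : E → ℝ} {g : E → E} (h : HasWGrad f g) :
    LocallyIntegrable (divMul V f g) volume := by
  have h1 := memLp_div_wt (h.memLp_divMul hV hVc)
  have h2 : MemLp (divMul V f g) 2 volume := by
    refine h1.ae_eq (Eventually.of_forall fun x => ?_)
    rw [mul_div_cancel_left₀ _ (wt_ne x)]
  exact h2.locallyIntegrable (by norm_num)

/-- The product rule: `divMul V f g` is the distributional divergence of `f V`. -/
lemma HasWGrad.isWeakDiv {V : E → E} {L : NNReal} (hV : LipschitzWith L V)
    (hVc : HasCompactSupport V) {f : E → ℝ} {g : E → E} (h : HasWGrad f g) :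
    IsWeakDiv (fun y => f y • V y) (divMul V f g) := by
  have hfV : LocallyIntegrable (fun y => f y • V y) volume :=
    (h.locallyIntegrable.integrable_smul_right_of_hasCompactSupport hV.continuous
      hVc).locallyIntegrable
  refine ⟨hfV, h.locallyIntegrable_divMul hV hVc, fun φ hφ => ?_⟩
  obtain ⟨B, hB⟩ := hV.continuous.bounded_above_of_compact_support hVc
  -- the identity is linear and bounded in `f`, so it only has to be checked for smooth `f`
  have ma : MemLp (fun x => wt x * (inner ℝ (V x) (gradient φ x) + φ x * divergence V x)) 2
      volume := by
    have hc1 : Continuous fun x => wt x * inner ℝ (V x) (gradient φ x) :=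
      continuous_wt.mul (hV.continuous.inner hφ.continuous_gradient)
    have h1 : MemLp (fun x => wt x * inner ℝ (V x) (gradient φ x)) 2 volume :=
      hc1.memLp_of_hasCompactSupport (hVc.mono fun x hx hx' => hx (by simp [hx']))
    have hc2 : Continuous fun x => wt x * φ x := continuous_wt.mul hφ.continuous
    have h2 : MemLp (fun x => wt x * φ x * divergence V x) 2 volume := by
      refine ((hc2.memLp_of_hasCompactSupport hφ.2.mul_left : MemLp _ 2 volume)).of_le_mul
        (c := 3 * L) (hc2.aestronglyMeasurable.mul (measurable_divergence V).aestronglyMeasurable)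
        (Eventually.of_forall fun x => ?_)
      rw [norm_mul, mul_comm]
      exact mul_le_mul_of_nonneg_right (abs_divergence_le hV x) (norm_nonneg _)
    refine (h1.add h2).ae_eq (Eventually.of_forall fun x => ?_)
    simp only [Pi.add_apply]
    ring
  have mb : MemLp (fun x => φ x • V x) 2 volume :=
    (hφ.continuous.smul hV.continuous).memLp_of_hasCompactSupport
      (hVc.mono fun x hx hx' => hx (by simp [hx']))
  have key := h.eq_of_eq_on_test (F := fun x => inner ℝ (mkPair ma mb) x) (G := fun _ => 0)
    (by fun_prop) continuous_const (by
      intro ψ hψ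
      have hψφ := hψ.mul_right hφ.1
      have h1 := integral_inner_gradient_eq hV hψφ
      rw [inner_toPair]
      have i1 : Integrable (fun x => wt x * (inner ℝ (V x) (gradient φ x) + φ x * divergence V x)
          * (ψ x / wt x)) volume := MemLp.integrable_mul ma hψ.hasWGrad.memLp
      have i2 : Integrable (fun x => (inner ℝ (φ x • V x) (gradient ψ x) : ℝ)) volume :=
        integrable_inner_of_memLp mb hψ.memLp_gradient
      have i3 : Integrable (fun x => ψ x * φ x * divergence V x) volume := by
        refine (hψφ.continuous.integrable_of_hasCompactSupport hψφ.2).mul_bdd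
          (measurable_divergence V).aestronglyMeasurable (c := 3 * L) ?_
        exact Eventually.of_forall fun x => abs_divergence_le hV x
      have i4 : Integrable (fun x => (inner ℝ (V x) (gradient (fun x => ψ x * φ x) x) : ℝ))
          volume := by
        refine (hV.continuous.inner hψφ.continuous_gradient).integrable_of_hasCompactSupport
          (hVc.mono fun x hx hx' => hx (by simp [hx']))
      rw [← integral_add i1 i2]
      rw [← sub_eq_zero, sub_neg_eq_add, ← integral_add i4 i3] at h1
      rw [← h1]
      refine integral_congr_ae (Eventually.of_forall fun x => ?_)
      simp only
      rw [gradient_mul (hψ.differentiable x) (hφ.differentiable x), inner_add_right,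
        real_inner_smul_right, real_inner_smul_right, real_inner_smul_left]
      field_simp [wt_ne x]
      ring)
  rw [inner_toPair] at key
  have i1 : Integrable (fun x => wt x * (inner ℝ (V x) (gradient φ x) + φ x * divergence V x)
      * (f x / wt x)) volume := MemLp.integrable_mul ma h.memLp
  have i2 : Integrable (fun x => (inner ℝ (φ x • V x) (g x) : ℝ)) volume :=
    integrable_inner_of_memLp mb h.memLp_grad
  have i3 : Integrable (fun x => divMul V f g x * φ x) volume := by
    have := (h.locallyIntegrable_divMul hV hVc).integrable_smul_left_of_hasCompactSupport
      hφ.continuous hφ.2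
    refine this.congr (Eventually.of_forall fun x => ?_)
    simp [mul_comm]
  have i4 : Integrable (fun x => (inner ℝ (f x • V x) (gradient φ x) : ℝ)) volume := by
    have := h.locallyIntegrable.integrable_smul_left_of_hasCompactSupport
      (g := fun x => (inner ℝ (V x) (gradient φ x) : ℝ))
      (hV.continuous.inner hφ.continuous_gradient)
      (hVc.mono fun x hx hx' => hx (by simp [hx']))
    refine this.congr (Eventually.of_forall fun x => ?_)
    simp [mul_comm]
  rw [← integral_add i1 i2] at key
  rw [← sub_eq_zero, sub_neg_eq_add, ← integral_add i4 i3, ← key]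
  refine integral_congr_ae (Eventually.of_forall fun x => ?_)
  simp only [divMul, real_inner_smul_left]
  rw [real_inner_comm (V x) (g x)]
  field_simp [wt_ne x]
  ring

lemma HasWGrad.weakDiv_ae_eq {V : E → E} {L : NNReal} (hV : LipschitzWith L V)
    (hVc : HasCompactSupport V) {f : E → ℝ} {g : E → E} (h : HasWGrad f g) :
    weakDiv (fun y => f y • V y) =ᵐ[volume] divMul V f g := by
  have h1 := h.isWeakDiv hV hVc
  have hex : ∃ d, IsWeakDiv (fun y => f y • V y) d := ⟨_, h1⟩
  have h2 : IsWeakDiv (fun y => f y • V y) (weakDiv fun y => f y • V y) := by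
    unfold weakDiv
    rw [dif_pos hex]
    exact hex.choose_spec
  refine ae_eq_of_integral_contDiff_smul_eq h2.2.1 h1.2.1 fun φ hφ hc => ?_
  have e1 := h1.2.2 φ ⟨hφ, hc⟩
  have e2 := h2.2.2 φ ⟨hφ, hc⟩
  rw [e1, neg_inj] at e2
  simp only [smul_eq_mul, mul_comm (φ _)]
  exact e2.symm

/-! ### The transformed coefficients as functions of the derivative of the perturbation -/

/-- The matrix of the derivative of `V`. -/
noncomputable def jacMat (V : E → E) (x : E) : Fin 3 → Fin 3 → ℝ :=
  fun i j => (fderiv ℝ V x (EuclideanSpace.single j 1)) i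

lemma norm_jacMat_le {V : E → E} {L : NNReal} (hV : LipschitzWith L V) (x : E) :
    ‖jacMat V x‖ ≤ L := by
  refine (pi_norm_le_iff_of_nonneg L.2).2 fun i => (pi_norm_le_iff_of_nonneg L.2).2 fun j => ?_
  exact norm_fderiv_apply_apply_le hV x i j

lemma measurable_jacMat (V : E → E) : Measurable (jacMat V) :=
  measurable_pi_lambda _ fun i => measurable_pi_lambda _ fun j => measurable_fderiv_apply_apply V i j

/-- `|det (1 + N)|`. -/
noncomputable def detCoef (N : Fin 3 → Fin 3 → ℝ) : ℝ := |(1 + Matrix.of N).det|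

/-- `|det (1 + N)| (1 + N)⁻¹ (1 + N)⁻ᵀ`, so that `A(ε, x)` is the value at `N = ε DV(x)`. -/
noncomputable def matCoef (N : Fin 3 → Fin 3 → ℝ) : Matrix (Fin 3) (Fin 3) ℝ :=
  detCoef N • ((1 + Matrix.of N)⁻¹ * ((1 + Matrix.of N)⁻¹).transpose)

/-- The derivative of `matCoef` at `0`, entry by entry. -/
noncomputable def matCoefDeriv (N : Fin 3 → Fin 3 → ℝ) : Matrix (Fin 3) (Fin 3) ℝ :=
  Matrix.of fun i j => fderiv ℝ (fun N => matCoef N i j) 0 N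

lemma contDiff_det_one_add :
    ContDiff ℝ 1 fun N : Fin 3 → Fin 3 → ℝ => (1 + Matrix.of N).det := by
  simp only [Matrix.det_fin_three, Matrix.add_apply, Matrix.of_apply]
  fun_prop

lemma contDiff_adjugate_one_add (i j : Fin 3) :
    ContDiff ℝ 1 fun N : Fin 3 → Fin 3 → ℝ => (1 + Matrix.of N).adjugate i j := by
  simp only [Matrix.adjugate_fin_three, Matrix.add_apply, Matrix.of_apply]
  fin_cases i <;> fin_cases j <;> simp <;> fun_prop

lemma matCoef_apply (N : Fin 3 → Fin 3 → ℝ) (i j : Fin 3) :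
    matCoef N i j = |(1 + Matrix.of N).det| * ∑ k, (((1 + Matrix.of N).det)⁻¹ *
      (1 + Matrix.of N).adjugate i k) * (((1 + Matrix.of N).det)⁻¹ *
      (1 + Matrix.of N).adjugate j k) := by
  simp only [matCoef, detCoef, Matrix.smul_apply, Matrix.mul_apply, Matrix.inv_def,
    Ring.inverse_eq_inv', Matrix.transpose_apply, smul_eq_mul]

lemma measurable_detCoef : Measurable detCoef :=
  contDiff_det_one_add.continuous.abs.measurable

lemma measurable_matCoef (i j : Fin 3) : Measurable fun N => matCoef N i j := by
  simp only [matCoef_apply]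
  have hd := contDiff_det_one_add.continuous.measurable
  refine (contDiff_det_one_add.continuous.abs.measurable).mul
    (Finset.measurable_sum _ fun k _ => Measurable.mul ?_ ?_)
  · exact hd.inv.mul (contDiff_adjugate_one_add i k).continuous.measurable
  · exact hd.inv.mul (contDiff_adjugate_one_add j k).continuous.measurable

lemma det_one_add_zero : (1 + Matrix.of (0 : Fin 3 → Fin 3 → ℝ)).det = 1 := by
  have : (Matrix.of (0 : Fin 3 → Fin 3 → ℝ)) = 0 := rfl
  rw [this, add_zero, Matrix.det_one]

lemma detCoef_zero : detCoef 0 = 1 := by rw [detCoef, det_one_add_zero, abs_one]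

lemma matCoef_zero : matCoef 0 = 1 := by
  have : (Matrix.of (0 : Fin 3 → Fin 3 → ℝ)) = 0 := rfl
  simp [matCoef, detCoef_zero, this]

lemma differentiableAt_detCoef : DifferentiableAt ℝ detCoef 0 := by
  refine DifferentiableAt.abs (contDiff_det_one_add.differentiable one_ne_zero 0) ?_
  rw [det_one_add_zero]
  exact one_ne_zero

lemma differentiableAt_matCoef (i j : Fin 3) : DifferentiableAt ℝ (fun N => matCoef N i j) 0 := by
  simp only [matCoef_apply]
  have hd := contDiff_det_one_add.differentiable one_ne_zero 0
  have hi : DifferentiableAt ℝ (fun N : Fin 3 → Fin 3 → ℝ => ((1 + Matrix.of N).det)⁻¹) 0 :=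
    hd.inv (by rw [det_one_add_zero]; exact one_ne_zero)
  refine differentiableAt_detCoef.mul (DifferentiableAt.fun_sum fun k _ => DifferentiableAt.mul ?_ ?_)
  · exact hi.mul ((contDiff_adjugate_one_add i k).differentiable one_ne_zero 0)
  · exact hi.mul ((contDiff_adjugate_one_add j k).differentiable one_ne_zero 0)

lemma hasDerivAt_smul_zero {Φ : (Fin 3 → Fin 3 → ℝ) → ℝ} (hΦ : DifferentiableAt ℝ Φ 0)
    (N : Fin 3 → Fin 3 → ℝ) : HasDerivAt (fun ε : ℝ => Φ (ε • N)) (fderiv ℝ Φ 0 N) 0 := by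
  have h1 : HasDerivAt (fun ε : ℝ => ε • N) N 0 := by
    simpa using (hasDerivAt_id (0 : ℝ)).smul_const N
  have h2 : HasFDerivAt Φ (fderiv ℝ Φ 0) ((0 : ℝ) • N) := by
    rw [zero_smul]
    exact hΦ.hasFDerivAt
  exact h2.comp_hasDerivAt 0 h1

/-- The derivative of the determinant at the identity is the trace. -/
lemma fderiv_detCoef_zero (N : Fin 3 → Fin 3 → ℝ) :
    fderiv ℝ detCoef 0 N = ∑ i, N i i := by
  have h1 := hasDerivAt_smul_zero differentiableAt_detCoef N
  have h2 : HasDerivAt (fun ε : ℝ => (1 + Matrix.of (ε • N)).det) (∑ i, N i i) 0 := by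
    have e : (fun ε : ℝ => (1 + Matrix.of (ε • N)).det) = fun ε : ℝ => 1 +
        (Matrix.of N).trace * ε + Polynomial.eval ε ((1 + (Polynomial.X : Polynomial ℝ) •
          (Matrix.of N).map Polynomial.C).det).divX.divX * ε ^ 2 := by
      ext ε
      rw [← Matrix.det_one_add_smul]
      rfl
    rw [e]
    have h3 := ((hasDerivAt_id (0 : ℝ)).const_mul (Matrix.of N).trace).const_add 1
    have h4 := (Polynomial.hasDerivAt (((1 + (Polynomial.X : Polynomial ℝ) •
          (Matrix.of N).map Polynomial.C).det).divX.divX) (0 : ℝ)).mul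
          ((hasDerivAt_id (0 : ℝ)).pow 2)
    refine (h3.add h4).congr_deriv ?_
    simp [Matrix.trace]
  have h5 : HasDerivAt (fun ε : ℝ => detCoef (ε • N)) (∑ i, N i i) 0 := by
    refine h2.congr_of_eventuallyEq ?_
    have hpos : ∀ᶠ ε : ℝ in 𝓝 0, 0 < (1 + Matrix.of (ε • N)).det := by
      refine h2.continuousAt.eventually (lt_mem_nhds ?_)
      simp only
      rw [zero_smul, det_one_add_zero]
      exact one_pos
    filter_upwards [hpos] with ε hε
    exact abs_of_pos hε
  exact h1.unique h5

/-- Continuity at `0` makes `Φ (ε N)` converge uniformly for bounded `N`. -/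
lemma eventually_abs_sub_le {Φ : (Fin 3 → Fin 3 → ℝ) → ℝ} (hΦ : ContinuousAt Φ 0) (L : ℝ) {η : ℝ}
    (hη : 0 < η) :
    ∀ᶠ ε : ℝ in 𝓝[>] 0, ∀ N : Fin 3 → Fin 3 → ℝ, ‖N‖ ≤ L → |Φ (ε • N) - Φ 0| ≤ η := by
  obtain ⟨δ, hδ, h⟩ := Metric.continuousAt_iff.1 hΦ η hη
  have ht : Tendsto (fun ε : ℝ => ε * L) (𝓝[>] 0) (𝓝 (0 * L)) :=
    (tendsto_id.mul_const _).mono_left nhdsWithin_le_nhds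
  rw [zero_mul] at ht
  filter_upwards [ht.eventually (gt_mem_nhds hδ), self_mem_nhdsWithin] with ε h1 h2 N hN
  refine (h (x := ε • N) ?_).le
  rw [dist_zero_right, norm_smul, Real.norm_of_nonneg (le_of_lt h2)]
  exact (mul_le_mul_of_nonneg_left hN (le_of_lt h2)).trans_lt h1

/-- Differentiability at `0` makes the difference quotients along `ε ↦ ε N` converge uniformly for
bounded `N`. -/
lemma eventually_abs_quotient_sub_le {Φ : (Fin 3 → Fin 3 → ℝ) → ℝ} (hΦ : DifferentiableAt ℝ Φ 0)
    {L : ℝ} (hL : 0 ≤ L) {η : ℝ} (hη : 0 < η) :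
    ∀ᶠ ε : ℝ in 𝓝[>] 0, ∀ N : Fin 3 → Fin 3 → ℝ, ‖N‖ ≤ L →
      |ε⁻¹ * (Φ (ε • N) - Φ 0) - fderiv ℝ Φ 0 N| ≤ η := by
  have h1 := (hasFDerivAt_iff_isLittleO_nhds_zero.1 hΦ.hasFDerivAt)
  have h2 := h1.def (show 0 < η / (L + 1) by positivity)
  obtain ⟨δ, hδ, h⟩ := Metric.eventually_nhds_iff.1 h2
  have ht : Tendsto (fun ε : ℝ => ε * L) (𝓝[>] 0) (𝓝 (0 * L)) :=
    (tendsto_id.mul_const _).mono_left nhdsWithin_le_nhds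
  rw [zero_mul] at ht
  filter_upwards [ht.eventually (gt_mem_nhds hδ), self_mem_nhdsWithin] with ε h3 h4 N hN
  have h4' : 0 < ε := h4
  have hn : ‖ε • N‖ ≤ ε * L := by
    rw [norm_smul, Real.norm_of_nonneg h4'.le]
    exact mul_le_mul_of_nonneg_left hN h4'.le
  have h5 := h (y := ε • N) (by rw [dist_zero_right]; exact hn.trans_lt h3)
  rw [zero_add, map_smul, smul_eq_mul, Real.norm_eq_abs] at h5
  have e : ε⁻¹ * (Φ (ε • N) - Φ 0) - fderiv ℝ Φ 0 N
      = ε⁻¹ * (Φ (ε • N) - Φ 0 - ε * fderiv ℝ Φ 0 N) := by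
    field_simp
  rw [e, abs_mul, abs_inv, abs_of_pos h4', inv_mul_le_iff₀ h4']
  refine h5.trans ((mul_le_mul_of_nonneg_left hn (by positivity)).trans ?_)
  rw [div_mul_eq_mul_div, div_le_iff₀ (by positivity)]
  nlinarith [mul_pos hη h4']

lemma jacobian_eq {V : E → E} {x : E} (hx : DifferentiableAt ℝ V x) (ε : ℝ) :
    jacobian V ε x = 1 + Matrix.of (ε • jacMat V x) := by
  have h : HasFDerivAt (perturbMap V ε) (ContinuousLinearMap.id ℝ E + ε • fderiv ℝ V x) x :=
    (hasFDerivAt_id x).add (hx.hasFDerivAt.const_smul ε)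
  ext i j
  rw [jacobian, Matrix.of_apply, h.fderiv]
  simp [jacMat, Matrix.one_apply]

lemma matA_eq {V : E → E} {x : E} (hx : DifferentiableAt ℝ V x) (ε : ℝ) :
    matA V ε x = matCoef (ε • jacMat V x) := by
  rw [matA, jacobian_eq hx, matCoef, detCoef]

lemma matA'_eq {V : E → E} {x : E} (hx : DifferentiableAt ℝ V x) :
    matA' V x = matCoefDeriv (jacMat V x) := by
  ext i j
  simp only [matA', matCoefDeriv, Matrix.of_apply, matA_eq hx]
  exact (hasDerivAt_smul_zero (differentiableAt_matCoef i j) (jacMat V x)).deriv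

lemma det_eq_det_matrix (D : E →L[ℝ] E) :
    D.det = (Matrix.of fun i j => (D (EuclideanSpace.single j 1)) i).det := by
  rw [ContinuousLinearMap.det, ← LinearMap.det_toMatrix (EuclideanSpace.basisFun (Fin 3) ℝ).toBasis]
  congr 1

lemma abs_det_fderiv_perturbMap {V : E → E} {x : E} (hx : DifferentiableAt ℝ V x) (ε : ℝ) :
    |(fderiv ℝ (perturbMap V ε) x).det| = detCoef (ε • jacMat V x) := by
  rw [detCoef, ← jacobian_eq hx, det_eq_det_matrix, jacobian]

/-! ### The form of a matrix -/

/-- The form `aᵀ B b`. -/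
def matForm (B : Matrix (Fin 3) (Fin 3) ℝ) (a b : E) : ℝ := ∑ i, ∑ j, a i * B i j * b j

lemma matForm_one (a b : E) : matForm 1 a b = inner ℝ a b := by
  simp [matForm, Matrix.one_apply, PiLp.inner_apply, mul_comm]

lemma matForm_add (B B' : Matrix (Fin 3) (Fin 3) ℝ) (a b : E) :
    matForm (B + B') a b = matForm B a b + matForm B' a b := by
  simp only [matForm, ← Finset.sum_add_distrib, Matrix.add_apply]
  refine Finset.sum_congr rfl fun i _ => Finset.sum_congr rfl fun j _ => ?_
  ring

lemma matForm_smul (c : ℝ) (B : Matrix (Fin 3) (Fin 3) ℝ) (a b : E) :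
    matForm (c • B) a b = c * matForm B a b := by
  simp only [matForm, Finset.mul_sum, Matrix.smul_apply, smul_eq_mul]
  refine Finset.sum_congr rfl fun i _ => Finset.sum_congr rfl fun j _ => ?_
  ring

lemma matForm_sub (B B' : Matrix (Fin 3) (Fin 3) ℝ) (a b : E) :
    matForm (B - B') a b = matForm B a b - matForm B' a b := by
  have h := matForm_add (B - B') B' a b
  rw [sub_add_cancel] at h
  linarith

lemma matForm_add_left (B : Matrix (Fin 3) (Fin 3) ℝ) (a a' b : E) :
    matForm B (a + a') b = matForm B a b + matForm B a' b := by
  simp only [matForm, ← Finset.sum_add_distrib, PiLp.add_apply]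
  refine Finset.sum_congr rfl fun i _ => Finset.sum_congr rfl fun j _ => ?_
  ring

lemma matForm_smul_left (B : Matrix (Fin 3) (Fin 3) ℝ) (c : ℝ) (a b : E) :
    matForm B (c • a) b = c * matForm B a b := by
  simp only [matForm, Finset.mul_sum, PiLp.smul_apply, smul_eq_mul]
  refine Finset.sum_congr rfl fun i _ => Finset.sum_congr rfl fun j _ => ?_
  ring

/-- The factor `9` is the number of entries. -/
lemma abs_matForm_le {B : Matrix (Fin 3) (Fin 3) ℝ} {c : ℝ} (hB : ∀ i j, |B i j| ≤ c) (a b : E) :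
    |matForm B a b| ≤ 9 * c * (‖a‖ * ‖b‖) := by
  have h1 : ∀ i j, |a i * B i j * b j| ≤ c * (‖a‖ * ‖b‖) := by
    intro i j
    rw [abs_mul, abs_mul]
    have ha : |a i| ≤ ‖a‖ := PiLp.norm_apply_le a i
    have hb : |b j| ≤ ‖b‖ := PiLp.norm_apply_le b j
    calc |a i| * |B i j| * |b j| ≤ ‖a‖ * c * ‖b‖ := by
          have hc : 0 ≤ c := (abs_nonneg _).trans (hB i j)
          gcongr
          exact hB i j
      _ = c * (‖a‖ * ‖b‖) := by ring
  calc |matForm B a b| ≤ ∑ i, ∑ j, |a i * B i j * b j| :=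
        (Finset.abs_sum_le_sum_abs _ _).trans
          (Finset.sum_le_sum fun i _ => Finset.abs_sum_le_sum_abs _ _)
    _ ≤ ∑ _i : Fin 3, ∑ _j : Fin 3, c * (‖a‖ * ‖b‖) :=
        Finset.sum_le_sum fun i _ => Finset.sum_le_sum fun j _ => h1 i j
    _ = 9 * c * (‖a‖ * ‖b‖) := by
        simp only [Finset.sum_const, Finset.card_univ, Fintype.card_fin, nsmul_eq_mul]
        push_cast
        ring

/-- The change of variables turns `∇u · ∇w` into the form of the transformed matrix. -/
lemma matForm_matA_pullGrad {V : E → E} {ε : ℝ} {x : E} (hdet : (jacobian V ε x).det ≠ 0)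
    (g h : E → E) :
    matForm (matA V ε x) (pullGrad (perturbMap V ε) g x) (pullGrad (perturbMap V ε) h x)
      = |(jacobian V ε x).det| * inner ℝ (g (perturbMap V ε x)) (h (perturbMap V ε x)) := by
  set J := jacobian V ε x with hJ
  have hp : ∀ k : E → E, ((pullGrad (perturbMap V ε) k x).ofLp : Fin 3 → ℝ)
      = J.transpose.mulVec (k (perturbMap V ε x)).ofLp := by
    intro k
    ext i
    have h1 : (pullGrad (perturbMap V ε) k x) i
        = inner ℝ (pullGrad (perturbMap V ε) k x) (EuclideanSpace.single i (1 : ℝ)) := by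
      simp [EuclideanSpace.inner_single_right]
    rw [h1, pullGrad, ContinuousLinearMap.adjoint_inner_left, PiLp.inner_apply]
    simp [Matrix.mulVec, dotProduct, hJ, jacobian, Matrix.transpose_apply]
  have hq : ∀ (B : Matrix (Fin 3) (Fin 3) ℝ) (a b : E),
      matForm B a b = dotProduct a.ofLp (B.mulVec b.ofLp) := by
    intro B a b
    simp only [matForm, dotProduct, Matrix.mulVec, Finset.mul_sum]
    refine Finset.sum_congr rfl fun i _ => Finset.sum_congr rfl fun j _ => ?_
    ring
  have hu : IsUnit J.det := hdet.isUnit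
  have hut : IsUnit J.transpose.det := by rwa [Matrix.det_transpose]
  rw [hq, hp, hp, matA, ← hJ, Matrix.smul_mulVec, dotProduct_smul, smul_eq_mul,
    Matrix.mulVec_mulVec, Matrix.mul_assoc, Matrix.transpose_nonsing_inv,
    Matrix.nonsing_inv_mul _ hut, Matrix.mul_one, Matrix.dotProduct_mulVec,
    Matrix.mulVec_transpose, Matrix.vecMul_vecMul, Matrix.mul_nonsing_inv _ hu, Matrix.vecMul_one]
  congr 1
  simp [PiLp.inner_apply, dotProduct, mul_comm]

lemma integrable_coeff_matForm {a : E → ℝ} (ha : Measurable a) {C : ℝ} (hC : ∀ x, |a x| ≤ C)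
    {B : E → Matrix (Fin 3) (Fin 3) ℝ} (hB : ∀ i j, Measurable fun x => B x i j) {c : ℝ}
    (hBc : ∀ x i j, |B x i j| ≤ c) {g h : E → E} (hg : MemLp g 2 volume) (hh : MemLp h 2 volume) :
    Integrable (fun x => a x * matForm (B x) (g x) (h x)) volume := by
  have hm : AEStronglyMeasurable (fun x => matForm (B x) (g x) (h x)) volume := by
    unfold matForm
    refine Finset.aestronglyMeasurable_fun_sum _ fun i _ =>
      Finset.aestronglyMeasurable_fun_sum _ fun j _ => ?_
    refine ((?_ : AEStronglyMeasurable (fun x => g x i) volume).mul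
      (hB i j).aestronglyMeasurable).mul ?_
    · exact (EuclideanSpace.proj i : E →L[ℝ] ℝ).continuous.comp_aestronglyMeasurable hg.1
    · exact (EuclideanSpace.proj j : E →L[ℝ] ℝ).continuous.comp_aestronglyMeasurable hh.1
  refine ((integrable_norm_mul_norm hg hh).const_mul (C * (9 * c))).mono'
    (ha.aestronglyMeasurable.mul hm) (Eventually.of_forall fun x => ?_)
  rw [norm_mul, mul_assoc]
  exact mul_le_mul (hC x) (abs_matForm_le (hBc x) _ _) (norm_nonneg _) ((abs_nonneg _).trans (hC x))

lemma abs_integral_coeff_matForm_le {a : E → ℝ} {C : ℝ} (hC : ∀ x, |a x| ≤ C)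
    {B : E → Matrix (Fin 3) (Fin 3) ℝ} {c : ℝ} (hBc : ∀ x i j, |B x i j| ≤ c) {g h : E → E}
    (hg : MemLp g 2 volume) (hh : MemLp h 2 volume) :
    |∫ x, a x * matForm (B x) (g x) (h x)| ≤
      C * (9 * c) * ((eLpNorm g 2 volume).toReal * (eLpNorm h 2 volume).toReal) := by
  have hC0 : 0 ≤ C := (abs_nonneg _).trans (hC 0)
  have hc0 : 0 ≤ c := (abs_nonneg _).trans (hBc 0 0 0)
  calc |∫ x, a x * matForm (B x) (g x) (h x)| ≤ ∫ x, |a x * matForm (B x) (g x) (h x)| :=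
        abs_integral_le_integral_abs
    _ ≤ ∫ x, C * (9 * c) * (‖g x‖ * ‖h x‖) := by
        refine integral_mono_of_nonneg (Eventually.of_forall fun x => abs_nonneg _)
          ((integrable_norm_mul_norm hg hh).const_mul _) (Eventually.of_forall fun x => ?_)
        simp only
        rw [abs_mul, mul_assoc C]
        exact mul_le_mul (hC x) (abs_matForm_le (hBc x) _ _) (abs_nonneg _) hC0
    _ ≤ _ := by
        rw [integral_const_mul]
        exact mul_le_mul_of_nonneg_left (integral_norm_mul_norm_le hg hh) (by positivity)

/-! ### Boundaries of class `C^{1,1}` are null sets -/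

/-- Near a boundary point the defining function vanishes on the boundary. -/
lemma IsC11DefiningFunction.eventually_eq_zero {D : Set E} (hD : IsOpen D) {p : E} {ψ : E → ℝ}
    (h : IsC11DefiningFunction D p ψ) : ∀ᶠ x in 𝓝 p, x ∈ frontier D → ψ x = 0 := by
  obtain ⟨U, hU, hp, hd, -, -, hs⟩ := h
  filter_upwards [hU.mem_nhds hp] with x hxU hx
  rw [hD.frontier_eq] at hx
  refine le_antisymm (not_lt.1 fun hlt => ?_) (not_lt.1 fun hlt => hx.2 ((hs x hxU).2 hlt))
  have hev : ∀ᶠ y in 𝓝 x, y ∈ U ∧ 0 < ψ y :=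
    (hU.eventually_mem hxU).and
      ((hd.differentiableAt (hU.mem_nhds hxU)).continuousAt.eventually_const_lt hlt)
  obtain ⟨y, ⟨hyU, hy⟩, hyD⟩ := mem_closure_iff_nhds.1 hx.1 _ hev
  exact lt_asymm hy ((hs y hyU).1 hyD)

/-- A defining function is strictly differentiable because its gradient is continuous. -/
lemma IsC11DefiningFunction.hasStrictFDerivAt {D : Set E} {p : E} {ψ : E → ℝ}
    (h : IsC11DefiningFunction D p ψ) :
    HasStrictFDerivAt ψ (innerSL ℝ (gradient ψ p)) p := by
  obtain ⟨U, hU, hp, hd, ⟨K, hK⟩, -, -⟩ := h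
  refine hasStrictFDerivAt_of_hasFDerivAt_of_continuousAt
    (f' := fun x => innerSL ℝ (gradient ψ x)) ?_ ?_
  · filter_upwards [hU.mem_nhds hp] with x hx
    exact (hd.differentiableAt (hU.mem_nhds hx)).hasGradientAt.hasFDerivAt
  · exact (innerSL ℝ).continuous.continuousAt.comp (hK.continuousOn.continuousAt (hU.mem_nhds hp))

/-- Small translates of a piece of the boundary in the normal direction are pairwise disjoint, so
the boundary is a null set. -/
lemma IsC11Domain.volume_frontier {D : Set E} (hD : IsC11Domain D) : volume (frontier D) = 0 := by
  refine measure_null_of_locally_null _ fun p hp => ?_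
  obtain ⟨ψ, hψ⟩ := hD.boundary p hp
  set e := gradient ψ p with he
  have he0 : e ≠ 0 := by
    obtain ⟨U, -, -, -, -, h0, -⟩ := hψ
    exact h0
  have hn : 0 < ‖e‖ := norm_pos_iff.2 he0
  have h1 := hψ.hasStrictFDerivAt.isLittleO.def (half_pos hn)
  rw [nhds_prod_eq] at h1
  obtain ⟨s, hs, h2⟩ := mem_prod_self_iff.1 h1
  obtain ⟨r, hr, hball⟩ := Metric.mem_nhds_iff.1
    (inter_mem hs (hψ.eventually_eq_zero hD.isOpen))
  refine ⟨frontier D ∩ Metric.ball p r,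
    inter_mem self_mem_nhdsWithin (mem_nhdsWithin_of_mem_nhds (Metric.ball_mem_nhds p hr)), ?_⟩
  have hb : Bornology.IsBounded (range fun k : ℕ => ((1 / 2 : ℝ) ^ k) • e) := by
    refine isBounded_iff_forall_norm_le.2 ⟨‖e‖, ?_⟩
    rintro _ ⟨k, rfl⟩
    rw [norm_smul, norm_pow, Real.norm_of_nonneg (by norm_num)]
    exact mul_le_of_le_one_left hn.le (pow_le_one₀ (by norm_num) (by norm_num))
  refine Measure.addHaar_eq_zero_of_disjoint_translates volume _ hb ?_
    (isClosed_frontier.measurableSet.inter measurableSet_ball)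
  intro m k hmk
  rw [Function.onFun, Set.disjoint_left]
  rintro _ ⟨_, rfl, x, hx, rfl⟩ ⟨_, rfl, y, hy, hxy⟩
  have hxb := hball hx.2
  have hyb := hball hy.2
  have h3 := h2 (mk_mem_prod hxb.1 hyb.1)
  simp only [mem_ofPred_eq] at h3 hxy
  have hsub : x - y = ((1 / 2 : ℝ) ^ k - (1 / 2) ^ m) • e := by
    rw [sub_smul, sub_eq_sub_iff_add_eq_add, add_comm, ← hxy, add_comm]
  rw [hxb.2 hx.1, hyb.2 hy.1, hsub, sub_self, zero_sub, norm_neg, ← he, innerSL_apply_apply,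
    inner_smul_right, real_inner_self_eq_norm_sq, norm_mul, norm_smul, norm_pow, norm_norm] at h3
  have hne : 0 < ‖(1 / 2 : ℝ) ^ k - (1 / 2) ^ m‖ := by
    refine norm_pos_iff.2 (sub_ne_zero.2 fun h => hmk ?_)
    exact (pow_right_injective₀ (by norm_num : (0 : ℝ) < 1 / 2) (by norm_num) h).symm
  have : 0 < ‖(1 / 2 : ℝ) ^ k - (1 / 2) ^ m‖ * ‖e‖ ^ 2 := by positivity
  nlinarith

lemma IsC11Domain.isNiceDomain {D : Set E} (hD : IsC11Domain D) : IsNiceDomain D :=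
  ⟨hD.isOpen, hD.isBounded, hD.volume_frontier⟩

/-! ### The perturbed partition -/

/-- A compactly supported locally Lipschitz map is Lipschitz. -/
lemma LocallyLipschitz.exists_lipschitzWith {V : E → E} (hV : LocallyLipschitz V)
    (hc : HasCompactSupport V) : ∃ L, LipschitzWith L V := by
  obtain ⟨R, hR⟩ := hc.isCompact.isBounded.subset_closedBall (0 : E)
  obtain ⟨L, hL⟩ := hV.locallyLipschitzOn.exists_lipschitzOnWith_of_compact
    (isCompact_closedBall (0 : E) (R + 1))
  obtain ⟨M, hM⟩ := hc.exists_bound_of_continuous hV.continuous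
  have hM0 : 0 ≤ M := (norm_nonneg _).trans (hM 0)
  refine ⟨max L ⟨M, hM0⟩, LipschitzWith.of_dist_le_mul ?_⟩
  have hmax : ∀ x y : E, (L : ℝ) * dist x y ≤ (max L ⟨M, hM0⟩ : NNReal) * dist x y := fun x y =>
    mul_le_mul_of_nonneg_right (NNReal.coe_le_coe.2 (le_max_left _ _)) dist_nonneg
  have hmax' : ∀ x y : E, M * dist x y ≤ (max L ⟨M, hM0⟩ : NNReal) * dist x y := fun x y =>
    mul_le_mul_of_nonneg_right (NNReal.coe_le_coe.2 (le_max_right L ⟨M, hM0⟩)) dist_nonneg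
  -- A point outside the larger ball has distance at least one from the support.
  have far : ∀ x y : E, x ∉ Metric.closedBall (0 : E) (R + 1) → dist (V x) (V y) ≤ M * dist x y := by
    intro x y hx
    have hx' : R + 1 < ‖x‖ := by simpa using hx
    have hx0 : V x = 0 := image_eq_zero_of_notMem_tsupport fun h => by
      have := hR h
      rw [mem_closedBall_zero_iff] at this
      linarith
    by_cases hy : y ∈ tsupport V
    · have h1 : 1 ≤ dist x y := by
        have := hR hy
        rw [mem_closedBall_zero_iff] at this
        rw [dist_eq_norm]
        linarith [norm_sub_norm_le x y]
      rw [hx0, dist_zero_left]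
      exact (hM y).trans (le_mul_of_one_le_right hM0 h1)
    · rw [hx0, image_eq_zero_of_notMem_tsupport hy, dist_self]
      positivity
  intro x y
  by_cases hx : x ∈ Metric.closedBall (0 : E) (R + 1)
  · by_cases hy : y ∈ Metric.closedBall (0 : E) (R + 1)
    · exact (hL.dist_le_mul x hx y hy).trans (hmax x y)
    · rw [dist_comm (V x), dist_comm x]
      exact (far y x hy).trans (hmax' y x)
  · exact (far x y hx).trans (hmax' x y)

lemma locallyLipschitz_smul {k : E → ℝ} {m : E → E} (hk : LocallyLipschitz k)
    (hm : LocallyLipschitz m) : LocallyLipschitz fun x => k x • m x := by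
  have h : ContDiff ℝ 1 fun q : ℝ × E => q.1 • q.2 := contDiff_fst.smul contDiff_snd
  have h1 := h.locallyLipschitz
  have h2 := hk.prodMk hm
  have h3 := h1.comp h2
  exact h3

lemma IsNiceDomain.image {D : Set E} (hD : IsNiceDomain D) {T : E ≃ₜ E} {K : NNReal}
    (hT : IsBiLipschitz T K) : IsNiceDomain (T '' D) := by
  refine ⟨T.isOpenMap _ hD.isOpen, hT.lip.isBounded_image hD.isBounded, ?_⟩
  rw [← T.image_frontier]
  refine le_antisymm ((volume_image_le_of_lipschitz hT.lip _).trans ?_) zero_le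
  rw [hD.null, mul_zero]

lemma image_ext (T : E ≃ₜ E) (D : Set E) : T '' ext D = ext (T '' D) := by
  rw [ext, ext, ← T.image_closure, image_compl_eq T.bijective]

lemma image_frontier_eq_perturbedInterface {D : Set E} {V : E → E} {ε : ℝ} {κ : frontier D → ℝ}
    {n : frontier D → E} (h : ∀ x : frontier D, V x = κ x • n x) {T : E ≃ₜ E}
    (hT : (T : E → E) = perturbMap V ε) : frontier (T '' D) = perturbedInterface D κ n ε := by
  rw [← T.image_frontier, hT, image_eq_range]
  refine congrArg range (funext fun x => ?_)
  rw [perturbMap, h x, smul_smul]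

lemma perturbMap_zero (V : E → E) : perturbMap V 0 = id := by
  funext x
  simp [perturbMap]

/-- The perturbation does not leave the support of the velocity field. -/
lemma apply_mem_tsupport {V : E → E} {ε : ℝ} {T : E ≃ₜ E} (hT : (T : E → E) = perturbMap V ε)
    {x : E} (hx : x ∈ tsupport V) : T x ∈ tsupport V := by
  by_contra h
  have h1 : T (T x) = T x := by rw [hT, perturbMap_of_notMem (hT ▸ h)]
  exact h ((T.injective h1).symm ▸ hx)

/-! ### Weak solutions -/

lemma measurable_coeff {D : Set E} (hD : MeasurableSet D) (αm αp : ℝ) :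
    Measurable (coeff D αm αp) := Measurable.ite hD measurable_const measurable_const

lemma min_le_coeff (D : Set E) (αm αp : ℝ) (x : E) : min αm αp ≤ coeff D αm αp x := by
  unfold coeff
  split_ifs
  exacts [min_le_left _ _, min_le_right _ _]

lemma abs_coeff_le (D : Set E) (αm αp : ℝ) (x : E) : |coeff D αm αp x| ≤ max |αm| |αp| := by
  unfold coeff
  split_ifs
  exacts [le_max_left _ _, le_max_right _ _]

lemma HasWGrad.norm_grad_le_norm_toPair {v : E → ℝ} {g : E → E} (h : HasWGrad v g) :
    (eLpNorm g 2 volume).toReal ≤ ‖h.toPair‖ := by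
  have h1 := WithLp.prod_norm_sq_eq_of_L2 h.toPair
  have h2 : ‖h.toPair.snd‖ = (eLpNorm g 2 volume).toReal := Lp.norm_toLp g h.memLp_grad
  rw [h2] at h1
  refine le_of_sq_le_sq ?_ (norm_nonneg _)
  rw [h1]
  exact le_add_of_nonneg_left (sq_nonneg _)

/-- For `f` in the dual of `W`, the functional `φ ↦ ∫ f φ` extends to the Hilbert space of pairs. -/
lemma MemDualW.exists_functional {D : Set E} (hD : IsNiceDomain D) {f : E → ℝ}
    (hf : MemLp f 2 volume) (h : MemDualW D f) :
    ∃ F : PairSpace →L[ℝ] ℝ, ∀ φ, ∀ hφ : IsTest φ, F hφ.hasWGrad.toPair = ∫ x, f x * φ x := by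
  obtain ⟨C, hC⟩ := h
  obtain ⟨M, hM0, hM⟩ := hD.exists_normW_le
  refine Transmission.exists_functional hf (C := |C| * M) fun φ hφ => (hC φ hφ).trans ?_
  calc C * normW D φ ≤ |C| * (M * ‖hφ.hasWGrad.toPair‖) := by
        refine mul_le_mul (le_abs_self C) ((hM _ _ hφ.hasWGrad).trans ?_) (Real.sqrt_nonneg _)
          (abs_nonneg C)
        exact mul_le_mul_of_nonneg_left hφ.hasWGrad.norm_grad_le_norm_toPair hM0
    _ = |C| * M * ‖hφ.hasWGrad.toPair‖ := by ring

/-- The energy form determines an element of `H¹_w(ℝ³)`: by coercivity its gradient, and by the Hardy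
inequality the function itself. -/
lemma HasWGrad.ae_eq_of_form_eq {a : E → ℝ} (ha : Measurable a) {c C : ℝ} (hc : 0 < c)
    (hca : ∀ x, c ≤ a x) (hC : ∀ x, |a x| ≤ C) {v v' : E → ℝ} {g g' : E → E} (h : HasWGrad v g)
    (h' : HasWGrad v' g')
    (H : ∀ w k, HasWGrad w k → ∫ x, a x * inner ℝ (g x) (k x) = ∫ x, a x * inner ℝ (g' x) (k x)) :
    v =ᵐ[volume] v' := by
  have hs := h.sub h'
  have h0 := H _ _ hs
  rw [← sub_eq_zero, ← integral_sub (integrable_coeff_inner ha hC h.memLp_grad hs.memLp_grad)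
    (integrable_coeff_inner ha hC h'.memLp_grad hs.memLp_grad)] at h0
  have e : ∀ x, a x * inner ℝ (g x) (g x - g' x) - a x * inner ℝ (g' x) (g x - g' x)
      = a x * ‖g x - g' x‖ ^ 2 := fun x => by
    rw [← mul_sub, ← inner_sub_left, real_inner_self_eq_norm_sq]
  simp only [e] at h0
  have hi : Integrable (fun x => a x * ‖g x - g' x‖ ^ 2) volume := by
    refine (integrable_coeff_inner ha hC hs.memLp_grad hs.memLp_grad).congr ?_
    exact Eventually.of_forall fun x => by simp only [real_inner_self_eq_norm_sq]
  have hz := (integral_eq_zero_iff_of_nonneg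
    (fun x => mul_nonneg (hc.le.trans (hca x)) (sq_nonneg _)) hi).1 h0
  have hg : eLpNorm (fun x => g x - g' x) 2 volume = 0 := by
    rw [eLpNorm_eq_zero_iff hs.memLp_grad.1 two_ne_zero]
    filter_upwards [hz] with x hx
    have := (mul_eq_zero.1 hx).resolve_left (hc.trans_le (hca x)).ne'
    simpa using this
  have hv := hs.hardy
  rw [hg, mul_zero, nonpos_iff_eq_zero, eLpNorm_eq_zero_iff hs.memLp.1 two_ne_zero] at hv
  filter_upwards [hv] with x hx
  have := (div_eq_zero_iff.1 hx).resolve_right (wt_ne x)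
  exact sub_eq_zero.1 this

/-- An identity with the test functions on the right extends to all of `H¹_w(ℝ³)` by density. -/
lemma form_eq_of_eq_on_test {a : E → ℝ} (ha : Measurable a) {C : ℝ} (hC : ∀ x, |a x| ≤ C)
    {g : E → E} (hg : MemLp g 2 volume) {F : PairSpace →L[ℝ] ℝ}
    (H : ∀ φ, ∀ hφ : IsTest φ, ∫ x, a x * inner ℝ (g x) (gradient φ x) = F hφ.hasWGrad.toPair)
    {w : E → ℝ} {k : E → E} (hw : HasWGrad w k) :
    ∫ x, a x * inner ℝ (g x) (k x) = F hw.toPair := by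
  have hb : MemLp (fun x => a x • g x) 2 volume := by
    refine hg.of_le_mul (c := C) (ha.aestronglyMeasurable.smul hg.1) (Eventually.of_forall fun x => ?_)
    rw [norm_smul]
    exact mul_le_mul_of_nonneg_right (hC x) (norm_nonneg _)
  have h0 : MemLp (fun _ : E => (0 : ℝ)) 2 volume := MemLp.zero
  have key : ∀ v l, ∀ h : HasWGrad v l,
      inner ℝ (mkPair h0 hb) h.toPair = ∫ x, a x * inner ℝ (g x) (l x) := by
    intro v l h
    rw [inner_toPair]
    simp [real_inner_smul_left]
  rw [← key w k hw]
  refine hw.eq_of_eq_on_test (F := fun ξ => inner ℝ (mkPair h0 hb) ξ) (by fun_prop) F.continuous ?_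
  intro φ hφ
  simp only [key]
  exact H φ hφ

/-- The weak formulation with arbitrary elements of `H¹_w(ℝ³)` in place of test functions. The integral
`∫ f φ` is replaced by its continuous extension `F`, since `f w` need not be integrable. -/
lemma isWeakSolution_iff {D : Set E} (hD : IsNiceDomain D) {αm αp : ℝ} {f u : E → ℝ}
    {F : PairSpace →L[ℝ] ℝ}
    (hF : ∀ φ, ∀ hφ : IsTest φ, F hφ.hasWGrad.toPair = ∫ x, f x * φ x) :
    IsWeakSolution D αm αp f u ↔ ∃ g, HasWGrad u g ∧ ∀ w k, ∀ hw : HasWGrad w k,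
      ∫ x, coeff D αm αp x * inner ℝ (g x) (k x) = F hw.toPair := by
  constructor
  · rintro ⟨hu, h⟩
    refine ⟨_, hu.hasWGrad hD, fun w k hw => ?_⟩
    refine form_eq_of_eq_on_test (measurable_coeff hD.isOpen.measurableSet αm αp)
      (abs_coeff_le D αm αp) (hu.hasWGrad hD).memLp_grad (fun φ hφ => ?_) hw
    rw [hF φ hφ, ← h φ hφ, hD.restrict_eq]
  · rintro ⟨g, hg, h⟩
    refine ⟨hg.memW hD, fun φ hφ => ?_⟩
    rw [hD.restrict_eq, ← hF φ hφ, ← h _ _ hφ.hasWGrad]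
    refine integral_congr_ae ?_
    filter_upwards [hg.pgrad_ae_eq hD] with x hx
    rw [hx]

/-- Existence and uniqueness of the solution of the transmission problem. -/
lemma exists_isWeakSolution {D : Set E} (hD : IsNiceDomain D) {αm αp : ℝ} (hαm : 0 < αm)
    (hαp : 0 < αp) {f : E → ℝ} {F : PairSpace →L[ℝ] ℝ}
    (hF : ∀ φ, ∀ hφ : IsTest φ, F hφ.hasWGrad.toPair = ∫ x, f x * φ x) :
    ∃ u, IsWeakSolution D αm αp f u ∧
      ∀ u', IsWeakSolution D αm αp f u' → u' =ᵐ[volume] u := by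
  have hc : 0 < min αm αp := lt_min hαm hαp
  have ha := measurable_coeff hD.isOpen.measurableSet αm αp
  obtain ⟨u, g, hu, h⟩ := exists_weak_solution ha hc (min_le_coeff D αm αp) (abs_coeff_le D αm αp) F
  refine ⟨u, (isWeakSolution_iff hD hF).2 ⟨g, hu, h⟩, fun u' hu' => ?_⟩
  obtain ⟨g', hg', h'⟩ := (isWeakSolution_iff hD hF).1 hu'
  refine hg'.ae_eq_of_form_eq ha hc (min_le_coeff D αm αp) (abs_coeff_le D αm αp) hu fun w k hw => ?_
  rw [h' w k hw, h w k hw]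

/-! ### The transmission problem on the fixed partition -/

/-- The matrix `A(ε, x)` where `V` is differentiable, hence almost everywhere; at the other points it
is the identity, because the derivative is then zero by convention. The bounds on `A` thus hold at
every point. -/
noncomputable def pertMat (V : E → E) (ε : ℝ) (x : E) : Matrix (Fin 3) (Fin 3) ℝ :=
  matCoef (ε • jacMat V x)

/-- The absolute value of the Jacobian determinant of `T^ε` where `V` is differentiable, and `1` at the
other points. -/
noncomputable def pertDet (V : E → E) (ε : ℝ) (x : E) : ℝ := detCoef (ε • jacMat V x)

lemma measurable_pertDet (V : E → E) (ε : ℝ) : Measurable (pertDet V ε) :=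
  measurable_detCoef.comp ((measurable_jacMat V).const_smul ε)

lemma measurable_pertMat (V : E → E) (ε : ℝ) (i j : Fin 3) :
    Measurable fun x => pertMat V ε x i j :=
  (measurable_matCoef i j).comp ((measurable_jacMat V).const_smul ε)

lemma pertDet_of_notMem {V : E → E} {ε : ℝ} {x : E} (hx : x ∉ tsupport V) : pertDet V ε x = 1 := by
  have h : jacMat V x = 0 := by
    funext i j
    simp [jacMat, fderiv_of_notMem_tsupport hx]
  rw [pertDet, h, smul_zero, detCoef_zero]

/-- The change of variables in the energy form. -/
lemma integral_matForm_pullGrad {V : E → E} {L : NNReal} (hV : LipschitzWith L V) {ε : ℝ}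
    {T : E ≃ₜ E} (hT : (T : E → E) = perturbMap V ε) {K : NNReal} (hbi : IsBiLipschitz T K)
    (hdet : ∀ x, pertDet V ε x ≠ 0) (D : Set E) (αm αp : ℝ) (g h : E → E) :
    ∫ x, coeff D αm αp x * matForm (pertMat V ε x) (pullGrad T g x) (pullGrad T h x)
      = ∫ x, coeff (T '' D) αm αp x * inner ℝ (g x) (h x) := by
  rw [hbi.integral_eq fun x => coeff (T '' D) αm αp x * inner ℝ (g x) (h x)]
  have hdiff : ∀ᵐ x ∂volume, DifferentiableAt ℝ V x := hV.ae_differentiableAt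
  refine integral_congr_ae ?_
  filter_upwards [hdiff] with x hx
  have e1 : coeff (T '' D) αm αp (T x) = coeff D αm αp x := by
    by_cases h : x ∈ D
    · rw [coeff, coeff, if_pos (mem_image_of_mem T h), if_pos h]
    · rw [coeff, coeff, if_neg (mt T.injective.mem_set_image.1 h), if_neg h]
  have e2 : |(fderiv ℝ T x).det| = |(jacobian V ε x).det| := by
    rw [hT, abs_det_fderiv_perturbMap hx, jacobian_eq hx, detCoef]
  have h0 : (jacobian V ε x).det ≠ 0 := by
    rw [jacobian_eq hx]
    exact abs_ne_zero.1 (hdet x)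
  rw [e1, e2, pertMat, ← matA_eq hx, hT, matForm_matA_pullGrad h0]
  ring

/-- The right-hand side of the transmission problem after the change of variables: only the support
of the velocity field contributes to the difference. -/
lemma functional_comp_symm {V : E → E} {L : NNReal} (hV : LipschitzWith L V)
    (hVc : HasCompactSupport V) {ε : ℝ} {T : E ≃ₜ E} (hT : (T : E → E) = perturbMap V ε)
    {K : NNReal} (hbi : IsBiLipschitz T K) {f : E → ℝ} (hf : MemLp f 2 volume)
    {F : PairSpace →L[ℝ] ℝ} (hF : ∀ φ, ∀ hφ : IsTest φ, F hφ.hasWGrad.toPair = ∫ x, f x * φ x)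
    {w : E → ℝ} {k : E → E} (hw : HasWGrad w k) :
    F (hw.comp hbi.symm).toPair
      = F hw.toPair + ∫ x, (pertDet V ε x * f (T x) - f x) * w x := by
  set S := tsupport V with hS
  have hSm : MeasurableSet S := (isClosed_tsupport V).measurableSet
  have hTS : ∀ x, T x ∈ S ↔ x ∈ S := by
    refine fun x => ⟨fun h => ?_, apply_mem_tsupport hT⟩
    by_contra hx
    rw [hT, perturbMap_of_notMem hx] at h
    exact hx h
  have hTfix : ∀ x ∉ S, T x = x := fun x hx => by rw [hT, perturbMap_of_notMem hx]
  have hTfix' : ∀ x ∉ S, T.symm x = x := fun x hx => by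
    rw [T.symm_apply_eq, hTfix x hx]
  set hs := (hw.comp hbi.symm).sub hw
  have hc : HasCompactSupport fun x => w (T.symm x) - w x := by
    refine HasCompactSupport.of_support_subset_isCompact hVc.isCompact fun x hx => ?_
    by_contra h
    exact hx (by simp only [hTfix' x h, sub_self])
  have h1 := functional_eq_integral hf hF hs hc
  rw [HasWGrad.toPair_sub (hw.comp hbi.symm) hw, map_sub] at h1
  have h2 : F (hw.comp hbi.symm).toPair
      = F hw.toPair + ∫ x, f x * (w (T.symm x) - w x) := by linarith
  rw [h2, add_right_inj]
  -- Both integrands vanish off the support of the velocity field.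
  have hL : ∀ v, ∀ l, HasWGrad v l → IntegrableOn (fun x => f x * v x) S := fun v l h =>
    MemLp.integrable_mul (hf.restrict S)
      (memLp_of_memLp_div_wt hVc.isCompact.isBounded (h.memLp.restrict S))
  have e1 : ∫ x, f x * (w (T.symm x) - w x)
      = (∫ x in S, f x * w (T.symm x)) - ∫ x in S, f x * w x := by
    rw [← integral_sub (hL _ _ (hw.comp hbi.symm)) (hL _ _ hw),
      ← setIntegral_eq_integral_of_forall_compl_eq_zero (s := S)]
    · exact integral_congr_ae (Eventually.of_forall fun x => mul_sub _ _ _)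
    · intro x hx
      rw [hTfix' x hx, sub_self, mul_zero]
  have e2 : ∫ x in S, f x * w (T.symm x) = ∫ x in S, pertDet V ε x * f (T x) * w x := by
    rw [← integral_indicator hSm, hbi.integral_eq, ← integral_indicator hSm]
    have hdiff : ∀ᵐ x ∂volume, DifferentiableAt ℝ V x := hV.ae_differentiableAt
    refine integral_congr_ae ?_
    filter_upwards [hdiff] with x hx
    by_cases h : x ∈ S
    · rw [indicator_of_mem h, indicator_of_mem ((hTS x).2 h), T.symm_apply_apply, hT,
        abs_det_fderiv_perturbMap hx, pertDet, mul_assoc]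
    · rw [indicator_of_notMem h, indicator_of_notMem (mt (hTS x).1 h), mul_zero]
  have i2 : IntegrableOn (fun x => pertDet V ε x * f (T x) * w x) S := by
    have hb : ∃ M : ℝ, ∀ x, ‖pertDet V ε x‖ ≤ M := by
      have hcpt : IsCompact (Metric.closedBall (0 : Fin 3 → Fin 3 → ℝ) (|ε| * L)) :=
        isCompact_closedBall _ _
      obtain ⟨M, hM⟩ := hcpt.exists_bound_of_continuousOn (f := detCoef)
        contDiff_det_one_add.continuous.abs.continuousOn
      refine ⟨M, fun x => hM _ ?_⟩
      rw [mem_closedBall_zero_iff, norm_smul, Real.norm_eq_abs]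
      exact mul_le_mul_of_nonneg_left (norm_jacMat_le hV x) (abs_nonneg ε)
    obtain ⟨M, hM⟩ := hb
    have h3 : MemLp (fun x => pertDet V ε x * f (T x)) 2 volume := by
      refine (hbi.memLp_comp hf).of_le_mul (c := M)
        ((measurable_pertDet V ε).aestronglyMeasurable.mul (hbi.memLp_comp hf).1)
        (Eventually.of_forall fun x => ?_)
      rw [norm_mul]
      exact mul_le_mul_of_nonneg_right (hM x) (norm_nonneg _)
    exact MemLp.integrable_mul (h3.restrict S)
      (memLp_of_memLp_div_wt hVc.isCompact.isBounded (hw.memLp.restrict S))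
  rw [e1, e2, ← integral_sub i2 (hL _ _ hw)]
  refine Eq.trans (integral_congr_ae (Eventually.of_forall fun x => (sub_mul _ _ _).symm))
    (setIntegral_eq_integral_of_forall_compl_eq_zero fun x hx => ?_)
  rw [hTfix x hx, pertDet_of_notMem hx, one_mul, sub_self, zero_mul]

/-- The equation solved by `u^ε ∘ T^ε` on the unperturbed partition, obtained by testing the equation
for `u^ε` with `w ∘ (T^ε)⁻¹`. -/
lemma transformed_equation {V : E → E} {L : NNReal} (hV : LipschitzWith L V)
    (hVc : HasCompactSupport V) {ε : ℝ} {T : E ≃ₜ E} (hT : (T : E → E) = perturbMap V ε)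
    {K : NNReal} (hbi : IsBiLipschitz T K) (hdet : ∀ x, pertDet V ε x ≠ 0) {f : E → ℝ}
    (hf : MemLp f 2 volume) {F : PairSpace →L[ℝ] ℝ}
    (hF : ∀ φ, ∀ hφ : IsTest φ, F hφ.hasWGrad.toPair = ∫ x, f x * φ x)
    {D : Set E} {αm αp : ℝ} {g : E → E}
    (hg : ∀ w k, ∀ hw : HasWGrad w k,
      ∫ x, coeff (T '' D) αm αp x * inner ℝ (g x) (k x) = F hw.toPair)
    {w : E → ℝ} {k : E → E} (hw : HasWGrad w k) :
    ∫ x, coeff D αm αp x * matForm (pertMat V ε x) (pullGrad T g x) (k x)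
      = F hw.toPair + ∫ x, (pertDet V ε x * f (T x) - f x) * w x := by
  rw [← functional_comp_symm hV hVc hT hbi hf hF hw, ← hg _ _ (hw.comp hbi.symm),
    ← integral_matForm_pullGrad hV hT hbi hdet]
  have e := hw.ae_eq ((hw.comp hbi.symm).comp hbi)
    (Eventually.of_forall fun x => by simp only [T.symm_apply_apply])
  refine integral_congr_ae ?_
  filter_upwards [e] with x hx
  rw [← hx]

/-- The expansion `γ = 1 + ε div V + o(ε)` of the Jacobian determinant, uniformly in space. -/
lemma eventually_pertDet {V : E → E} {L : NNReal} (hV : LipschitzWith L V) {η : ℝ} (hη : 0 < η) :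
    ∀ᶠ ε : ℝ in 𝓝[>] 0, ∀ x, |pertDet V ε x - 1| ≤ η ∧
      |ε⁻¹ * (pertDet V ε x - 1) - divergence V x| ≤ η := by
  filter_upwards [eventually_abs_sub_le differentiableAt_detCoef.continuousAt L hη,
    eventually_abs_quotient_sub_le differentiableAt_detCoef L.2 hη] with ε h1 h2 x
  have a := h1 _ (norm_jacMat_le hV x)
  have b := h2 _ (norm_jacMat_le hV x)
  rw [detCoef_zero] at a b
  rw [fderiv_detCoef_zero] at b
  exact ⟨a, b⟩

/-- The expansion `A = 1 + ε A'(0) + o(ε)`, uniformly in space. -/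
lemma eventually_pertMat {V : E → E} {L : NNReal} (hV : LipschitzWith L V) {η : ℝ} (hη : 0 < η) :
    ∀ᶠ ε : ℝ in 𝓝[>] 0, ∀ x i j, |(pertMat V ε x - 1) i j| ≤ η ∧
      |(ε⁻¹ • (pertMat V ε x - 1) - matCoefDeriv (jacMat V x)) i j| ≤ η := by
  have h : ∀ i j, ∀ᶠ ε : ℝ in 𝓝[>] 0, ∀ x, |(pertMat V ε x - 1) i j| ≤ η ∧
      |(ε⁻¹ • (pertMat V ε x - 1) - matCoefDeriv (jacMat V x)) i j| ≤ η := by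
    intro i j
    filter_upwards [eventually_abs_sub_le (differentiableAt_matCoef i j).continuousAt L hη,
      eventually_abs_quotient_sub_le (differentiableAt_matCoef i j) L.2 hη] with ε h1 h2 x
    have a := h1 _ (norm_jacMat_le hV x)
    have b := h2 _ (norm_jacMat_le hV x)
    rw [matCoef_zero] at a b
    exact ⟨a, b⟩
  filter_upwards [eventually_all.2 fun i => eventually_all.2 fun j => h i j] with ε hε x i j
  exact hε i j x

lemma HasWGrad.integrable_mul {s : E → ℝ} (hs : MemLp (fun x => wt x * s x) 2 volume) {w : E → ℝ}
    {k : E → E} (hw : HasWGrad w k) : Integrable (fun x => s x * w x) volume := by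
  refine (MemLp.integrable_mul hs hw.memLp).congr (Eventually.of_forall fun x => ?_)
  simp only [Pi.mul_apply]
  field_simp [wt_ne x]

/-- The difference quotients of the transformed right-hand side converge to `div (f V)`. -/
lemma HasWGrad.eventually_rhs_le {V : E → E} {L : NNReal} (hV : LipschitzWith L V)
    (hVc : HasCompactSupport V) {f : E → ℝ} {g : E → E} (h : HasWGrad f g)
    (hf : MemLp f 2 volume) {η : ℝ} (hη : 0 < η) :
    ∀ᶠ ε : ℝ in 𝓝[>] 0, ∀ w k, HasWGrad w k →
      |ε⁻¹ * (∫ x, (pertDet V ε x * f (perturbMap V ε x) - f x) * w x) - ∫ x, divMul V f g x * w x|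
        ≤ η * (eLpNorm k 2 volume).toReal := by
  obtain ⟨B, hB⟩ := hV.continuous.bounded_above_of_compact_support hVc
  obtain ⟨M, hM⟩ := hVc.isCompact.exists_bound_of_continuousOn continuous_wt.continuousOn
  have hB0 : 0 ≤ B := (norm_nonneg _).trans (hB 0)
  -- The part of the difference that carries the determinant is dominated by `m`.
  set m : E → ℝ := fun x => B * ‖g x‖ + |f x| with hm
  have hmL : MemLp m 2 volume := (h.memLp_grad.norm.const_mul B).add hf.norm
  set N := (eLpNorm m 2 volume).toReal with hN
  have hN0 : 0 ≤ N := ENNReal.toReal_nonneg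
  set θ : ℝ := η / (4 * (|M| + 1) * (N + 2)) with hθ
  have hθ0 : 0 < θ := by positivity
  have hq := (h.tendsto_difference_quotient hV hVc).eventually
    (ge_mem_nhds (show (0 : ENNReal) < ENNReal.ofReal θ by simpa using hθ0))
  filter_upwards [hq, eventually_pertDet hV hθ0, eventually_pertDet hV one_pos,
    eventually_mul_le (L := L)] with ε h1 h2 h3 h4 w k hw
  obtain ⟨T, hT, hbi⟩ := exists_homeomorph_perturbMap hV h4.1.le h4.2
  set q : E → ℝ := fun x => ε⁻¹ * (f (perturbMap V ε x) - f x) - inner ℝ (g x) (V x) with hqdef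
  set s : E → ℝ := fun x =>
    ε⁻¹ * (pertDet V ε x * f (perturbMap V ε x) - f x) - divMul V f g x with hs
  have hqm : AEStronglyMeasurable q volume := by
    have a1 := (hbi.memLp_comp hf).1
    rw [hT] at a1
    exact ((a1.sub hf.1).const_mul _).sub (h.memLp_grad.1.inner hV.continuous.aestronglyMeasurable)
  have hqL : MemLp q 2 volume := ⟨hqm, h1.trans_lt ENNReal.ofReal_lt_top⟩
  have hsb : ∀ x, ‖wt x * s x‖ ≤ (|M| + 1) * (2 * ‖q x‖ + θ * m x) := by
    intro x
    by_cases hx : x ∈ tsupport V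
    · have e : s x = pertDet V ε x * q x + (pertDet V ε x - 1) * inner ℝ (g x) (V x)
          + (ε⁻¹ * (pertDet V ε x - 1) - divergence V x) * f x := by
        simp only [hs, hqdef, divMul]
        ring
      have b1 : |pertDet V ε x| ≤ 2 := by
        have := (h3 x).1
        rw [abs_le] at this ⊢
        constructor <;> linarith [this.1, this.2]
      have b2 : |inner ℝ (g x) (V x)| ≤ B * ‖g x‖ := by
        refine (abs_real_inner_le_norm _ _).trans ?_
        rw [mul_comm]
        exact mul_le_mul_of_nonneg_right (hB x) (norm_nonneg _)
      have b3 : |s x| ≤ 2 * ‖q x‖ + θ * m x := by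
        rw [e]
        refine (abs_add_three _ _ _).trans ?_
        rw [abs_mul, abs_mul, abs_mul]
        have c1 := mul_le_mul_of_nonneg_right b1 (abs_nonneg (q x))
        have c2 := mul_le_mul (h2 x).1 b2 (abs_nonneg _) hθ0.le
        have c3 := mul_le_mul_of_nonneg_right (h2 x).2 (abs_nonneg (f x))
        rw [Real.norm_eq_abs]
        simp only [hm]
        linarith
      rw [norm_mul, Real.norm_eq_abs (s x)]
      refine mul_le_mul ?_ b3 (abs_nonneg _) (by positivity)
      exact (hM x hx).trans ((le_abs_self M).trans (by linarith))
    -- Off the support of `V` the map is the identity and the determinant is `1`.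
    · have e : s x = 0 := by
        simp only [hs, divMul]
        rw [pertDet_of_notMem hx, perturbMap_of_notMem hx, divergence_of_notMem hx,
          image_eq_zero_of_notMem_tsupport hx]
        simp
      rw [e, mul_zero, norm_zero]
      positivity
  have hsm : AEStronglyMeasurable (fun x => wt x * s x) volume := by
    have a1 := (hbi.memLp_comp hf).1
    rw [hT] at a1
    have a2 : AEStronglyMeasurable (divMul V f g) volume :=
      (h.locallyIntegrable_divMul hV hVc).aestronglyMeasurable
    exact continuous_wt.aestronglyMeasurable.mul
      (((((measurable_pertDet V ε).aestronglyMeasurable.mul a1).sub hf.1).const_mul _).sub a2)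
  have hdom : MemLp (fun x => (|M| + 1) * (2 * ‖q x‖ + θ * m x)) 2 volume :=
    ((hqL.norm.const_mul 2).add (hmL.const_mul θ)).const_mul _
  have hsL : MemLp (fun x => wt x * s x) 2 volume :=
    hdom.of_le hsm (Eventually.of_forall fun x => (hsb x).trans (le_abs_self _))
  have hsn : (eLpNorm (fun x => wt x * s x) 2 volume).toReal ≤ (|M| + 1) * (2 * θ + θ * N) := by
    have a1 : eLpNorm (fun x => wt x * s x) 2 volume
        ≤ ENNReal.ofReal ((|M| + 1) * (2 * θ + θ * N)) := by
      calc eLpNorm (fun x => wt x * s x) 2 volume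
          ≤ ENNReal.ofReal (|M| + 1) * eLpNorm (fun x => 2 * ‖q x‖ + θ * m x) 2 volume := by
            refine eLpNorm_le_mul_eLpNorm_of_ae_le_mul (Eventually.of_forall fun x => ?_) 2
            refine (hsb x).trans (mul_le_mul_of_nonneg_left (le_abs_self _) (by positivity))
        _ ≤ ENNReal.ofReal (|M| + 1) *
            (ENNReal.ofReal 2 * ENNReal.ofReal θ + ENNReal.ofReal θ * ENNReal.ofReal N) := by
            gcongr
            refine (eLpNorm_add_le (hqL.norm.const_mul 2).1 (hmL.const_mul θ).1
              (by norm_num)).trans (add_le_add ?_ ?_)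
            · refine (eLpNorm_le_mul_eLpNorm_of_ae_le_mul (g := q) (c := 2)
                (Eventually.of_forall fun x => by simp) 2).trans ?_
              gcongr
            · refine (eLpNorm_le_mul_eLpNorm_of_ae_le_mul (g := m) (c := θ)
                (Eventually.of_forall fun x => by
                  rw [norm_mul, Real.norm_of_nonneg hθ0.le]) 2).trans ?_
              rw [hN, ENNReal.ofReal_toReal hmL.2.ne]
        _ = ENNReal.ofReal ((|M| + 1) * (2 * θ + θ * N)) := by
            rw [← ENNReal.ofReal_mul (by norm_num), ← ENNReal.ofReal_mul hθ0.le,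
              ← ENNReal.ofReal_add (by positivity) (by positivity),
              ← ENNReal.ofReal_mul (by positivity)]
    exact ENNReal.toReal_le_of_le_ofReal (by positivity) a1
  have hH := ENNReal.toReal_mono (ENNReal.mul_ne_top (by simp) hw.memLp_grad.2.ne) hw.hardy
  rw [ENNReal.toReal_mul, ENNReal.toReal_ofNat] at hH
  have hsplit : ε⁻¹ * (∫ x, (pertDet V ε x * f (perturbMap V ε x) - f x) * w x)
      = (∫ x, s x * w x) + ∫ x, divMul V f g x * w x := by
    rw [← integral_add (hw.integrable_mul hsL) (hw.integrable_mul (h.memLp_divMul hV hVc)),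
      ← integral_const_mul]
    refine integral_congr_ae (Eventually.of_forall fun x => ?_)
    simp only [hs]
    ring
  rw [hsplit, add_sub_cancel_right]
  calc |∫ x, s x * w x| ≤ ∫ x, |s x * w x| := abs_integral_le_integral_abs
    _ = ∫ x, ‖wt x * s x‖ * ‖w x / wt x‖ := by
        refine integral_congr_ae (Eventually.of_forall fun x => ?_)
        simp only [← norm_mul, ← Real.norm_eq_abs]
        congr 1
        field_simp [wt_ne x]
    _ ≤ (eLpNorm (fun x => wt x * s x) 2 volume).toReal
          * (eLpNorm (fun x => w x / wt x) 2 volume).toReal :=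
        integral_norm_mul_norm_le hsL hw.memLp
    _ ≤ (|M| + 1) * (2 * θ + θ * N) * (2 * (eLpNorm k 2 volume).toReal) :=
        mul_le_mul hsn hH ENNReal.toReal_nonneg (by positivity)
    _ ≤ η * (eLpNorm k 2 volume).toReal := by
        have e : (|M| + 1) * (2 * θ + θ * N) * (2 * (eLpNorm k 2 volume).toReal)
            = (η / 2) * (eLpNorm k 2 volume).toReal := by
          rw [hθ]
          field_simp
          ring
        rw [e]
        exact mul_le_mul_of_nonneg_right (by linarith) ENNReal.toReal_nonneg

/-! ### The problem for the material derivative -/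

lemma measurable_matCoefDeriv_jacMat (V : E → E) (i j : Fin 3) :
    Measurable fun x => matCoefDeriv (jacMat V x) i j :=
  (fderiv ℝ (fun N => matCoef N i j) 0).continuous.measurable.comp (measurable_jacMat V)

lemma exists_matCoefDeriv_le {V : E → E} {L : NNReal} (hV : LipschitzWith L V) :
    ∃ c : ℝ, ∀ x i j, |matCoefDeriv (jacMat V x) i j| ≤ c := by
  set Q : Fin 3 → Fin 3 → ((Fin 3 → Fin 3 → ℝ) →L[ℝ] ℝ) :=
    fun i j => fderiv ℝ (fun N => matCoef N i j) 0
  refine ⟨‖Q‖ * L, fun x i j => ?_⟩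
  calc |matCoefDeriv (jacMat V x) i j| ≤ ‖Q i j‖ * ‖jacMat V x‖ := (Q i j).le_opNorm _
    _ ≤ ‖Q‖ * L := mul_le_mul ((norm_le_pi_norm (Q i) j).trans (norm_le_pi_norm Q i))
        (norm_jacMat_le hV x) (norm_nonneg _) (norm_nonneg _)

/-- The form of a bounded matrix field is represented by a square integrable vector field. -/
lemma exists_memLp_inner_eq_matForm {a : E → ℝ} (ha : Measurable a) {C : ℝ} (hC : ∀ x, |a x| ≤ C)
    {B : E → Matrix (Fin 3) (Fin 3) ℝ} (hB : ∀ i j, Measurable fun x => B x i j) {c : ℝ}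
    (hBc : ∀ x i j, |B x i j| ≤ c) {g : E → E} (hg : MemLp g 2 volume) :
    ∃ b : E → E, MemLp b 2 volume ∧ ∀ x l, inner ℝ (b x) l = a x * matForm (B x) (g x) l := by
  have hC0 : 0 ≤ C := (abs_nonneg _).trans (hC 0)
  have hs : ∀ i j, MemLp (fun x => (a x * (g x i * B x i j)) •
      (EuclideanSpace.single j (1 : ℝ) : E)) 2 volume := by
    intro i j
    refine hg.of_le_mul (c := C * c) ((ha.aestronglyMeasurable.mul
      (((EuclideanSpace.proj i : E →L[ℝ] ℝ).continuous.comp_aestronglyMeasurable hg.1).mul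
        (hB i j).aestronglyMeasurable)).smul aestronglyMeasurable_const)
      (Eventually.of_forall fun x => ?_)
    rw [norm_smul, PiLp.norm_single, norm_one, mul_one, norm_mul, norm_mul]
    have h1 : ‖g x i‖ ≤ ‖g x‖ := PiLp.norm_apply_le _ i
    have h2 := hC x
    have h3 := hBc x i j
    have h4 : ‖g x i‖ * ‖B x i j‖ ≤ ‖g x‖ * c :=
      mul_le_mul h1 h3 (norm_nonneg _) (norm_nonneg _)
    calc ‖a x‖ * (‖g x i‖ * ‖B x i j‖) ≤ C * (‖g x‖ * c) :=
          mul_le_mul h2 h4 (by positivity) hC0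
      _ = C * c * ‖g x‖ := by ring
  refine ⟨fun x => ∑ i, ∑ j, (a x * (g x i * B x i j)) • (EuclideanSpace.single j (1 : ℝ) : E),
    memLp_finsetSum _ fun i _ => memLp_finsetSum _ fun j _ => hs i j, fun x l => ?_⟩
  simp only [sum_inner, real_inner_smul_left, EuclideanSpace.inner_single_left, matForm,
    Finset.mul_sum, map_one, one_mul]
  refine Finset.sum_congr rfl fun i _ => Finset.sum_congr rfl fun j _ => ?_
  ring

/-- The problem for the derivative in terms of `H¹_w(ℝ³)`, with almost everywhere equal representatives
of `A'(0)` and of the distributional divergence of `f V`. -/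
lemma solvesDerivativeProblem_iff {D : Set E} (hD : IsNiceDomain D) {αm αp : ℝ} {V : E → E}
    {L : NNReal} (hV : LipschitzWith L V) (hVc : HasCompactSupport V) {f : E → ℝ} {gf : E → E}
    (hf : HasWGrad f gf) {u z : E → ℝ} {g : E → E} (hu : HasWGrad u g) :
    SolvesDerivativeProblem D αm αp V f u z ↔ ∃ gz, HasWGrad z gz ∧ ∀ w k, HasWGrad w k →
      ∫ x, coeff D αm αp x * inner ℝ (gz x) (k x) =
        -(∫ x, coeff D αm αp x * matForm (matCoefDeriv (jacMat V x)) (g x) (k x))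
          + ∫ x, divMul V f gf x * w x := by
  have hdiff : ∀ᵐ x ∂volume, DifferentiableAt ℝ V x := hV.ae_differentiableAt
  have e1 : ∀ gz z w k, HasWGrad z gz → HasWGrad w k →
      ∫ x, coeff D αm αp x * inner ℝ (pgrad D z x) (pgrad D w x)
        = ∫ x, coeff D αm αp x * inner ℝ (gz x) (k x) := by
    intro gz z w k hz hw
    refine integral_congr_ae ?_
    filter_upwards [hz.pgrad_ae_eq hD, hw.pgrad_ae_eq hD] with x h1 h2
    rw [h1, h2]
  have e2 : ∀ w k, HasWGrad w k → ∫ x, coeff D αm αp x *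
        ∑ i, ∑ j, pgrad D u x i * matA' V x i j * pgrad D w x j
      = ∫ x, coeff D αm αp x * matForm (matCoefDeriv (jacMat V x)) (g x) (k x) := by
    intro w k hw
    refine integral_congr_ae ?_
    filter_upwards [hu.pgrad_ae_eq hD, hw.pgrad_ae_eq hD, hdiff] with x h1 h2 h3
    rw [h1, h2, matA'_eq h3, matForm]
  have e3 : ∀ w : E → ℝ, ∫ x, weakDiv (fun y => f y • V y) x * w x
      = ∫ x, divMul V f gf x * w x := by
    intro w
    refine integral_congr_ae ?_
    filter_upwards [hf.weakDiv_ae_eq hV hVc] with x h1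
    rw [h1]
  unfold SolvesDerivativeProblem
  rw [hD.restrict_eq]
  constructor
  · rintro ⟨hz, h⟩
    refine ⟨_, hz.hasWGrad hD, fun w k hw => ?_⟩
    rw [← e1 _ _ _ _ (hz.hasWGrad hD) hw, ← e2 w k hw, ← e3 w]
    exact h w (hw.memW hD)
  · rintro ⟨gz, hz, h⟩
    refine ⟨hz.memW hD, fun w hw => ?_⟩
    have hw' := hw.hasWGrad hD
    rw [e1 _ _ _ _ hz hw', e2 w _ hw', e3 w]
    exact h w _ hw'

/-- Existence and uniqueness for the problem satisfied by the derivative. -/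
lemma exists_solvesDerivativeProblem {D : Set E} (hD : IsNiceDomain D) {αm αp : ℝ} (hαm : 0 < αm)
    (hαp : 0 < αp) {V : E → E} {L : NNReal} (hV : LipschitzWith L V) (hVc : HasCompactSupport V)
    {f : E → ℝ} {gf : E → E} (hf : HasWGrad f gf) {u : E → ℝ} {g : E → E} (hu : HasWGrad u g) :
    ∃ z, SolvesDerivativeProblem D αm αp V f u z ∧
      ∀ z', SolvesDerivativeProblem D αm αp V f u z' → z' =ᵐ[volume] z := by
  have hc : 0 < min αm αp := lt_min hαm hαp
  have ha := measurable_coeff hD.isOpen.measurableSet αm αp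
  obtain ⟨c, hcB⟩ := exists_matCoefDeriv_le hV
  obtain ⟨b, hb, hbe⟩ := exists_memLp_inner_eq_matForm ha (abs_coeff_le D αm αp)
    (measurable_matCoefDeriv_jacMat V) hcB hu.memLp_grad
  obtain ⟨z, gz, hz, hze⟩ := exists_weak_solution ha hc (min_le_coeff D αm αp)
    (abs_coeff_le D αm αp) (innerSL ℝ (mkPair (hf.memLp_divMul hV hVc) hb.neg))
  have hz' : ∀ w k, HasWGrad w k → ∫ x, coeff D αm αp x * inner ℝ (gz x) (k x) =
        -(∫ x, coeff D αm αp x * matForm (matCoefDeriv (jacMat V x)) (g x) (k x))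
          + ∫ x, divMul V f gf x * w x := by
    intro w k hw
    rw [hze w k hw, innerSL_apply_apply, inner_toPair, add_comm]
    congr 1
    · rw [← integral_neg]
      refine integral_congr_ae (Eventually.of_forall fun x => ?_)
      simp only [Pi.neg_apply, inner_neg_left, hbe]
    · refine integral_congr_ae (Eventually.of_forall fun x => ?_)
      simp only
      field_simp [wt_ne x]
  refine ⟨z, (solvesDerivativeProblem_iff hD hV hVc hf hu).2 ⟨gz, hz, hz'⟩, fun z' h => ?_⟩
  obtain ⟨g', hg', h'⟩ := (solvesDerivativeProblem_iff hD hV hVc hf hu).1 h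
  refine hg'.ae_eq_of_form_eq ha hc (min_le_coeff D αm αp) (abs_coeff_le D αm αp) hz fun w k hw => ?_
  rw [h' w k hw, hz' w k hw]

/-! ### Convergence of the difference quotients -/

/-- The energy estimate for the error `k` of the difference quotient: if `A - 1` and the error of the
expansion of `A` are at most `η`, and `ρ` bounds the consistency error of the equation, then `k` is
bounded by `ρ` and `η`. -/
lemma norm_quotient_error_le {a : E → ℝ} (ha : Measurable a) {c C : ℝ} (hc : 0 ≤ c)
    (hca : ∀ x, c ≤ a x)
    (hC : ∀ x, |a x| ≤ C) {A A' : E → Matrix (Fin 3) (Fin 3) ℝ}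
    (hA : ∀ i j, Measurable fun x => A x i j) (hA' : ∀ i j, Measurable fun x => A' x i j)
    {ε η c' : ℝ} (hη : η ≤ 1 / 18) (h1 : ∀ x i j, |(A x - 1) i j| ≤ η)
    (h2 : ∀ x i j, |(ε⁻¹ • (A x - 1) - A' x) i j| ≤ η) (hc' : ∀ x i j, |A' x i j| ≤ c')
    {G g₀ gz : E → E} (hG : MemLp G 2 volume) (hg₀ : MemLp g₀ 2 volume) (hgz : MemLp gz 2 volume)
    {k : E → E} (hk : ∀ x, k x = ε⁻¹ • (G x - g₀ x) - gz x) {ρ : ℝ}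
    (H : ε⁻¹ * ((∫ x, a x * matForm (A x) (G x) (k x)) - ∫ x, a x * inner ℝ (g₀ x) (k x))
      - (∫ x, a x * inner ℝ (gz x) (k x)) - (∫ x, a x * matForm (A' x) (g₀ x) (k x))
        ≤ ρ * (eLpNorm k 2 volume).toReal) (hρ : 0 ≤ ρ) :
    c / 2 * (eLpNorm k 2 volume).toReal ≤
      ρ + C * (9 * η) * ((eLpNorm g₀ 2 volume).toReal + (eLpNorm gz 2 volume).toReal) := by
  have hkL : MemLp k 2 volume :=
    (((hG.sub hg₀).const_smul ε⁻¹).sub hgz).ae_eq (Eventually.of_forall fun x => (hk x).symm)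
  have hC0 : 0 ≤ C := (abs_nonneg _).trans (hC 0)
  have hη0 : 0 ≤ η := (abs_nonneg _).trans (h1 0 0 0)
  have hm1 : ∀ i j, Measurable fun x => (A x - 1) i j := fun i j => (hA i j).sub_const _
  have hm2 : ∀ i j, Measurable fun x => (ε⁻¹ • (A x - 1) - A' x) i j := fun i j =>
    (((hA i j).sub_const _).const_mul _).sub (hA' i j)
  have hAb : ∀ x i j, |A x i j| ≤ η + 1 := by
    intro x i j
    have b1 := h1 x i j
    rw [Matrix.sub_apply] at b1
    have b2 : |(1 : Matrix (Fin 3) (Fin 3) ℝ) i j| ≤ 1 := by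
      rw [Matrix.one_apply]
      split_ifs <;> norm_num
    calc |A x i j| = |(A x i j - (1 : Matrix (Fin 3) (Fin 3) ℝ) i j)
          + (1 : Matrix (Fin 3) (Fin 3) ℝ) i j| := by rw [sub_add_cancel]
      _ ≤ η + 1 := (abs_add_le _ _).trans (add_le_add b1 b2)
  have iG := integrable_coeff_matForm ha hC hA hAb hG hkL
  have iA := integrable_coeff_matForm ha hC hA hAb hkL hkL
  have i0 := integrable_coeff_inner ha hC hg₀ hkL
  have iz := integrable_coeff_inner ha hC hgz hkL
  have i' := integrable_coeff_matForm ha hC hA' hc' hg₀ hkL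
  have iB := integrable_coeff_matForm ha hC hm2 h2 hg₀ hkL
  have i1 := integrable_coeff_matForm ha hC hm1 h1 hgz hkL
  -- The equation for the error: `A k` is `ε⁻¹ (A G - g₀) - gz - A' g₀`, up to the errors of the
  -- expansion of `A`.
  have key : ∫ x, a x * matForm (A x) (k x) (k x)
      = (ε⁻¹ * ((∫ x, a x * matForm (A x) (G x) (k x)) - ∫ x, a x * inner ℝ (g₀ x) (k x))
        - (∫ x, a x * inner ℝ (gz x) (k x)) - (∫ x, a x * matForm (A' x) (g₀ x) (k x)))
        - (∫ x, a x * matForm (ε⁻¹ • (A x - 1) - A' x) (g₀ x) (k x))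
        - ∫ x, a x * matForm (A x - 1) (gz x) (k x) := by
    have j1 : Integrable (fun x => ε⁻¹ * (a x * matForm (A x) (G x) (k x)
      - a x * inner ℝ (g₀ x) (k x))) volume := (iG.sub i0).const_mul _
    have j2 := j1.sub iz
    have j3 := j2.sub i'
    have j4 := j3.sub iB
    simp only [Pi.sub_def] at j2 j3 j4
    rw [← integral_sub iG i0, ← integral_const_mul, ← integral_sub j1 iz, ← integral_sub j2 i',
      ← integral_sub j3 iB, ← integral_sub j4 i1]
    refine integral_congr_ae (Eventually.of_forall fun x => ?_)
    have e : matForm (A x) (k x) (k x) = ε⁻¹ * (matForm (A x) (G x) (k x)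
        - matForm (A x) (g₀ x) (k x)) - matForm (A x) (gz x) (k x) := by
      have hk' : k x = ε⁻¹ • (G x + (-1 : ℝ) • g₀ x) + (-1 : ℝ) • gz x := by
        rw [hk x]
        module
      conv_lhs => rw [show matForm (A x) (k x) (k x)
        = matForm (A x) (ε⁻¹ • (G x + (-1 : ℝ) • g₀ x) + (-1 : ℝ) • gz x) (k x) by rw [← hk']]
      rw [matForm_add_left, matForm_smul_left, matForm_add_left, matForm_smul_left,
        matForm_smul_left]
      ring
    simp only [e, matForm_sub, matForm_smul, matForm_one]
    ring
  have lower : c / 2 * (eLpNorm k 2 volume).toReal ^ 2 ≤ ∫ x, a x * matForm (A x) (k x) (k x) := by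
    rw [toReal_eLpNorm_sq hkL, ← integral_const_mul]
    refine integral_mono ((hkL.integrable_norm_pow two_ne_zero).const_mul _) iA fun x => ?_
    have b1 := abs_matForm_le (h1 x) (k x) (k x)
    have b2 : matForm (A x) (k x) (k x) = ‖k x‖ ^ 2 + matForm (A x - 1) (k x) (k x) := by
      rw [matForm_sub, matForm_one, real_inner_self_eq_norm_sq]
      ring
    have b3 := (abs_le.1 b1).1
    -- Here `9 * η ≤ 1 / 2` is used.
    have b4 : ‖k x‖ ^ 2 / 2 ≤ matForm (A x) (k x) (k x) := by
      rw [b2]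
      nlinarith [sq_nonneg ‖k x‖]
    calc c / 2 * ‖k x‖ ^ 2 = c * (‖k x‖ ^ 2 / 2) := by ring
      _ ≤ a x * matForm (A x) (k x) (k x) :=
          mul_le_mul (hca x) b4 (by positivity) (hc.trans (hca x))
  have u1 := (abs_le.1 (abs_integral_coeff_matForm_le hC h2 hg₀ hkL)).1
  have u2 := (abs_le.1 (abs_integral_coeff_matForm_le hC h1 hgz hkL)).1
  rw [key] at lower
  set N := (eLpNorm k 2 volume).toReal with hN
  have hN0 : 0 ≤ N := ENNReal.toReal_nonneg
  set N₀ := (eLpNorm g₀ 2 volume).toReal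
  set N₁ := (eLpNorm gz 2 volume).toReal
  have hN0' : 0 ≤ N₀ := ENNReal.toReal_nonneg
  have hN1' : 0 ≤ N₁ := ENNReal.toReal_nonneg
  have total : (c / 2 * N) * N ≤ (ρ + C * (9 * η) * (N₀ + N₁)) * N := by
    linarith [lower, H, u1, u2]
  rcases hN0.eq_or_lt with h | h
  · rw [← h, mul_zero]
    positivity
  · exact le_of_mul_le_mul_right total h

/-- The difference quotient of the solutions, transported to the unperturbed partition, lies in
`H¹_w(ℝ³)`. -/
lemma HasWGrad.diffQuot {V : E → E} {ε : ℝ} {T : E ≃ₜ E} (hT : (T : E → E) = perturbMap V ε)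
    {K : NNReal} (hbi : IsBiLipschitz T K) {u : ℝ → E → ℝ} {g₀ g : E → E} (h₀ : HasWGrad (u 0) g₀)
    (h : HasWGrad (u ε) g) :
    HasWGrad (diffQuot V u ε) fun x => ε⁻¹ • (pullGrad T g x - g₀ x) := by
  refine (((h.comp hbi).sub h₀).const_mul ε⁻¹).congr (Eventually.of_forall fun x => ?_)
    (EventuallyEq.refl _ _)
  simp only [Transmission.diffQuot, hT, div_eq_inv_mul]

/-- The gradient of the error of the difference quotients tends to zero. -/
lemma eventually_norm_grad_error_le {D : Set E} (hD : IsNiceDomain D) {αm αp : ℝ} (hαm : 0 < αm)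
    (hαp : 0 < αp) {V : E → E} {L : NNReal} (hV : LipschitzWith L V) (hVc : HasCompactSupport V)
    {f : E → ℝ} (hfL : MemLp f 2 volume) {gf : E → E} (hf : HasWGrad f gf) {F : PairSpace →L[ℝ] ℝ}
    (hF : ∀ φ, ∀ hφ : IsTest φ, F hφ.hasWGrad.toPair = ∫ x, f x * φ x) {u : ℝ → E → ℝ}
    (h₀ : IsWeakSolution D αm αp f (u 0))
    (hu : ∀ᶠ ε in 𝓝[>] (0 : ℝ), IsWeakSolution (perturbMap V ε '' D) αm αp f (u ε)) {z : E → ℝ}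
    (hz : SolvesDerivativeProblem D αm αp V f (u 0) z) {δ : ℝ} (hδ : 0 < δ) :
    ∀ᶠ ε in 𝓝[>] (0 : ℝ), MemW D (diffQuot V u ε) ∧
      ∃ k, HasWGrad (diffQuot V u ε - z) k ∧ (eLpNorm k 2 volume).toReal ≤ δ := by
  obtain ⟨g₀, hg₀, he₀⟩ := (isWeakSolution_iff hD hF).1 h₀
  obtain ⟨gz, hgz, hze⟩ := (solvesDerivativeProblem_iff hD hV hVc hf hg₀).1 hz
  obtain ⟨c', hc'⟩ := exists_matCoefDeriv_le hV
  set c := min αm αp with hc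
  have hc0 : 0 < c := lt_min hαm hαp
  set C := max |αm| |αp| with hC
  have hC0 : 0 ≤ C := (abs_nonneg _).trans (le_max_left _ _)
  set N := (eLpNorm g₀ 2 volume).toReal + (eLpNorm gz 2 volume).toReal with hN
  have hN0 : 0 ≤ N := add_nonneg ENNReal.toReal_nonneg ENNReal.toReal_nonneg
  -- With these bounds the energy estimate gives `c / 2 * ‖k‖ ≤ c * δ / 4 + c * δ / 4`.
  set ρ := c * δ / 4 with hρ
  set η := min (1 / 18) (c * δ / (36 * (C + 1) * (N + 1))) with hη
  have hρ0 : 0 < ρ := by positivity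
  have hη0 : 0 < η := lt_min (by norm_num) (by positivity)
  filter_upwards [hu, eventually_mul_le (L := L), eventually_pertMat hV hη0,
    eventually_pertDet hV (show (0 : ℝ) < 1 / 2 by norm_num),
    hf.eventually_rhs_le hV hVc hfL hρ0] with ε h1 h2 h3 h4 h5
  obtain ⟨T, hT, hbi⟩ := exists_homeomorph_perturbMap hV h2.1.le h2.2
  rw [← hT] at h1
  obtain ⟨g, hg, hge⟩ := (isWeakSolution_iff (hD.image hbi) hF).1 h1
  have hdq := HasWGrad.diffQuot hT hbi hg₀ hg
  have hw := hdq.sub hgz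
  have hdet : ∀ x, pertDet V ε x ≠ 0 := fun x h => by
    have := (h4 x).1
    rw [h] at this
    norm_num at this
  refine ⟨hdq.memW hD, _, hw, ?_⟩
  have I := transformed_equation hV hVc hT hbi hdet hfL hF hge hw
  have I₀ := he₀ _ _ hw
  have Iz := hze _ _ hw
  have hρw := h5 _ _ hw
  rw [← hT] at hρw
  have est := norm_quotient_error_le (measurable_coeff hD.isOpen.measurableSet αm αp) hc0.le
    (min_le_coeff D αm αp) (abs_coeff_le D αm αp) (measurable_pertMat V ε)
    (measurable_matCoefDeriv_jacMat V) (min_le_left _ _) (fun x i j => (h3 x i j).1)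
    (fun x i j => (h3 x i j).2) hc' (hg.comp hbi).memLp_grad hg₀.memLp_grad hgz.memLp_grad
    (fun _ => rfl) (ρ := ρ) (by
      rw [I, I₀, Iz, add_sub_cancel_left]
      linarith [(abs_le.1 hρw).2]) hρ0.le
  have hηN : C * (9 * η) * N ≤ c * δ / 4 := by
    calc C * (9 * η) * N ≤ (C + 1) * (9 * (c * δ / (36 * (C + 1) * (N + 1)))) * (N + 1) := by
          have := min_le_right (1 / 18) (c * δ / (36 * (C + 1) * (N + 1)))
          gcongr <;> linarith
      _ = c * δ / 4 := by
          field_simp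
          norm_num
  refine le_of_mul_le_mul_left ?_ (half_pos hc0)
  refine est.trans ((add_le_add le_rfl hηN).trans (le_of_eq ?_))
  rw [hρ]
  ring

/-- The solution of the derivative problem is the material derivative: the error converges in `W_0`,
whose norm is controlled by the gradient. -/
lemma hasMaterialDerivative {D : Set E} (hD : IsNiceDomain D) {αm αp : ℝ} (hαm : 0 < αm)
    (hαp : 0 < αp) {V : E → E} {L : NNReal} (hV : LipschitzWith L V) (hVc : HasCompactSupport V)
    {f : E → ℝ} (hfL : MemLp f 2 volume) {gf : E → E} (hf : HasWGrad f gf) {F : PairSpace →L[ℝ] ℝ}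
    (hF : ∀ φ, ∀ hφ : IsTest φ, F hφ.hasWGrad.toPair = ∫ x, f x * φ x) {u : ℝ → E → ℝ}
    (h₀ : IsWeakSolution D αm αp f (u 0))
    (hu : ∀ᶠ ε in 𝓝[>] (0 : ℝ), IsWeakSolution (perturbMap V ε '' D) αm αp f (u ε)) {z : E → ℝ}
    (hz : SolvesDerivativeProblem D αm αp V f (u 0) z) : HasMaterialDerivative D V u z := by
  have key := fun δ hδ => eventually_norm_grad_error_le hD hαm hαp hV hVc hfL hf hF h₀ hu hz
    (δ := δ) hδ
  refine ⟨hz.1, (key 1 one_pos).mono fun ε h => h.1, ?_⟩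
  obtain ⟨M, hM0, hM⟩ := hD.exists_normW_le
  rw [Metric.tendsto_nhds]
  intro δ hδ
  filter_upwards [key (δ / (2 * (M + 1))) (by positivity)] with ε h
  obtain ⟨k, hk, hkn⟩ := h.2
  have hn : 0 ≤ normW D (diffQuot V u ε - z) := Real.sqrt_nonneg _
  rw [Real.dist_eq, sub_zero, abs_of_nonneg hn]
  calc normW D (diffQuot V u ε - z) ≤ M * (δ / (2 * (M + 1))) :=
        (hM _ _ hk).trans (mul_le_mul_of_nonneg_left hkn hM0)
    _ ≤ (M + 1) * (δ / (2 * (M + 1))) := by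
        refine mul_le_mul_of_nonneg_right (by linarith) (by positivity)
    _ = δ / 2 := by field_simp
    _ < δ := half_lt_self hδ

end Transmission


open Transmission
theorem mainTheorem3
    (D : Set E) (hD : IsC11Domain D)
    (αm αp : ℝ) (hαm : 0 < αm) (hαp : 0 < αp)
    (f : E → ℝ) (hf : MemH1 Set.univ f) (hfW : MemDualW D f)
    (n : frontier D → E) (hn : IsOutwardUnitNormal D n)
    (κ : frontier D → ℝ) (hκ : IsC1OnSurface (frontier D) κ)
    (κt : E → ℝ) (hκt : ContDiff ℝ 1 κt) (hκt_supp : HasCompactSupport κt)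
    (hκt_ext : ∀ x : frontier D, κt x = κ x)
    (nt : E → E) (hnt : LocallyLipschitz nt) (hnt_ext : ∀ x : frontier D, nt x = n x)
    (V : E → E) (hV : ∀ x, V x = κt x • nt x) :
    ∃ ε₀ > 0,
      (∀ ε ∈ Set.Icc (0 : ℝ) ε₀,
        IsHomeomorph (perturbMap V ε) ∧
        frontier (perturbMap V ε '' D) = perturbedInterface D κ n ε ∧
        perturbMap V ε '' ext D = ext (perturbMap V ε '' D) ∧
        ∃ u, IsWeakSolution (perturbMap V ε '' D) αm αp f u ∧
          ∀ u', IsWeakSolution (perturbMap V ε '' D) αm αp f u' → u' =ᵐ[volume] u) ∧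
      ∀ u : ℝ → E → ℝ,
        (∀ ε ∈ Set.Icc (0 : ℝ) ε₀, IsWeakSolution (perturbMap V ε '' D) αm αp f (u ε)) →
        ∃ z, HasMaterialDerivative D V u z ∧
          SolvesDerivativeProblem D αm αp V f (u 0) z ∧
          ∀ z', SolvesDerivativeProblem D αm αp V f (u 0) z' → z' =ᵐ[volume] z := by
  have hVe : V = fun x => κt x • nt x := funext hV
  have hVc : HasCompactSupport V := hVe ▸ hκt_supp.smul_right
  obtain ⟨L, hVL⟩ : ∃ L, LipschitzWith L V :=
    Transmission.LocallyLipschitz.exists_lipschitzWith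
      (hVe ▸ locallyLipschitz_smul hκt.locallyLipschitz hnt) hVc
  have hVb : ∀ x : frontier D, V x = κ x • n x := fun x => by rw [hV, hκt_ext, hnt_ext]
  have hDn := hD.isNiceDomain
  have hfL : MemLp f 2 volume := by simpa using hf.1
  obtain ⟨gf, hgf, hgfL⟩ := hf.2
  rw [Measure.restrict_univ] at hgfL
  have hfW' : HasWGrad f gf := hgf.hasWGrad (memLp_div_wt hfL) hgfL
  obtain ⟨F, hF⟩ := hfW.exists_functional hDn hfL
  -- For these `ε` the perturbation of the identity is a contraction with constant `1 / 2`.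
  have hε₀ : ∀ ε ∈ Set.Icc (0 : ℝ) (1 / (2 * (L + 1))), ε * L ≤ 1 / 2 := by
    intro ε hε
    have h1 : ε * L ≤ 1 / (2 * (L + 1)) * L := mul_le_mul_of_nonneg_right hε.2 L.2
    have h2 : 1 / (2 * ((L : ℝ) + 1)) * L ≤ 1 / 2 := by
      have := L.2
      rw [div_mul_eq_mul_div, one_mul, div_le_div_iff₀ (by positivity) (by norm_num)]
      linarith
    exact h1.trans h2
  have hpos : (0 : ℝ) < 1 / (2 * (L + 1)) := by positivity
  refine ⟨1 / (2 * (L + 1)), hpos, fun ε hε => ?_, fun u hu => ?_⟩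
  · obtain ⟨T, hT, hbi⟩ := exists_homeomorph_perturbMap hVL hε.1 (hε₀ ε hε)
    rw [← hT]
    exact ⟨T.isHomeomorph, image_frontier_eq_perturbedInterface hVb hT, image_ext T D,
      exists_isWeakSolution (hDn.image hbi) hαm hαp hF⟩
  · have h₀ : IsWeakSolution D αm αp f (u 0) := by
      have := hu 0 (Set.left_mem_Icc.2 hpos.le)
      rwa [perturbMap_zero, Set.image_id] at this
    have hev : ∀ᶠ ε in 𝓝[>] (0 : ℝ), IsWeakSolution (perturbMap V ε '' D) αm αp f (u ε) :=
      Filter.mem_of_superset (Ioc_mem_nhdsGT hpos) fun ε hε => hu ε ⟨hε.1.le, hε.2⟩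
    obtain ⟨z, hz, hz'⟩ := exists_solvesDerivativeProblem hDn hαm hαp hVL hVc hfW'
      (h₀.1.hasWGrad hDn)
    exact ⟨z, hasMaterialDerivative hDn hαm hαp hVL hVc hfL hfW' hF h₀ hev hz, hz, hz'⟩
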